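/- **Setting.** Let $N$ be a smooth manifold and $0<m<\dim N$. Let $J^k_m(N)$ be the bundle of $k$-jets of $m$-dimensional smooth submanifolds of $N$, i.e. of pairs ($x\in N$, submanifold $L\ni x$) modulo contact of order $k$ at $x$, with its usual topology. For a surjective submersion $F:N\to N'$ and $m'=m-\dim N+\dim N'$, a submanifold $L\subset N$ is called $F$-projected if $L=F^{-1}(F(L))$; let $J^k_{m,F}(N)\subset J^k_m(N)$ be the set of $k$-jets of $m$-dimensional $F$-projected submanifolds, and $F^k:J^k_{m,F}(N)\to J^k_{m'}(N')$ the map sending the $k$-jet of $L$ at $x$ to the $k$-jet of $F(L)$ at $F(x)$. For $E\subset J^k_m(N)$ and $E'\subset J^k_{m'}(N')$, a morphism $(N,E)\to(N',E')$ is a smooth surjective submersion $F:N\to N'$ with $E\cap J^k_{m,F}(N)=(F^k)^{-1}(E')$. The category $\mathcal{PE}$ of second-order parabolic equations has as objects the pairs $(N,E)$ with $N=T\times X\times\Omega$, where $T,\Omega\subset\mathbb R$ are non-empty open intervals, $X$ is a connected smooth manifold of dimension $n\ge 1$, and $E$ is the closure in $J^2_{n+1}(N)$ of the set of $2$-jets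 of graphs of (locally defined, smooth) functions $u=u(t,x)$ satisfying at the given point an equation $$u_t=\sum_{i,j}b^{ij}(t,x,u)u_{ij}+\sum_{i,j}c^{ij}(t,x,u)u_iu_j+\sum_i b^i(t,x,u)u_i+q(t,x,u),$$ whose right-hand side has this form near each point of $N$, in some local coordinates of $X$, with smooth coefficients, $b^{ij}=b^{ji}$ positive definite and $c^{ij}=c^{ji}$. Its morphisms are all morphisms $(N,E)\to(N',E')$ as above; composition is composition of maps. A map $F:T\times X\times\Omega\to T'\times X'\times\Omega'$ is said to have *triangular form* if $$F(t,x,u)=\bigl(t'(t),\,x'(t,x),\,u'(t,x,u)\bigr)$$ with smooth submersions $t':T\to T'$, $x':T\times X\to X'$, $u':T\times X\times\Omega\to\Omega'$. **Theorem.** 1. Every morphism of $\mathcal{PE}$ has triangular form. 2. A morphism of $\mathcal{PE}$ is an isomorphism of $\mathcal{PE}$ if and only if it is a diffeomorphism of triangular form. 3. Let $(N,E)$ be an object of $\mathcal{PE}$, let $N'=T'\times X'\times\Omega'$ with $T',X',\Omega'$ as above, and let $F:N\to N'$ be a map. Then there is an equation $E'$ such that $(N',E')$ is an object of $\mathcal{PE}$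 and $F$ is an isomorphism $(N,E)\to(N',E')$ of $\mathcal{PE}$ if and only if $F$ is a diffeomorphism of triangular form whose component $t'$ is strictly increasing. -/

import Mathlib

open Set Filter Topology TopologicalSpace CategoryTheory
open scoped Manifold ContDiff

universe u

/-! ## Jets of submanifolds

Throughout, `N` is a smooth manifold without boundary with model `I`.  The codimension of submanifolds
is prescribed by a normed space `V`: a submanifold is locally the zero set of a submersion to `V`, so
it has dimension `m = dim N - dim V`.  For hypersurfaces `V = ℝ`. -/

section Jets

variable {E H N : Type*} [NormedAddCommGroup E] [NormedSpace ℝ E] [TopologicalSpace H]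
  [TopologicalSpace N] [ChartedSpace H N]
  {E' H' N' : Type*} [NormedAddCommGroup E'] [NormedSpace ℝ E'] [TopologicalSpace H']
  [TopologicalSpace N'] [ChartedSpace H' N']
  {E'' H'' N'' : Type*} [NormedAddCommGroup E''] [NormedSpace ℝ E''] [TopologicalSpace H'']
  [TopologicalSpace N''] [ChartedSpace H'' N'']

/-- A smooth map whose differential is surjective at each point. -/
def IsSmoothSubmersion (I : ModelWithCorners ℝ E H) (I' : ModelWithCorners ℝ E' H')
    (F : N → N') : Prop :=
  ContMDiff I I' ∞ F ∧ ∀ x, Function.Surjective (mfderiv I I' F x)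

/-- In a neighbourhood of `x` the set `L` is the zero set of the smooth submersion `f`. -/
def IsLocalEquation (I : ModelWithCorners ℝ E H) {V : Type*} [NormedAddCommGroup V]
    [NormedSpace ℝ V] (f : N → V) (L : Set N) (x : N) : Prop :=
  ∃ U : Set N, IsOpen U ∧ x ∈ U ∧ ContMDiffOn I 𝓘(ℝ, V) ∞ f U ∧
    (∀ z ∈ U, Function.Surjective (mfderiv I 𝓘(ℝ, V) f z)) ∧ ∀ z ∈ U, (z ∈ L ↔ f z = 0)

/-- A smooth (embedded, not necessarily closed) submanifold of `N` of codimension `dim V`, together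
with one of its points. -/
@[ext]
structure PointedSubmanifold (I : ModelWithCorners ℝ E H) (N : Type*) [TopologicalSpace N]
    [ChartedSpace H N] (V : Type*) [NormedAddCommGroup V] [NormedSpace ℝ V] where
  pt : N
  carrier : Set N
  pt_mem : pt ∈ carrier
  isSubmanifold : ∀ x ∈ carrier, ∃ f : N → V, IsLocalEquation I f carrier x

/-- The Taylor coefficients at `x`, up to order `k`, of `f : N → V`, in the chart of `N` around `x₀`,
preceded by the coordinates of `x`. -/
noncomputable def taylorCoeffs (I : ModelWithCorners ℝ E H) {V : Type*} [NormedAddCommGroup V]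
    [NormedSpace ℝ V] (k : ℕ) (x₀ : N) (f : N → V) (x : N) :
    E × ((i : Fin (k + 1)) → ContinuousMultilinearMap ℝ (fun _ : Fin i => E) V) :=
  (extChartAt I x₀ x,
    fun i => iteratedFDeriv ℝ i (f ∘ (extChartAt I x₀).symm) (extChartAt I x₀ x))

/-- Contact of order `k` of two submanifolds at a common point: they have local equations with the
same derivatives up to order `k` at that point. -/
def HaveContact (I : ModelWithCorners ℝ E H) {V : Type*} [NormedAddCommGroup V]
    [NormedSpace ℝ V] (k : ℕ) (S₁ S₂ : PointedSubmanifold I N V) : Prop :=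
  S₁.pt = S₂.pt ∧ ∃ f₁ f₂ : N → V,
    IsLocalEquation I f₁ S₁.carrier S₁.pt ∧ IsLocalEquation I f₂ S₂.carrier S₁.pt ∧
    taylorCoeffs I k S₁.pt f₁ S₁.pt = taylorCoeffs I k S₁.pt f₂ S₁.pt

/-- The space `J^k_m(N)` of `k`-jets of submanifolds of `N` of dimension `m = dim N - dim V`:
pointed submanifolds modulo contact of order `k` at the marked point. -/
noncomputable def JetSpace (I : ModelWithCorners ℝ E H) (N : Type*) [TopologicalSpace N]
    [ChartedSpace H N] (V : Type*) [NormedAddCommGroup V] [NormedSpace ℝ V] (k : ℕ) : Type _ :=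
  Quot (HaveContact (N := N) (V := V) I k)

/-- The `k`-jet of a submanifold at its marked point. -/
noncomputable def PointedSubmanifold.jet {I : ModelWithCorners ℝ E H} {V : Type*} [NormedAddCommGroup V]
    [NormedSpace ℝ V] (S : PointedSubmanifold I N V) (k : ℕ) : JetSpace I N V k :=
  Quot.mk _ S

/-- Pointed submanifolds with marked point in the chart domain around `x₀`, equipped with a local
equation at the marked point. -/
def EquippedSubmanifold (I : ModelWithCorners ℝ E H) (V : Type*) [NormedAddCommGroup V]
    [NormedSpace ℝ V] (x₀ : N) : Type _ :=
  {a : PointedSubmanifold I N V × (N → V) //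
    a.1.pt ∈ (chartAt H x₀).source ∧ IsLocalEquation I a.2 a.1.carrier a.1.pt}

/-- The topology of the jet space: the quotient topology of the space of Taylor coefficients (in the
charts of `N`) of local equations.  Thus a set of jets is open iff, over each chart, it corresponds
to a (relatively) open set of Taylor coefficients. -/
noncomputable instance JetSpace.topology (I : ModelWithCorners ℝ E H) (V : Type*) [NormedAddCommGroup V]
    [NormedSpace ℝ V] (k : ℕ) : TopologicalSpace (JetSpace I N V k) :=
  ⨆ x₀ : N, TopologicalSpace.coinduced
    (fun a : EquippedSubmanifold I V x₀ => a.1.1.jet k)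
    (TopologicalSpace.induced
      (fun a : EquippedSubmanifold I V x₀ => taylorCoeffs I k x₀ a.1.2 a.1.1.pt) inferInstance)

/-! ## Morphisms of partial differential equations -/

/-- The graph of the map `F^k : J^k_F(N) → J^k(N')`: the jet `θ` is the jet at some point `x` of an
`F`-projected submanifold `L = F⁻¹(F(L))`, and `θ'` is the jet of the submanifold `F(L)` at `F(x)`. -/
def IsJetLift (I : ModelWithCorners ℝ E H) (I' : ModelWithCorners ℝ E' H') {V : Type*}
    [NormedAddCommGroup V] [NormedSpace ℝ V] {k : ℕ} (F : N → N')
    (θ : JetSpace I N V k) (θ' : JetSpace I' N' V k) : Prop :=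
  ∃ (S : PointedSubmanifold I N V) (S' : PointedSubmanifold I' N' V),
    S.carrier = F ⁻¹' (F '' S.carrier) ∧ S'.carrier = F '' S.carrier ∧ S'.pt = F S.pt ∧
    S.jet k = θ ∧ S'.jet k = θ'

/-- `F` is a morphism of partial differential equations from `(N, 𝓔)` to `(N', 𝓔')`: a surjective
submersion with `𝓔 ∩ J^k_F(N) = (F^k)⁻¹(𝓔')`. -/
structure IsPDEMorphism (I : ModelWithCorners ℝ E H) (I' : ModelWithCorners ℝ E' H') {V : Type*}
    [NormedAddCommGroup V] [NormedSpace ℝ V] {k : ℕ} (F : N → N')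
    (𝓔 : Set (JetSpace I N V k)) (𝓔' : Set (JetSpace I' N' V k)) : Prop where
  submersion : IsSmoothSubmersion I I' F
  surjective : Function.Surjective F
  mem_iff : ∀ θ θ', IsJetLift I I' F θ θ' → (θ ∈ 𝓔 ↔ θ' ∈ 𝓔')

theorem IsPDEMorphism.id (I : ModelWithCorners ℝ E H) {V : Type*}
    [NormedAddCommGroup V] [NormedSpace ℝ V] {k : ℕ} (𝓔 : Set (JetSpace I N V k)) :
    IsPDEMorphism I I (fun x : N => x) 𝓔 𝓔 where
  submersion := ⟨contMDiff_id, fun x => by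
    have h : mfderiv I I (fun x : N => x) x = ContinuousLinearMap.id ℝ (TangentSpace I x) :=
      mfderiv_id
    rw [h]
    exact fun v => ⟨v, rfl⟩⟩
  surjective := fun x => ⟨x, rfl⟩
  mem_iff := by
    rintro θ θ' ⟨S, S', -, h2, h3, rfl, rfl⟩
    have : S' = S := PointedSubmanifold.ext h3 (by simpa using h2)
    rw [this]

theorem IsLocalEquation.comp {I : ModelWithCorners ℝ E H} {I' : ModelWithCorners ℝ E' H'}
    {V : Type*} [NormedAddCommGroup V] [NormedSpace ℝ V] {F : N → N'}
    (hF : IsSmoothSubmersion I I' F) {f : N' → V} {L : Set N'} {x : N}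
    (h : IsLocalEquation I' f L (F x)) : IsLocalEquation I (f ∘ F) (F ⁻¹' L) x := by
  obtain ⟨U, hU, hx, hf, hs, hL⟩ := h
  refine ⟨F ⁻¹' U, hU.preimage hF.1.continuous, hx,
    hf.comp hF.1.contMDiffOn (fun _ hz => hz), fun z hz => ?_, fun z hz => hL (F z) hz⟩
  have h1 : MDifferentiableAt I' 𝓘(ℝ, V) f (F z) :=
    (hf.contMDiffAt (hU.mem_nhds hz)).mdifferentiableAt (by simp)
  have h2 : MDifferentiableAt I I' F z := (hF.1 z).mdifferentiableAt (by simp)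
  rw [mfderiv_comp z h1 h2]
  exact (hs (F z) hz).comp (hF.2 z)

theorem IsPDEMorphism.comp {I : ModelWithCorners ℝ E H} {I' : ModelWithCorners ℝ E' H'}
    {I'' : ModelWithCorners ℝ E'' H''} {V : Type*}
    [NormedAddCommGroup V] [NormedSpace ℝ V] {k : ℕ} {F : N → N'} {G : N' → N''}
    {𝓔 : Set (JetSpace I N V k)} {𝓔' : Set (JetSpace I' N' V k)}
    {𝓔'' : Set (JetSpace I'' N'' V k)}
    (hG : IsPDEMorphism I' I'' G 𝓔' 𝓔'') (hF : IsPDEMorphism I I' F 𝓔 𝓔') :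
    IsPDEMorphism I I'' (fun x => G (F x)) 𝓔 𝓔'' where
  submersion := by
    refine ⟨hG.submersion.1.comp hF.submersion.1, fun x => ?_⟩
    have h1 : MDifferentiableAt I' I'' G (F x) :=
      (hG.submersion.1 (F x)).mdifferentiableAt (by simp)
    have h2 : MDifferentiableAt I I' F x := (hF.submersion.1 x).mdifferentiableAt (by simp)
    have h := mfderiv_comp x h1 h2
    change Function.Surjective (mfderiv I I'' (G ∘ F) x)
    rw [h]
    exact (hG.submersion.2 (F x)).comp (hF.submersion.2 x)
  surjective := hG.surjective.comp hF.surjective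
  mem_iff := by
    rintro θ θ'' ⟨S, S'', h1, h2, h3, rfl, rfl⟩
    have hS : S.carrier = F ⁻¹' (G ⁻¹' S''.carrier) := by rw [h2]; exact h1
    let S' : PointedSubmanifold I' N' V :=
      { pt := F S.pt
        carrier := G ⁻¹' S''.carrier
        pt_mem := by
          have := S''.pt_mem
          rw [h3] at this
          exact this
        isSubmanifold := fun y hy => by
          obtain ⟨f, hf⟩ := S''.isSubmanifold (G y) hy
          exact ⟨f ∘ G, hf.comp hG.submersion⟩ }
    have hS' : S'.carrier = F '' S.carrier := by
      rw [hS, image_preimage_eq _ hF.surjective]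
    have hS'' : S''.carrier = G '' S'.carrier := (image_preimage_eq _ hG.surjective).symm
    rw [hF.mem_iff (S.jet k) (S'.jet k) ⟨S, S', by rw [← hS']; exact hS, hS', rfl, rfl, rfl⟩]
    exact hG.mem_iff _ _ ⟨S', S'', by rw [← hS''], hS'', h3, rfl, rfl⟩

end Jets

/-! ## Parabolic equations -/

/-- The data `T × X × Ω` on which a parabolic equation is posed: open intervals `T`, `Ω` of the real
line and a connected smooth manifold `X` of dimension `n ≥ 1`. -/
structure ParabolicDomain where
  T : Opens ℝ
  isConnected_T : _root_.IsConnected (T : Set ℝ)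
  Ω : Opens ℝ
  isConnected_Ω : _root_.IsConnected (Ω : Set ℝ)
  n : ℕ
  one_le_n : 1 ≤ n
  X : Type u
  [topX : TopologicalSpace X]
  [chartedX : ChartedSpace (EuclideanSpace ℝ (Fin n)) X]
  [manifoldX : IsManifold (𝓡 n) ∞ X]
  [t2X : T2Space X]
  [secondCountableX : SecondCountableTopology X]
  [connectedX : ConnectedSpace X]

namespace ParabolicDomain

attribute [instance] topX chartedX manifoldX t2X secondCountableX connectedX

/-- The manifold `N = T × X × Ω`. -/
abbrev N (M : ParabolicDomain.{u}) : Type u := M.T × M.X × M.Ω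

/-- The product model of `N = T × X × Ω`. -/
noncomputable abbrev I (M : ParabolicDomain.{u}) :=
  (𝓘(ℝ, ℝ)).prod ((𝓡 M.n).prod 𝓘(ℝ, ℝ))

/-- The model of `T × X` (or `ℝ × X`). -/
noncomputable abbrev I₀ (M : ParabolicDomain.{u}) := (𝓘(ℝ, ℝ)).prod (𝓡 M.n)

end ParabolicDomain

/-- The partial derivative with respect to the `i`-th coordinate. -/
noncomputable def partialD {n : ℕ} (i : Fin n) (w : EuclideanSpace ℝ (Fin n) → ℝ)
    (z : EuclideanSpace ℝ (Fin n)) : ℝ :=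
  fderiv ℝ w z (EuclideanSpace.single i 1)

/-- The class `P(X, T, Ω)` of operators `L` on `X` depending on the time `t`.  Here `L t x v` is the
value at `x` of the operator at time `t` applied to a function `v` which is smooth near `x` and has
`v x ∈ Ω`.  In a neighbourhood `W` of each point of `T × X × Ω`, in some local coordinates `φ` of `X`,
`L v = ∑ b^{ij}(t,x,v) v_{ij} + ∑ c^{ij}(t,x,v) v_i v_j + ∑ b^i(t,x,v) v_i + q(t,x,v)` with smooth
coefficients, `b` positive definite (and symmetric), `c` symmetric. -/
def IsParabolicOperator (M : ParabolicDomain.{u}) (L : M.T → M.X → (M.X → ℝ) → ℝ) : Prop :=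
  ∀ p₀ : M.N, ∃ φ ∈ IsManifold.maximalAtlas (𝓡 M.n) ∞ M.X, ∃ W : Set M.N,
    IsOpen W ∧ p₀ ∈ W ∧ (∀ p ∈ W, p.2.1 ∈ φ.source) ∧
    ∃ (b c : M.N → Matrix (Fin M.n) (Fin M.n) ℝ) (β : M.N → Fin M.n → ℝ) (q : M.N → ℝ),
      (∀ i j, ContMDiffOn M.I 𝓘(ℝ, ℝ) ∞ (fun p => b p i j) W) ∧
      (∀ i j, ContMDiffOn M.I 𝓘(ℝ, ℝ) ∞ (fun p => c p i j) W) ∧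
      (∀ i, ContMDiffOn M.I 𝓘(ℝ, ℝ) ∞ (fun p => β p i) W) ∧
      ContMDiffOn M.I 𝓘(ℝ, ℝ) ∞ q W ∧
      (∀ p ∈ W, (b p).PosDef ∧ (c p).IsSymm) ∧
      ∀ p ∈ W, ∀ (v : M.X → ℝ) (U : Set M.X), IsOpen U → p.2.1 ∈ U →
        ContMDiffOn (𝓡 M.n) 𝓘(ℝ, ℝ) ∞ v U → v p.2.1 = p.2.2 →
        L p.1 p.2.1 v =
          ∑ i, ∑ j, b p i j * partialD i (partialD j (v ∘ φ.symm)) (φ p.2.1) +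
          ∑ i, ∑ j, c p i j * partialD i (v ∘ φ.symm) (φ p.2.1) *
            partialD j (v ∘ φ.symm) (φ p.2.1) +
          ∑ i, β p i * partialD i (v ∘ φ.symm) (φ p.2.1) + q p

/-- The equation `u_t = L u` as a set of `2`-jets of graphs of functions `u = s(t, x)`: the jets at
`(t, x, s(t, x))` of graphs of locally defined smooth functions `s` with `s_t = L s` at `(t, x)`. -/
def graphEquation (M : ParabolicDomain.{u}) (L : M.T → M.X → (M.X → ℝ) → ℝ) :
    Set (JetSpace M.I M.N ℝ 2) :=
  {θ | ∃ (S : PointedSubmanifold M.I M.N ℝ) (s : ℝ → M.X → ℝ) (U : Set (ℝ × M.X)),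
    S.jet 2 = θ ∧ IsOpen U ∧ ((S.pt.1 : ℝ), S.pt.2.1) ∈ U ∧
    ContMDiffOn M.I₀ 𝓘(ℝ, ℝ) ∞ (fun y : ℝ × M.X => s y.1 y.2) U ∧
    (∀ᶠ p in 𝓝 S.pt, p ∈ S.carrier ↔ (p.2.2 : ℝ) = s p.1 p.2.1) ∧
    deriv (fun τ => s τ S.pt.2.1) S.pt.1 = L S.pt.1 S.pt.2.1 (s S.pt.1)}

/-- The objects `(T × X × Ω, 𝓔)` of the category of second order parabolic equations: `𝓔` is the
extended version of an equation `u_t = L u`, that is, its closure in the space `J^2_{n+1}(N)` of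
`2`-jets of hypersurfaces of `N = T × X × Ω`. -/
structure ParabolicEquation where
  dom : ParabolicDomain.{u}
  eqn : Set (JetSpace dom.I dom.N ℝ 2)
  isParabolic : ∃ L, IsParabolicOperator dom L ∧ eqn = closure (graphEquation dom L)

/-- The morphisms of parabolic equations: all morphisms of partial differential equations. -/
@[ext]
structure ParabolicEquation.Hom (A B : ParabolicEquation.{u}) where
  toFun : A.dom.N → B.dom.N
  isMorphism : IsPDEMorphism A.dom.I B.dom.I toFun A.eqn B.eqn

/-- The category of second order parabolic equations. -/
instance : Category ParabolicEquation.{u} where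
  Hom A B := ParabolicEquation.Hom A B
  id A := ⟨fun x => x, IsPDEMorphism.id _ _⟩
  comp F G := ⟨fun x => G.toFun (F.toFun x), G.isMorphism.comp F.isMorphism⟩

/-- `F` has the form `(t, x, u) ↦ (t'(t), x'(t, x), u'(t, x, u))` with smooth submersive
`t' : T → T'`, `x' : T × X → X'`, `u' : T × X × Ω → Ω'`. -/
structure HasTriangularForm {M M' : ParabolicDomain.{u}} (F : M.N → M'.N)
    (t' : M.T → M'.T) (x' : M.T × M.X → M'.X) (u' : M.N → M'.Ω) : Prop where
  submersion_t : IsSmoothSubmersion 𝓘(ℝ, ℝ) 𝓘(ℝ, ℝ) t'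
  submersion_x : IsSmoothSubmersion M.I₀ (𝓡 M'.n) x'
  submersion_u : IsSmoothSubmersion M.I 𝓘(ℝ, ℝ) u'
  eq : ∀ t x u, F (t, x, u) = (t' t, x' (t, x), u' (t, x, u))

/-- `F` is a (smooth) diffeomorphism of `N` onto `N'`. -/
def IsDiffeomorphism {M M' : ParabolicDomain.{u}} (F : M.N → M'.N) : Prop :=
  ∃ Φ : Diffeomorph M.I M'.I M.N M'.N ∞, ∀ p, Φ p = F p

/-!
The parabolic equation at a point `(t, x, u)` is turned into a condition on the first and second
derivatives `α`, `H` of an arbitrary local equation `f = 0` of a hypersurface. With the vectors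
`w_i = α_u ∂_i - α_i ∂_u` in the kernel of `α` it reads `P(α, H) = 0`, where `P(α, H) = α_t α_u² -
∑ b_ij H(w_i, w_j) + α_u ∑ c_ij α_i α_j - α_u² ∑ β_i α_i + α_u³ q` (`ParabolicCoeffs.symb`). Since
`P` depends on the choice of `f` only through a non-zero factor
(`ParabolicCoeffs.symb_eq_of_isProportionalJet`), it makes sense for jets of hypersurfaces. The
equation `u_t = L u` is `α_u ≠ 0`, `P = 0` (`LocalForm.jet_mem_graphEquation_iff`); `P = 0` on its
closure, and the closure contains all zeros of `P` whose conormal `α` is not proportional to `dt`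
(`LocalForm.mem_closure_of_symbAt_eq_zero`).

*Triangular form.* Under a morphism with derivatives `D`, `K` at a point, the jet `(α, H)` is
pulled back to `(α ∘ D, H(D, D) + α ∘ K)`, and `IsPDEMorphism.isSymbolMorphism` says that this
relates the zeros of the two symbols away from the multiples of `dt`. If the pull-back of `dt'`
were not a multiple of `dt`, the symbol over it would vanish for every `H`, by approximating `dt'`
by `dt' + ε dx'_k` and `dt' + ε du'`; then `D` kills the vectors `w_i`, which is impossible
(`IsSymbolMorphism.dt_comp_eq`). Thus `t'` depends on `t` only. The jets `(dx'_k + s dt', 0)` have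
vanishing symbol for all `s`, and the symbols of their pull-backs differ by multiples of
`(∂x'_k/∂u)²`; so `x'` does not depend on `u` (`IsSymbolMorphism.dx_comp_eu_eq_zero`). These
statements are local, and `T`, `X`, `Ω` are connected. Finally, positivity of `b` and `b'` forces
`dt'/dt > 0` if `∂u'/∂u ≠ 0` (`IsSymbolMorphism.dt_comp_et_pos`).

*Isomorphisms.* The condition defining morphisms is symmetric under inversion of a diffeomorphism,
so that isomorphisms are the morphisms which are diffeomorphisms.

*Transport.* For a diffeomorphism of triangular form with `dt'/dt > 0` the pull-back of `P` is
again of the form `(∂u'/∂u)² (dt'/dt) P'`, with `P'` the symbol of a parabolic equation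
(`IsTriangularAt.symb_pull`): its leading coefficients are those of `b` transformed by `∂x'/∂x`
and divided by `dt'/dt`, and the terms of lower order are quadratic in the gradient. Hence the
image of an equation `u_t = L u` is again of this form, and since diffeomorphisms act on jet
spaces by homeomorphisms (`JetSpace.pullbackHomeomorph`), the closures correspond as well.
-/

/-! ### Second derivatives and zero sets -/

section Calculus

variable {E F G : Type*} [NormedAddCommGroup E] [NormedSpace ℝ E] [NormedAddCommGroup F]
  [NormedSpace ℝ F] [NormedAddCommGroup G] [NormedSpace ℝ G]

theorem fderiv_fderiv_comp_apply {h : F → G} {g : E → F} {x : E} (hh : ContDiffAt ℝ ∞ h (g x))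
    (hg : ContDiffAt ℝ ∞ g x) (a b : E) :
    fderiv ℝ (fderiv ℝ (h ∘ g)) x a b =
      fderiv ℝ (fderiv ℝ h) (g x) (fderiv ℝ g x a) (fderiv ℝ g x b) +
        fderiv ℝ h (g x) (fderiv ℝ (fderiv ℝ g) x a b) := by
  have hh2 : ContDiffAt ℝ 2 h (g x) := hh.of_le (WithTop.coe_le_coe.2 (le_top : (2 : ℕ∞) ≤ ⊤))
  have hg2 : ContDiffAt ℝ 2 g x := hg.of_le (WithTop.coe_le_coe.2 (le_top : (2 : ℕ∞) ≤ ⊤))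
  have e : fderiv ℝ (h ∘ g) =ᶠ[𝓝 x] fun y => (fderiv ℝ h (g y)).comp (fderiv ℝ g y) := by
    have h1 := hg2.eventually (by simp)
    have h2 := hg2.continuousAt.eventually (hh2.eventually (by simp))
    filter_upwards [h1, h2] with y hy1 hy2
    exact fderiv_comp y (hy2.differentiableAt (by simp)) (hy1.differentiableAt (by simp))
  rw [e.fderiv_eq]
  have dh : DifferentiableAt ℝ (fderiv ℝ h) (g x) :=
    (hh2.fderiv_right (m := 1) (by norm_num)).differentiableAt (by simp)
  have dg : DifferentiableAt ℝ (fderiv ℝ g) x :=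
    (hg2.fderiv_right (m := 1) (by norm_num)).differentiableAt (by simp)
  have dgx : DifferentiableAt ℝ g x := hg2.differentiableAt (by simp)
  have key := (dh.hasFDerivAt.comp x dgx.hasFDerivAt).clm_comp dg.hasFDerivAt
  have key' := key.fderiv
  simp only [Function.comp_def] at key'
  rw [key']
  simp [add_comm]

/-- Two pairs of a covector and a bilinear form are proportional `2`-jets of hypersurfaces: up to a
non-zero factor they agree, the bilinear forms being compared on the kernel of the covector. -/
def IsProportionalJet (α : E →L[ℝ] ℝ) (H : E →L[ℝ] E →L[ℝ] ℝ) (α₁ : E →L[ℝ] ℝ)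
    (H₁ : E →L[ℝ] E →L[ℝ] ℝ) : Prop :=
  ∃ c : ℝ, c ≠ 0 ∧ α₁ = c • α ∧ ∀ a, α a = 0 → H₁ a a = c * H a a

theorem IsProportionalJet.symm {α α₁ : E →L[ℝ] ℝ} {H H₁ : E →L[ℝ] E →L[ℝ] ℝ}
    (h : IsProportionalJet α H α₁ H₁) : IsProportionalJet α₁ H₁ α H := by
  obtain ⟨c, hc, h1, h2⟩ := h
  refine ⟨c⁻¹, inv_ne_zero hc, by rw [h1, smul_smul, inv_mul_cancel₀ hc, one_smul], fun a ha => ?_⟩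
  have : α a = 0 := by
    rw [h1] at ha
    simpa [hc] using ha
  rw [h2 a this, inv_mul_cancel_left₀ hc]

theorem IsProportionalJet.trans {α α₁ α₂ : E →L[ℝ] ℝ} {H H₁ H₂ : E →L[ℝ] E →L[ℝ] ℝ}
    (h : IsProportionalJet α H α₁ H₁) (h' : IsProportionalJet α₁ H₁ α₂ H₂) :
    IsProportionalJet α H α₂ H₂ := by
  obtain ⟨c, hc, h1, h2⟩ := h
  obtain ⟨d, hd, h3, h4⟩ := h'
  refine ⟨d * c, mul_ne_zero hd hc, by rw [h3, h1, smul_smul], fun a ha => ?_⟩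
  rw [h4 a (by simp [h1, ha]), h2 a ha, mul_assoc]

/-- Local equations of the same hypersurface have proportional `2`-jets. In the coordinates
`Ψ(z) = z - z₀ + (f z - Df(z - z₀)) ν` with `Df ν = 1`, the function `f` becomes the linear
function `Df`, so that the other equation vanishes on `ker Df`. -/
theorem isProportionalJet_of_zeros [CompleteSpace E] {f f₁ : E → ℝ} {z₀ : E}
    (hf : ContDiffAt ℝ ∞ f z₀) (hf₁ : ContDiffAt ℝ ∞ f₁ z₀) (h0 : f z₀ = 0)
    (hd : fderiv ℝ f z₀ ≠ 0) (hd₁ : fderiv ℝ f₁ z₀ ≠ 0)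
    (hz : ∀ᶠ z in 𝓝 z₀, (f z = 0 ↔ f₁ z = 0)) :
    IsProportionalJet (fderiv ℝ f z₀) (fderiv ℝ (fderiv ℝ f) z₀) (fderiv ℝ f₁ z₀)
      (fderiv ℝ (fderiv ℝ f₁) z₀) := by
  set α := fderiv ℝ f z₀ with hα
  set α₁ := fderiv ℝ f₁ z₀ with hα₁
  obtain ⟨ν₀, hν₀⟩ : ∃ v, α v ≠ 0 := by
    by_contra! h
    exact hd (ContinuousLinearMap.ext h)
  set ν := (α ν₀)⁻¹ • ν₀ with hν
  have hαν : α ν = 1 := by simp [hν, hν₀]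
  let Ψ : E → E := fun z => z - z₀ + (f z - α (z - z₀)) • ν
  have hΨ0 : Ψ z₀ = 0 := by simp [Ψ, h0]
  have hΨc : ContDiffAt ℝ ∞ Ψ z₀ := by
    have h1 : ContDiffAt ℝ ∞ (fun z : E => z - z₀) z₀ := contDiffAt_id.sub contDiffAt_const
    exact h1.add ((hf.sub (α.contDiff.contDiffAt.comp z₀ h1)).smul contDiffAt_const)
  have hΨd : HasFDerivAt Ψ ((ContinuousLinearEquiv.refl ℝ E : E ≃L[ℝ] E) : E →L[ℝ] E) z₀ := by
    have h1 : HasFDerivAt (fun z : E => z - z₀) (ContinuousLinearMap.id ℝ E) z₀ :=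
      (hasFDerivAt_id z₀).sub_const z₀
    have h2 : HasFDerivAt f α z₀ := (hf.differentiableAt (by simp)).hasFDerivAt
    have h3 := h1.add ((h2.sub (α.hasFDerivAt.comp z₀ h1)).smul_const ν)
    refine h3.congr_fderiv ?_
    ext v
    simp
  have hαΨ : ∀ z, α (Ψ z) = f z := by
    intro z
    simp [Ψ, hαν]
  set c := hΨc.localInverse hΨd (by simp) with hc
  have hcc : ContDiffAt ℝ ∞ c 0 := by
    have := hΨc.to_localInverse hΨd (by simp)
    rwa [hΨ0] at this
  have hstr : HasStrictFDerivAt Ψ _ z₀ := hΨc.hasStrictFDerivAt' hΨd (by simp)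
  have hc0 : c 0 = z₀ := by
    have := hΨc.localInverse_apply_image hΨd (by simp)
    rwa [hΨ0] at this
  have hcd : fderiv ℝ c 0 = ContinuousLinearMap.id ℝ E := by
    have := hstr.to_localInverse.hasFDerivAt
    rw [hΨ0] at this
    exact this.fderiv
  have hr : ∀ᶠ y in 𝓝 (0 : E), Ψ (c y) = y := by
    have := hstr.eventually_right_inverse
    rwa [hΨ0] at this
  have hfc : f ∘ c =ᶠ[𝓝 0] α := by
    filter_upwards [hr] with y hy
    rw [Function.comp_apply, ← hαΨ, hy]
  have hz' : ∀ᶠ y in 𝓝 (0 : E), f (c y) = 0 ↔ f₁ (c y) = 0 := by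
    have : Tendsto c (𝓝 0) (𝓝 z₀) := by
      have := hcc.continuousAt.tendsto
      rwa [hc0] at this
    exact this.eventually hz
  have hg : ∀ᶠ y in 𝓝 (0 : E), α y = 0 → (f₁ ∘ c) y = 0 := by
    filter_upwards [hz', hfc] with y h1 h2 h3
    exact h1.1 (h2.trans h3)
  have hf' : ContDiffAt ℝ ∞ f (c 0) := by rwa [hc0]
  have hf₁' : ContDiffAt ℝ ∞ f₁ (c 0) := by rwa [hc0]
  have hgc : ContDiffAt ℝ ∞ (f₁ ∘ c) 0 := hf₁'.comp 0 hcc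
  have hgd : fderiv ℝ (f₁ ∘ c) 0 = α₁ := by
    rw [fderiv_comp 0 (hf₁'.differentiableAt (by simp)) (hcc.differentiableAt (by simp)), hcd, hc0]
    rfl
  have hline : ∀ a, α a = 0 → α₁ a = 0 ∧ fderiv ℝ (fderiv ℝ (f₁ ∘ c)) 0 a a = 0 := by
    intro a ha
    let l : ℝ →L[ℝ] E := ContinuousLinearMap.toSpanSingleton ℝ a
    have hl0 : l 0 = 0 := by simp
    have e : (f₁ ∘ c) ∘ l =ᶠ[𝓝 0] fun _ => 0 := by
      have : Tendsto l (𝓝 0) (𝓝 0) := by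
        have := l.continuous.tendsto 0
        rwa [hl0] at this
      filter_upwards [this.eventually hg] with s hs
      exact hs (by simp [l, ha])
    have hgc' : ContDiffAt ℝ ∞ (f₁ ∘ c) (l 0) := by rwa [hl0]
    have hlc : ContDiffAt ℝ ∞ l 0 := l.contDiff.contDiffAt
    have e1 : fderiv ℝ ((f₁ ∘ c) ∘ l) 0 = 0 := by
      rw [e.fderiv_eq]; simp
    have e2 : fderiv ℝ (fderiv ℝ ((f₁ ∘ c) ∘ l)) 0 = 0 := by
      rw [e.fderiv.fderiv_eq]
      simp
    have hll : fderiv ℝ (fderiv ℝ l) 0 = 0 := by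
      have : fderiv ℝ l = fun _ => l := by
        ext1 s
        exact l.fderiv
      rw [this]; simp
    constructor
    · rw [fderiv_comp 0 (hgc'.differentiableAt (by simp)) (hlc.differentiableAt (by simp)),
        hl0, hgd] at e1
      simpa [l] using congrArg (fun L : ℝ →L[ℝ] ℝ => L 1) e1
    · have := fderiv_fderiv_comp_apply hgc' hlc 1 1
      rw [e2, hll, hl0] at this
      simpa [l] using this.symm
  have hprop : α₁ = α₁ ν • α := by
    ext v
    have := (hline (v - α v • ν) (by simp [hαν])).1
    simp only [map_sub, map_smul, smul_eq_mul] at this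
    simp only [smul_apply, smul_eq_mul]
    linarith
  refine ⟨α₁ ν, fun h => hd₁ (by rw [hprop, h, zero_smul]), hprop, fun a ha => ?_⟩
  have h1 := fderiv_fderiv_comp_apply hf₁' hcc a a
  have h2 := fderiv_fderiv_comp_apply hf' hcc a a
  rw [(hline a ha).2, hcd, hc0, ← hα₁, hprop] at h1
  have h3 : fderiv ℝ (fderiv ℝ (f ∘ c)) 0 = 0 := by
    rw [hfc.fderiv.fderiv_eq]
    have : fderiv ℝ (α : E → ℝ) = fun _ => α := by
      ext1 s
      exact α.fderiv
    rw [this]; simp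
  rw [h3, hcd, hc0, ← hα] at h2
  simp only [smul_apply, smul_eq_mul, ContinuousLinearMap.coe_id', id_eq,
    zero_apply] at h1 h2
  linear_combination -h1 + (α₁ ν) * h2

/-- A hypersurface with an equation whose derivative in the last direction does not vanish is
locally a graph over the remaining factors. -/
theorem exists_graph_of_fderiv_ne_zero [CompleteSpace E] [CompleteSpace F] {f : E × F × ℝ → ℝ}
    {U : Set (E × F × ℝ)} (hU : IsOpen U) (hf : ContDiffOn ℝ ∞ f U) {z₀ : E × F × ℝ} (hz₀ : z₀ ∈ U)
    (h0 : f z₀ = 0) (hd : fderiv ℝ f z₀ (0, 0, 1) ≠ 0) :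
    ∃ (s : E × F → ℝ) (W : Set (E × F)), IsOpen W ∧ (z₀.1, z₀.2.1) ∈ W ∧ ContDiffOn ℝ ∞ s W ∧
      ∀ᶠ z in 𝓝 z₀, (f z = 0 ↔ z.2.2 = s (z.1, z.2.1)) := by
  let Ψ : E × F × ℝ → E × F × ℝ := fun z => (z.1, z.2.1, f z)
  have hfa : ∀ z ∈ U, ContDiffAt ℝ ∞ f z := fun z hz => hf.contDiffAt (hU.mem_nhds hz)
  have hΨc : ∀ z ∈ U, ContDiffAt ℝ ∞ Ψ z := fun z hz =>
    contDiffAt_fst.prodMk ((contDiff_fst.comp contDiff_snd).contDiffAt.prodMk (hfa z hz))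
  have hΨd : ∀ z ∈ U, fderiv ℝ f z (0, 0, 1) ≠ 0 →
      ∃ A : (E × F × ℝ) ≃L[ℝ] (E × F × ℝ), HasFDerivAt Ψ (A : (E × F × ℝ) →L[ℝ] (E × F × ℝ)) z := by
    intro z hz hm
    set α := fderiv ℝ f z with hα
    set m := α (0, 0, 1) with hm'
    let p1 : (E × F × ℝ) →L[ℝ] E := ContinuousLinearMap.fst ℝ E (F × ℝ)
    let p2 : (E × F × ℝ) →L[ℝ] F := (ContinuousLinearMap.fst ℝ F ℝ).comp
      (ContinuousLinearMap.snd ℝ E (F × ℝ))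
    let p3 : (E × F × ℝ) →L[ℝ] ℝ := (ContinuousLinearMap.snd ℝ F ℝ).comp
      (ContinuousLinearMap.snd ℝ E (F × ℝ))
    let A : (E × F × ℝ) →L[ℝ] (E × F × ℝ) := p1.prod (p2.prod α)
    let B : (E × F × ℝ) →L[ℝ] (E × F × ℝ) := p1.prod (p2.prod (m⁻¹ •
      (p3 - α.comp (p1.prod (p2.prod 0)))))
    have hdec : ∀ v : E × F × ℝ, α v = α (v.1, v.2.1, 0) + v.2.2 * m := by
      rintro ⟨a, b, r⟩
      have : ((a, b, r) : E × F × ℝ) = (a, b, 0) + r • (0, 0, 1) := by simp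
      rw [this, map_add, map_smul]
      simp [hm']
    refine ⟨ContinuousLinearEquiv.equivOfInverse A B (fun v => ?_) (fun v => ?_), ?_⟩
    · ext
      · rfl
      · rfl
      · change m⁻¹ * (α v - α (v.1, v.2.1, 0)) = v.2.2
        rw [hdec v]
        field_simp
        ring
    · ext
      · rfl
      · rfl
      · change α (v.1, v.2.1, m⁻¹ * (v.2.2 - α (v.1, v.2.1, 0))) = v.2.2
        rw [hdec]
        field_simp
        ring
    · exact p1.hasFDerivAt.prodMk (p2.hasFDerivAt.prodMk
        ((hfa z hz).differentiableAt (by simp)).hasFDerivAt)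
  obtain ⟨A₀, hA₀⟩ := hΨd z₀ hz₀ hd
  set P := (hΨc z₀ hz₀).toOpenPartialHomeomorph Ψ hA₀ (by simp) with hP
  have hPcoe : (P : E × F × ℝ → E × F × ℝ) = Ψ := rfl
  have hsrc : z₀ ∈ P.source := (hΨc z₀ hz₀).mem_toOpenPartialHomeomorph_source hA₀ (by simp)
  set O : Set (E × F × ℝ) := {z | z ∈ U ∧ fderiv ℝ f z (0, 0, 1) ≠ 0} with hO
  have hOo : IsOpen O := by
    have hc : ContinuousOn (fun z => fderiv ℝ f z (0, 0, 1)) U :=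
      (hf.continuousOn_fderiv_of_isOpen hU (by simp)).clm_apply continuousOn_const
    exact hc.isOpen_inter_preimage hU isOpen_compl_singleton
  let i : E × F → E × F × ℝ := fun y => (y.1, y.2, 0)
  have hic : ContDiff ℝ ∞ i := contDiff_fst.prodMk (contDiff_snd.prodMk contDiff_const)
  let Q : Set (E × F × ℝ) := P.target ∩ P.symm ⁻¹' O
  have hQ : IsOpen Q := P.symm.isOpen_inter_preimage hOo
  have hΨz₀ : Ψ z₀ = i (z₀.1, z₀.2.1) := by simp [Ψ, i, h0]
  have hΨt : i (z₀.1, z₀.2.1) ∈ P.target := by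
    rw [← hΨz₀]; exact P.map_source hsrc
  have hback : P.symm (i (z₀.1, z₀.2.1)) = z₀ := by
    rw [← hΨz₀]; exact P.left_inv hsrc
  refine ⟨fun y => (P.symm (i y)).2.2, i ⁻¹' Q, hQ.preimage hic.continuous, ?_, ?_, ?_⟩
  · refine ⟨hΨt, ?_⟩
    change P.symm (i (z₀.1, z₀.2.1)) ∈ O
    rw [hback]
    exact ⟨hz₀, hd⟩
  · intro y hy
    obtain ⟨A, hA⟩ := hΨd _ hy.2.1 hy.2.2
    have h1 : ContDiffAt ℝ ∞ P.symm (i y) := P.contDiffAt_symm hy.1 hA (hΨc _ hy.2.1)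
    have h2 : ContDiffAt ℝ ∞ (fun y => P.symm (i y)) y := h1.comp y hic.contDiffAt
    exact ((contDiff_snd.comp contDiff_snd).contDiffAt.comp y h2).contDiffWithinAt
  · have hj : Continuous (fun z : E × F × ℝ => i (z.1, z.2.1)) := by fun_prop
    have h1 : ∀ᶠ z in 𝓝 z₀, i (z.1, z.2.1) ∈ P.target ∧ P.symm (i (z.1, z.2.1)) ∈ P.source := by
      have : ∀ᶠ w in 𝓝 (i (z₀.1, z₀.2.1)), w ∈ P.target ∧ P.symm w ∈ P.source := by
        filter_upwards [P.open_target.mem_nhds hΨt] with w hw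
        exact ⟨hw, P.map_target hw⟩
      exact hj.continuousAt.eventually this
    filter_upwards [h1, P.open_source.mem_nhds hsrc] with z hz1 hz2
    constructor
    · intro hfz
      have : Ψ z = i (z.1, z.2.1) := by simp [Ψ, i, hfz]
      change z.2.2 = (P.symm (i (z.1, z.2.1))).2.2
      rw [← this]
      exact congrArg (fun w : E × F × ℝ => w.2.2) (P.left_inv hz2).symm
    · intro hzs
      have hr : Ψ (P.symm (i (z.1, z.2.1))) = i (z.1, z.2.1) := P.right_inv hz1.1
      have hz : z = P.symm (i (z.1, z.2.1)) := by
        have h1 := congrArg (fun w : E × F × ℝ => w.1) hr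
        have h2 := congrArg (fun w : E × F × ℝ => w.2.1) hr
        simp only [Ψ, i] at h1 h2
        ext
        · exact h1.symm
        · exact h2.symm
        · exact hzs
      have := congrArg (fun w : E × F × ℝ => w.2.2) hr
      simp only [Ψ] at this
      rw [← hz] at this
      simpa [i] using this

end Calculus

/-! ### Jets of hypersurfaces in local coordinates -/

section Coordinates

variable {E H N : Type*} [NormedAddCommGroup E] [NormedSpace ℝ E] [TopologicalSpace H]
  [TopologicalSpace N] [ChartedSpace H N] {I : ModelWithCorners ℝ E H}
  {E' H' N' : Type*} [NormedAddCommGroup E'] [NormedSpace ℝ E'] [TopologicalSpace H']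
  [TopologicalSpace N'] [ChartedSpace H' N'] {I' : ModelWithCorners ℝ E' H'}
  {B B' : Type*} [NormedAddCommGroup B] [NormedSpace ℝ B] [NormedAddCommGroup B'] [NormedSpace ℝ B']

/-- Smooth local coordinates on a manifold with values in a normed space `B`. They need not come from
a chart of the atlas, so that product coordinates on a product manifold are included. -/
structure Coordinates (I : ModelWithCorners ℝ E H) (N : Type*) [TopologicalSpace N]
    [ChartedSpace H N] (B : Type*) [NormedAddCommGroup B] [NormedSpace ℝ B]
    extends PartialEquiv N B where
  open_source : IsOpen source
  open_target : IsOpen target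
  contMDiffOn_toFun : ContMDiffOn I 𝓘(ℝ, B) ∞ toFun source
  contMDiffOn_invFun : ContMDiffOn 𝓘(ℝ, B) I ∞ invFun target

namespace Coordinates

/-- The coordinates given by a preferred chart. -/
noncomputable def ofChart (I : ModelWithCorners ℝ E H) [I.Boundaryless] [IsManifold I ∞ N] (x₀ : N) :
    Coordinates I N E where
  toPartialEquiv := extChartAt I x₀
  open_source := isOpen_extChartAt_source x₀
  open_target := isOpen_extChartAt_target x₀
  contMDiffOn_toFun := by
    have := contMDiffOn_extChartAt (I := I) (n := ∞) (x := x₀)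
    rwa [← extChartAt_source I] at this
  contMDiffOn_invFun := contMDiffOn_extChartAt_symm x₀

variable (e : Coordinates I N B) (e' : Coordinates I' N' B')

/-- The differential of a function in coordinates. -/
noncomputable def d1 (f : N → ℝ) (x : N) : B →L[ℝ] ℝ :=
  fderiv ℝ (f ∘ e.toPartialEquiv.symm) (e.toPartialEquiv x)

/-- The second derivative of a function in coordinates. -/
noncomputable def d2 (f : N → ℝ) (x : N) : B →L[ℝ] B →L[ℝ] ℝ :=
  fderiv ℝ (fderiv ℝ (f ∘ e.toPartialEquiv.symm)) (e.toPartialEquiv x)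

/-- The coordinate expression of a map. -/
def rep (F : N → N') : B → B' := e'.toPartialEquiv ∘ F ∘ e.toPartialEquiv.symm

variable {e e'}

theorem contMDiffAt_toFun {x : N} (hx : x ∈ e.source) :
    ContMDiffAt I 𝓘(ℝ, B) ∞ e.toPartialEquiv x :=
  e.contMDiffOn_toFun.contMDiffAt (e.open_source.mem_nhds hx)

theorem contMDiffAt_symm {z : B} (hz : z ∈ e.target) :
    ContMDiffAt 𝓘(ℝ, B) I ∞ e.toPartialEquiv.symm z :=
  e.contMDiffOn_invFun.contMDiffAt (e.open_target.mem_nhds hz)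

theorem contMDiffAt_symm_apply {x : N} (hx : x ∈ e.source) :
    ContMDiffAt 𝓘(ℝ, B) I ∞ e.toPartialEquiv.symm (e.toPartialEquiv x) :=
  contMDiffAt_symm (e.map_source hx)

theorem continuousAt_symm_apply {x : N} (hx : x ∈ e.source) :
    ContinuousAt e.toPartialEquiv.symm (e.toPartialEquiv x) :=
  (contMDiffAt_symm_apply hx).continuousAt

theorem tendsto_symm {x : N} (hx : x ∈ e.source) :
    Tendsto e.toPartialEquiv.symm (𝓝 (e.toPartialEquiv x)) (𝓝 x) := by
  have := (continuousAt_symm_apply hx).tendsto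
  rwa [e.left_inv hx] at this

theorem contDiffAt_comp_symm {f : N → B'} {x : N} (hx : x ∈ e.source)
    (hf : ContMDiffAt I 𝓘(ℝ, B') ∞ f x) :
    ContDiffAt ℝ ∞ (f ∘ e.toPartialEquiv.symm) (e.toPartialEquiv x) := by
  rw [← contMDiffAt_iff_contDiffAt]
  refine ContMDiffAt.comp _ ?_ (contMDiffAt_symm_apply hx)
  rwa [e.left_inv hx]

theorem contDiffAt_rep {F : N → N'} {x : N} (hx : x ∈ e.source) (hFx : F x ∈ e'.source)
    (hF : ContMDiffAt I I' ∞ F x) : ContDiffAt ℝ ∞ (e.rep e' F) (e.toPartialEquiv x) :=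
  contDiffAt_comp_symm (f := e'.toPartialEquiv ∘ F) hx ((contMDiffAt_toFun hFx).comp x hF)

theorem rep_apply {F : N → N'} {x : N} (hx : x ∈ e.source) :
    e.rep e' F (e.toPartialEquiv x) = e'.toPartialEquiv (F x) := by
  simp [rep, e.left_inv hx]

theorem comp_symm_eventuallyEq {F : N → N'} {x : N} (hx : x ∈ e.source) (hFx : F x ∈ e'.source)
    (hF : ContinuousAt F x) (f : N' → ℝ) :
    (f ∘ F) ∘ e.toPartialEquiv.symm =ᶠ[𝓝 (e.toPartialEquiv x)]
      (f ∘ e'.toPartialEquiv.symm) ∘ e.rep e' F := by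
  have h := (hF.tendsto.comp (tendsto_symm hx)).eventually (e'.open_source.mem_nhds hFx)
  filter_upwards [h] with z hz
  simp only [rep, Function.comp_apply] at hz ⊢
  rw [e'.left_inv hz]

theorem d1_comp {F : N → N'} {x : N} (hx : x ∈ e.source) (hFx : F x ∈ e'.source)
    (hF : ContMDiffAt I I' ∞ F x) {f : N' → ℝ} (hf : ContMDiffAt I' 𝓘(ℝ, ℝ) ∞ f (F x)) :
    e.d1 (f ∘ F) x = (e'.d1 f (F x)).comp (fderiv ℝ (e.rep e' F) (e.toPartialEquiv x)) := by
  have h1 := contDiffAt_rep hx hFx hF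
  have h2 := contDiffAt_comp_symm hFx hf
  rw [← rep_apply (e' := e') hx] at h2
  rw [d1, (comp_symm_eventuallyEq hx hFx hF.continuousAt f).fderiv_eq,
    fderiv_comp _ (h2.differentiableAt (by simp)) (h1.differentiableAt (by simp)),
    rep_apply hx]
  rfl

theorem d2_comp {F : N → N'} {x : N} (hx : x ∈ e.source) (hFx : F x ∈ e'.source)
    (hF : ContMDiffAt I I' ∞ F x) {f : N' → ℝ} (hf : ContMDiffAt I' 𝓘(ℝ, ℝ) ∞ f (F x)) (a b : B) :
    e.d2 (f ∘ F) x a b =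
      e'.d2 f (F x) (fderiv ℝ (e.rep e' F) (e.toPartialEquiv x) a)
        (fderiv ℝ (e.rep e' F) (e.toPartialEquiv x) b) +
      e'.d1 f (F x) (fderiv ℝ (fderiv ℝ (e.rep e' F)) (e.toPartialEquiv x) a b) := by
  have h1 := contDiffAt_rep hx hFx hF
  have h2 := contDiffAt_comp_symm hFx hf
  rw [← rep_apply (e' := e') hx] at h2
  rw [d2, (comp_symm_eventuallyEq hx hFx hF.continuousAt f).fderiv.fderiv_eq,
    fderiv_fderiv_comp_apply h2 h1, rep_apply hx]
  rfl

theorem surjective_mfderiv_iff {f : N → ℝ} {x : N} (hx : x ∈ e.source)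
    (hf : ContMDiffAt I 𝓘(ℝ, ℝ) ∞ f x) :
    Function.Surjective (mfderiv I 𝓘(ℝ, ℝ) f x) ↔ e.d1 f x ≠ 0 := by
  have hs := contMDiffAt_symm_apply hx
  have h1 : e.d1 f x = (mfderiv I 𝓘(ℝ, ℝ) f x : E →L[ℝ] ℝ).comp
      (mfderiv 𝓘(ℝ, B) I e.toPartialEquiv.symm (e.toPartialEquiv x)) := by
    have hf' : ContMDiffAt I 𝓘(ℝ, ℝ) ∞ f (e.toPartialEquiv.symm (e.toPartialEquiv x)) := by
      rwa [e.left_inv hx]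
    have := mfderiv_comp (e.toPartialEquiv x) (hf'.mdifferentiableAt (by simp))
      (hs.mdifferentiableAt (by simp))
    rw [mfderiv_eq_fderiv, e.left_inv hx] at this
    exact this
  have h2 : (mfderiv I 𝓘(ℝ, ℝ) f x : E →L[ℝ] ℝ) =
      (e.d1 f x).comp (mfderiv I 𝓘(ℝ, B) e.toPartialEquiv x : E →L[ℝ] B) := by
    have hc := contMDiffAt_toFun hx
    have hg : ContMDiffAt 𝓘(ℝ, B) 𝓘(ℝ, ℝ) ∞ (f ∘ e.toPartialEquiv.symm) (e.toPartialEquiv x) :=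
      (contDiffAt_comp_symm hx hf).contMDiffAt
    have := mfderiv_comp x (hg.mdifferentiableAt (by simp)) (hc.mdifferentiableAt (by simp))
    rw [mfderiv_eq_fderiv] at this
    have h3 : f =ᶠ[𝓝 x] (f ∘ e.toPartialEquiv.symm) ∘ e.toPartialEquiv := by
      filter_upwards [e.open_source.mem_nhds hx] with y hy
      simp [e.left_inv hy]
    exact (h3.mfderiv_eq).trans this
  constructor
  · intro hsurj h0
    obtain ⟨v, hv⟩ := hsurj (1 : ℝ)
    have : (mfderiv I 𝓘(ℝ, ℝ) f x : E →L[ℝ] ℝ) v =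
        e.d1 f x ((mfderiv I 𝓘(ℝ, B) e.toPartialEquiv x : E →L[ℝ] B) v) :=
      congrArg (fun l : E →L[ℝ] ℝ => l v) h2
    rw [h0] at this
    exact one_ne_zero (α := ℝ) (hv.symm.trans this)
  · intro h0 (r : ℝ)
    obtain ⟨v, hv⟩ : ∃ v, e.d1 f x v ≠ 0 := by
      by_contra! h
      exact h0 (ContinuousLinearMap.ext h)
    refine ⟨(mfderiv 𝓘(ℝ, B) I e.toPartialEquiv.symm (e.toPartialEquiv x) :
      B →L[ℝ] E) ((r / e.d1 f x v) • v), ?_⟩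
    have := congrArg (fun l : B →L[ℝ] ℝ => l ((r / e.d1 f x v) • v)) h1
    rw [map_smul, smul_eq_mul, div_mul_cancel₀ _ hv] at this
    exact this.symm

theorem eventually_d1_ne_zero {f : N → ℝ} {x : N} (hx : x ∈ e.source) {U : Set N} (hU : IsOpen U)
    (hxU : x ∈ U) (hf : ContMDiffOn I 𝓘(ℝ, ℝ) ∞ f U) (h : e.d1 f x ≠ 0) :
    ∀ᶠ y in 𝓝 x, e.d1 f y ≠ 0 := by
  have h1 : ContDiffAt ℝ 1 (f ∘ e.toPartialEquiv.symm) (e.toPartialEquiv x) :=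
    (contDiffAt_comp_symm hx (hf.contMDiffAt (hU.mem_nhds hxU))).of_le
      (WithTop.coe_le_coe.2 (le_top : (1 : ℕ∞) ≤ ⊤))
  have h2 : ContinuousAt (fderiv ℝ (f ∘ e.toPartialEquiv.symm)) (e.toPartialEquiv x) :=
    (h1.fderiv_right (m := 0) (by norm_num)).continuousAt
  exact ((h2.comp (contMDiffAt_toFun hx).continuousAt).tendsto).eventually_ne h

end Coordinates

/-! ### Hypersurfaces and their local equations -/

open Coordinates

theorem IsLocalEquation.contMDiffAt {V : Type*} [NormedAddCommGroup V] [NormedSpace ℝ V] {f : N → V}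
    {L : Set N} {x : N} (h : IsLocalEquation I f L x) : ContMDiffAt I 𝓘(ℝ, V) ∞ f x := by
  obtain ⟨U, hU, hx, hf, -⟩ := h
  exact hf.contMDiffAt (hU.mem_nhds hx)

theorem IsLocalEquation.eventually_iff {V : Type*} [NormedAddCommGroup V] [NormedSpace ℝ V]
    {f : N → V} {L : Set N} {x : N} (h : IsLocalEquation I f L x) :
    ∀ᶠ z in 𝓝 x, (z ∈ L ↔ f z = 0) := by
  obtain ⟨U, hU, hx, -, -, hL⟩ := h
  filter_upwards [hU.mem_nhds hx] with z hz using hL z hz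

theorem IsLocalEquation.d1_ne_zero {f : N → ℝ} {L : Set N} {x : N} (h : IsLocalEquation I f L x)
    {e : Coordinates I N B} (hx : x ∈ e.source) : e.d1 f x ≠ 0 := by
  rw [← surjective_mfderiv_iff hx h.contMDiffAt]
  obtain ⟨U, -, hxU, -, hs, -⟩ := h
  exact hs x hxU

theorem IsLocalEquation.congr {V : Type*} [NormedAddCommGroup V] [NormedSpace ℝ V] {f : N → V}
    {L L' : Set N} {x : N} (h : IsLocalEquation I f L x) (hL : ∀ᶠ z in 𝓝 x, (z ∈ L ↔ z ∈ L')) :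
    IsLocalEquation I f L' x := by
  obtain ⟨U, hU, hx, hf, hs, hz⟩ := h
  obtain ⟨O, hO, hOo, hxO⟩ := eventually_nhds_iff.1 hL
  exact ⟨U ∩ O, hU.inter hOo, ⟨hx, hxO⟩, hf.mono inter_subset_left, fun z hz => hs z hz.1,
    fun z hzz => (hO z hzz.2).symm.trans (hz z hzz.1)⟩

theorem isLocalEquation_of_d1_ne_zero {f : N → ℝ} {L : Set N} {x : N} {e : Coordinates I N B}
    (hx : x ∈ e.source) {U : Set N} (hU : IsOpen U) (hxU : x ∈ U)
    (hf : ContMDiffOn I 𝓘(ℝ, ℝ) ∞ f U) (h : e.d1 f x ≠ 0)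
    (hL : ∀ᶠ z in 𝓝 x, (z ∈ L ↔ f z = 0)) : IsLocalEquation I f L x := by
  have h1 := eventually_d1_ne_zero hx hU hxU hf h
  obtain ⟨O, hO, hOo, hxO⟩ := eventually_nhds_iff.1
    ((h1.and hL).and ((hU.eventually_mem hxU).and (e.open_source.eventually_mem hx)))
  refine ⟨O, hOo, hxO, hf.mono fun y hy => (hO y hy).2.1, fun z hz => ?_, fun z hz => (hO z hz).1.2⟩
  rw [surjective_mfderiv_iff (hO z hz).2.2 (hf.contMDiffAt (hU.mem_nhds (hO z hz).2.1))]
  exact (hO z hz).1.1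

/-- The zero set of a function whose differential does not vanish at `x`, cut down to a
neighbourhood of `x` on which it is a hypersurface. -/
theorem PointedSubmanifold.exists_of_d1_ne_zero {f : N → ℝ} {x : N} {e : Coordinates I N B}
    (hx : x ∈ e.source) {U : Set N} (hU : IsOpen U) (hxU : x ∈ U)
    (hf : ContMDiffOn I 𝓘(ℝ, ℝ) ∞ f U) (h0 : f x = 0) (h : e.d1 f x ≠ 0) :
    ∃ S : PointedSubmanifold I N ℝ, S.pt = x ∧ IsLocalEquation I f S.carrier x := by
  have h1 := eventually_d1_ne_zero hx hU hxU hf h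
  obtain ⟨O, hO, hOo, hxO⟩ := eventually_nhds_iff.1
    (h1.and ((hU.eventually_mem hxU).and (e.open_source.eventually_mem hx)))
  have key : ∀ y ∈ O, IsLocalEquation I f {z | z ∈ O ∧ f z = 0} y := fun y hy =>
    isLocalEquation_of_d1_ne_zero (hO y hy).2.2 hU (hO y hy).2.1 hf (hO y hy).1 (by
      filter_upwards [hOo.mem_nhds hy] with z hz
      simp [hz])
  exact ⟨⟨x, {z | z ∈ O ∧ f z = 0}, ⟨hxO, h0⟩, fun y hy => ⟨f, key y hy.1⟩⟩, rfl, key x hxO⟩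

theorem PointedSubmanifold.jet_eq_of_eventually {S₁ S₂ : PointedSubmanifold I N ℝ} (k : ℕ)
    (hpt : S₁.pt = S₂.pt) (h : ∀ᶠ z in 𝓝 S₁.pt, (z ∈ S₁.carrier ↔ z ∈ S₂.carrier)) :
    S₁.jet k = S₂.jet k := by
  obtain ⟨f, hf⟩ := S₁.isSubmanifold S₁.pt S₁.pt_mem
  exact Quot.sound ⟨hpt, f, f, hf, hf.congr h, rfl⟩

theorem isProportionalJet_of_isLocalEquation [CompleteSpace B] {f f₁ : N → ℝ} {L : Set N} {x : N}
    {e : Coordinates I N B} (hx : x ∈ e.source) (hxL : x ∈ L) (h : IsLocalEquation I f L x)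
    (h₁ : IsLocalEquation I f₁ L x) :
    IsProportionalJet (e.d1 f x) (e.d2 f x) (e.d1 f₁ x) (e.d2 f₁ x) := by
  refine isProportionalJet_of_zeros (contDiffAt_comp_symm hx h.contMDiffAt)
    (contDiffAt_comp_symm hx h₁.contMDiffAt) ?_ (h.d1_ne_zero hx) (h₁.d1_ne_zero hx) ?_
  · rw [Function.comp_apply, e.left_inv hx]
    exact h.eventually_iff.self_of_nhds.1 hxL
  · filter_upwards [(tendsto_symm hx).eventually h.eventually_iff,
      (tendsto_symm hx).eventually h₁.eventually_iff] with z hz hz₁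
    exact hz.symm.trans hz₁

theorem d1_d2_eq_of_taylorCoeffs_eq [I.Boundaryless] [IsManifold I ∞ N] {e : Coordinates I N B}
    {f f₁ : N → ℝ} {x : N} (hx : x ∈ e.source)
    (hf : ContMDiffAt I 𝓘(ℝ, ℝ) ∞ f x) (hf₁ : ContMDiffAt I 𝓘(ℝ, ℝ) ∞ f₁ x)
    (h : taylorCoeffs I 2 x f x = taylorCoeffs I 2 x f₁ x) :
    e.d1 f x = e.d1 f₁ x ∧ e.d2 f x = e.d2 f₁ x := by
  set κ := Coordinates.ofChart I x
  have hκ : x ∈ κ.source := mem_extChartAt_source x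
  have hid : ContMDiffAt I I ∞ (fun y : N => y) x := contMDiffAt_id
  have e1 : κ.d1 f x = κ.d1 f₁ x := by
    have := congrFun (congrArg Prod.snd h) 1
    ext v
    have h2 := congrArg (fun T : ContinuousMultilinearMap ℝ (fun _ : Fin 1 => E) ℝ => T ![v]) this
    have h3 : iteratedFDeriv ℝ 1 (f ∘ (extChartAt I x).symm) (extChartAt I x x) ![v] =
      iteratedFDeriv ℝ 1 (f₁ ∘ (extChartAt I x).symm) (extChartAt I x x) ![v] := h2
    rw [iteratedFDeriv_one_apply, iteratedFDeriv_one_apply] at h3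
    exact h3
  have e2 : κ.d2 f x = κ.d2 f₁ x := by
    have := congrFun (congrArg Prod.snd h) 2
    ext v w
    have h2 := congrArg (fun T : ContinuousMultilinearMap ℝ (fun _ : Fin 2 => E) ℝ => T ![v, w]) this
    have h3 : iteratedFDeriv ℝ 2 (f ∘ (extChartAt I x).symm) (extChartAt I x x) ![v, w] =
      iteratedFDeriv ℝ 2 (f₁ ∘ (extChartAt I x).symm) (extChartAt I x x) ![v, w] := h2
    rw [iteratedFDeriv_two_apply, iteratedFDeriv_two_apply] at h3
    exact h3
  constructor
  · have h1 := d1_comp (e := e) (e' := κ) (F := fun y => y) hx hκ hid hf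
    have h2 := d1_comp (e := e) (e' := κ) (F := fun y => y) hx hκ hid hf₁
    rw [e1, ← h2] at h1
    exact h1
  · ext a b
    have h1 := d2_comp (e := e) (e' := κ) (F := fun y => y) hx hκ hid hf a b
    have h2 := d2_comp (e := e) (e' := κ) (F := fun y => y) hx hκ hid hf₁ a b
    rw [e1, e2, ← h2] at h1
    exact h1

/-- Second-order jets of hypersurfaces determine the `2`-jets of local equations up to
proportionality. -/
theorem PointedSubmanifold.isProportionalJet_of_jet_eq [I.Boundaryless] [IsManifold I ∞ N]
    [CompleteSpace B] {S₁ S₂ : PointedSubmanifold I N ℝ} (h : S₁.jet 2 = S₂.jet 2) :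
    S₁.pt = S₂.pt ∧ ∀ (e : Coordinates I N B) (f₁ f₂ : N → ℝ), S₁.pt ∈ e.source →
      IsLocalEquation I f₁ S₁.carrier S₁.pt → IsLocalEquation I f₂ S₂.carrier S₂.pt →
      IsProportionalJet (e.d1 f₁ S₁.pt) (e.d2 f₁ S₁.pt) (e.d1 f₂ S₂.pt) (e.d2 f₂ S₂.pt) := by
  induction Quot.eqvGen_exact h with
  | rel S₁ S₂ hc =>
    obtain ⟨hpt, g₁, g₂, hg₁, hg₂, ht⟩ := hc
    refine ⟨hpt, fun e f₁ f₂ hx hf₁ hf₂ => ?_⟩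
    have a1 := isProportionalJet_of_isLocalEquation hx S₁.pt_mem hf₁ hg₁
    rw [← hpt] at hf₂ ⊢
    have a2 := isProportionalJet_of_isLocalEquation hx (by rw [hpt]; exact S₂.pt_mem) hg₂ hf₂
    obtain ⟨e1, e2⟩ := d1_d2_eq_of_taylorCoeffs_eq hx hg₁.contMDiffAt hg₂.contMDiffAt ht
    rw [e1, e2] at a1
    exact a1.trans a2
  | refl S => exact ⟨rfl, fun e f₁ f₂ hx hf₁ hf₂ =>
      isProportionalJet_of_isLocalEquation hx S.pt_mem hf₁ hf₂⟩
  | symm S₁ S₂ hr ih =>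
    obtain ⟨hpt, ih⟩ := ih (Quot.eqvGen_sound hr)
    exact ⟨hpt.symm, fun e f₁ f₂ hx hf₁ hf₂ => (ih e f₂ f₁ (hpt ▸ hx) hf₂ hf₁).symm⟩
  | trans S₁ S₂ S₃ h12 h23 ih1 ih2 =>
    obtain ⟨hpt, ih1⟩ := ih1 (Quot.eqvGen_sound h12)
    obtain ⟨hpt', ih2⟩ := ih2 (Quot.eqvGen_sound h23)
    refine ⟨hpt.trans hpt', fun e f₁ f₃ hx hf₁ hf₃ => ?_⟩
    obtain ⟨f₂, hf₂⟩ := S₂.isSubmanifold S₂.pt S₂.pt_mem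
    exact (ih1 e f₁ f₂ hx hf₁ hf₂).trans (ih2 e f₂ f₃ (hpt ▸ hx) hf₂ hf₃)

end Coordinates

/-! ### The topology of the space of `2`-jets -/

section JetTopology

open Coordinates

variable {E H N : Type*} [NormedAddCommGroup E] [NormedSpace ℝ E] [TopologicalSpace H]
  [TopologicalSpace N] [ChartedSpace H N] {I : ModelWithCorners ℝ E H}
  {E' H' N' : Type*} [NormedAddCommGroup E'] [NormedSpace ℝ E'] [TopologicalSpace H']
  [TopologicalSpace N'] [ChartedSpace H' N'] {I' : ModelWithCorners ℝ E' H'}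
  {B : Type*} [NormedAddCommGroup B] [NormedSpace ℝ B]

/-- The topology on equipped hypersurfaces whose quotients, over all charts, define the topology of the
space of `2`-jets. -/
noncomputable instance EquippedSubmanifold.topology (x₀ : N) :
    TopologicalSpace (EquippedSubmanifold I ℝ x₀) :=
  TopologicalSpace.induced
    (fun a : EquippedSubmanifold I ℝ x₀ => taylorCoeffs I 2 x₀ a.1.2 a.1.1.pt) inferInstance

theorem continuous_taylorCoeffs (x₀ : N) :
    Continuous fun a : EquippedSubmanifold I ℝ x₀ => taylorCoeffs I 2 x₀ a.1.2 a.1.1.pt :=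
  continuous_induced_dom

theorem continuous_jet (x₀ : N) :
    Continuous fun a : EquippedSubmanifold I ℝ x₀ => a.1.1.jet 2 :=
  continuous_iff_coinduced_le.2 (le_iSup (fun x₀ : N => TopologicalSpace.coinduced
    (fun a : EquippedSubmanifold I ℝ x₀ => a.1.1.jet 2) inferInstance) x₀)

theorem JetSpace.isOpen_iff {O : Set (JetSpace I N ℝ 2)} :
    IsOpen O ↔ ∀ x₀ : N, IsOpen {a : EquippedSubmanifold I ℝ x₀ | a.1.1.jet 2 ∈ O} :=
  isOpen_iSup_iff.trans (forall_congr' fun _ => isOpen_coinduced)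

theorem JetSpace.continuous_iff {Y : Type*} [TopologicalSpace Y] {J : JetSpace I N ℝ 2 → Y} :
    Continuous J ↔ ∀ x₀ : N, Continuous fun a : EquippedSubmanifold I ℝ x₀ => J (a.1.1.jet 2) :=
  continuous_iSup_dom.trans (forall_congr' fun _ => continuous_coinduced_dom)

theorem EquippedSubmanifold.continuous_pt (x₀ : N) :
    Continuous fun a : EquippedSubmanifold I ℝ x₀ => a.1.1.pt := by
  have h1 : Continuous fun a : EquippedSubmanifold I ℝ x₀ => extChartAt I x₀ a.1.1.pt :=
    continuous_fst.comp (continuous_taylorCoeffs x₀)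
  have h2 := (continuousOn_extChartAt_symm (I := I) x₀).comp_continuous h1 fun a =>
    (extChartAt I x₀).map_source (by rw [extChartAt_source]; exact a.2.1)
  refine h2.congr fun a => (extChartAt I x₀).left_inv (by rw [extChartAt_source]; exact a.2.1)

variable [I.Boundaryless] [IsManifold I ∞ N]

theorem EquippedSubmanifold.continuous_d1 [FiniteDimensional ℝ E] (x₀ : N) :
    Continuous fun a : EquippedSubmanifold I ℝ x₀ =>
      (Coordinates.ofChart I x₀).d1 a.1.2 a.1.1.pt := by
  refine continuous_clm_apply.2 fun v => ?_
  have h := ((ContinuousMultilinearMap.apply ℝ (fun _ : Fin 1 => E) ℝ ![v]).continuous).comp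
    ((continuous_apply (1 : Fin 3)).comp (continuous_snd.comp (continuous_taylorCoeffs (I := I) x₀)))
  refine h.congr fun a => ?_
  change iteratedFDeriv ℝ 1 (a.1.2 ∘ (extChartAt I x₀).symm) (extChartAt I x₀ a.1.1.pt) ![v] = _
  rw [iteratedFDeriv_one_apply]
  rfl

theorem EquippedSubmanifold.continuous_d2 [FiniteDimensional ℝ E] (x₀ : N) :
    Continuous fun a : EquippedSubmanifold I ℝ x₀ =>
      (Coordinates.ofChart I x₀).d2 a.1.2 a.1.1.pt := by
  refine continuous_clm_apply.2 fun v => continuous_clm_apply.2 fun w => ?_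
  have h := ((ContinuousMultilinearMap.apply ℝ (fun _ : Fin 2 => E) ℝ ![v, w]).continuous).comp
    ((continuous_apply (2 : Fin 3)).comp (continuous_snd.comp (continuous_taylorCoeffs (I := I) x₀)))
  refine h.congr fun a => ?_
  change iteratedFDeriv ℝ 2 (a.1.2 ∘ (extChartAt I x₀).symm) (extChartAt I x₀ a.1.1.pt) ![v, w] = _
  rw [iteratedFDeriv_two_apply]
  rfl

theorem EquippedSubmanifold.mem_ofChart_source {x₀ : N} (a : EquippedSubmanifold I ℝ x₀) :
    a.1.1.pt ∈ (Coordinates.ofChart I x₀).source := by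
  change a.1.1.pt ∈ (extChartAt I x₀).source
  rw [extChartAt_source]
  exact a.2.1

/-- The coordinate `2`-jet of the pull-back of a local equation by a smooth map depends continuously on
the local equation. -/
theorem continuousOn_d1_d2_comp [FiniteDimensional ℝ E] [FiniteDimensional ℝ B] {F : N' → N}
    (hF : ContMDiff I' I ∞ F) (x₀ : N) (e : Coordinates I' N' B)
    {ψ : EquippedSubmanifold I ℝ x₀ → N'} (hψ : Continuous ψ) (hFψ : ∀ a, F (ψ a) = a.1.1.pt) :
    ContinuousOn (fun a => e.d1 (a.1.2 ∘ F) (ψ a)) {a | ψ a ∈ e.source} ∧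
    ContinuousOn (fun a => e.d2 (a.1.2 ∘ F) (ψ a)) {a | ψ a ∈ e.source} := by
  set κ := Coordinates.ofChart I x₀ with hκ
  have hs : ∀ a, F (ψ a) ∈ κ.source := fun a => by
    rw [hFψ]; exact a.mem_ofChart_source
  have hf : ∀ a : EquippedSubmanifold I ℝ x₀, ContMDiffAt I 𝓘(ℝ, ℝ) ∞ a.1.2 (F (ψ a)) := fun a => by
    rw [hFψ]; exact a.2.2.contMDiffAt
  have hz : ContinuousOn (fun a => e.toPartialEquiv (ψ a)) {a | ψ a ∈ e.source} :=
    e.contMDiffOn_toFun.continuousOn.comp hψ.continuousOn fun a ha => ha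
  set R := e.rep κ F
  have hR : ∀ a, ψ a ∈ e.source → ContDiffAt ℝ 2 R (e.toPartialEquiv (ψ a)) := fun a ha =>
    (contDiffAt_rep ha (hs a) hF.contMDiffAt).of_le (WithTop.coe_le_coe.2 (le_top : (2 : ℕ∞) ≤ ⊤))
  have hL : ContinuousOn (fun a => fderiv ℝ R (e.toPartialEquiv (ψ a))) {a | ψ a ∈ e.source} :=
    fun a ha => ContinuousAt.comp_continuousWithinAt (f := fun a => e.toPartialEquiv (ψ a))
      ((hR a ha).fderiv_right (m := 1) (by norm_num)).continuousAt (hz a ha)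
  have hK : ContinuousOn (fun a => fderiv ℝ (fderiv ℝ R) (e.toPartialEquiv (ψ a)))
      {a | ψ a ∈ e.source} :=
    fun a ha => ContinuousAt.comp_continuousWithinAt (f := fun a => e.toPartialEquiv (ψ a))
      (((hR a ha).fderiv_right (m := 1) (by norm_num)).fderiv_right (m := 0)
        (by norm_num)).continuousAt (hz a ha)
  have h1 : ContinuousOn (fun a : EquippedSubmanifold I ℝ x₀ => κ.d1 a.1.2 (F (ψ a)))
      {a | ψ a ∈ e.source} := by
    simp only [hFψ]
    exact (EquippedSubmanifold.continuous_d1 x₀).continuousOn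
  have h2 : ContinuousOn (fun a : EquippedSubmanifold I ℝ x₀ => κ.d2 a.1.2 (F (ψ a)))
      {a | ψ a ∈ e.source} := by
    simp only [hFψ]
    exact (EquippedSubmanifold.continuous_d2 x₀).continuousOn
  constructor
  · refine (h1.clm_comp hL).congr fun a ha => ?_
    exact d1_comp ha (hs a) hF.contMDiffAt (hf a)
  · refine continuousOn_clm_apply.2 fun v => continuousOn_clm_apply.2 fun w => ?_
    refine ContinuousOn.congr (f := fun a => κ.d2 a.1.2 (F (ψ a))
      (fderiv ℝ R (e.toPartialEquiv (ψ a)) v) (fderiv ℝ R (e.toPartialEquiv (ψ a)) w) +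
      κ.d1 a.1.2 (F (ψ a)) (fderiv ℝ (fderiv ℝ R) (e.toPartialEquiv (ψ a)) v w)) ?_ fun a ha =>
      d2_comp ha (hs a) hF.contMDiffAt (hf a) v w
    exact ((h2.clm_apply (hL.clm_apply continuousOn_const)).clm_apply
      (hL.clm_apply continuousOn_const)).add
      (h1.clm_apply ((hK.clm_apply continuousOn_const).clm_apply continuousOn_const))

/-- A map to the space of Taylor coefficients is continuous if the base point and the derivatives of
orders at most two are. -/
theorem continuous_taylorCoeffs_of {Y : Type*} [TopologicalSpace Y] {x₀ : N} {x : Y → N}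
    {f : Y → N → ℝ} (hx : Continuous fun y => (ofChart I x₀).toPartialEquiv (x y))
    (h0 : ∀ y, (f y ∘ (extChartAt I x₀).symm) (extChartAt I x₀ (x y)) = 0)
    (h1 : Continuous fun y => (ofChart I x₀).d1 (f y) (x y))
    (h2 : Continuous fun y => (ofChart I x₀).d2 (f y) (x y)) :
    Continuous fun y => taylorCoeffs I 2 x₀ (f y) (x y) := by
  let Λ : (E →L[ℝ] ℝ) →L[ℝ] ContinuousMultilinearMap ℝ (fun _ : Fin 1 => E) ℝ :=
    (continuousMultilinearCurryFin1 ℝ E ℝ).symm.toContinuousLinearEquiv.toContinuousLinearMap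
  refine hx.prodMk (continuous_pi fun i => ?_)
  fin_cases i
  · change Continuous fun y => iteratedFDeriv ℝ 0 (f y ∘ (extChartAt I x₀).symm)
      (extChartAt I x₀ (x y))
    refine (continuous_const (y := (0 : ContinuousMultilinearMap ℝ (fun _ : Fin 0 => E) ℝ))).congr
      fun y => ?_
    ext m
    rw [iteratedFDeriv_zero_apply, h0]
    rfl
  · change Continuous fun y => iteratedFDeriv ℝ 1 (f y ∘ (extChartAt I x₀).symm)
      (extChartAt I x₀ (x y))
    refine (Λ.continuous.comp h1).congr fun y => ?_
    ext m
    rw [iteratedFDeriv_one_apply]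
    rfl
  · change Continuous fun y => iteratedFDeriv ℝ 2 (f y ∘ (extChartAt I x₀).symm)
      (extChartAt I x₀ (x y))
    refine ((continuousMultilinearCurryLeftEquiv ℝ (fun _ : Fin 2 => E) ℝ).symm.continuous.comp
      ((continuous_const (y := Λ)).clm_comp h2)).congr fun y => ?_
    ext m
    rw [iteratedFDeriv_two_apply]
    rfl

/-- The jet of the zero set of `f + ε g + r(ε) h` depends continuously on `ε`. -/
theorem tendsto_jet_of_perturbation {f g h : N → ℝ} {x : N} {r : ℝ → ℝ} (hr : ContinuousAt r 0)
    (hf : ContMDiffAt I 𝓘(ℝ, ℝ) ∞ f x) (hg : ContMDiffAt I 𝓘(ℝ, ℝ) ∞ g x)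
    (hh : ContMDiffAt I 𝓘(ℝ, ℝ) ∞ h x)
    (S : ℝ → PointedSubmanifold I N ℝ) (hSx : ∀ ε, (S ε).pt = x)
    (hS : ∀ ε, IsLocalEquation I (fun y => f y + ε * g y + r ε * h y) (S ε).carrier x) :
    Tendsto (fun ε => (S ε).jet 2) (𝓝 0) (𝓝 ((S 0).jet 2)) := by
  have hx : x ∈ (ofChart I x).source := mem_extChartAt_source x
  let z := extChartAt I x x
  have key : ∀ {k : N → ℝ}, ContMDiffAt I 𝓘(ℝ, ℝ) ∞ k x →
      ContDiffAt ℝ ∞ (k ∘ (extChartAt I x).symm) z := fun hk => contDiffAt_comp_symm hx hk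
  let G : ℝ → EquippedSubmanifold I ℝ x := fun ε =>
    ⟨(S ε, fun y => f y + ε * g y + r ε * h y), by
      rw [hSx]; exact mem_chart_source H x, by rw [hSx]; exact hS ε⟩
  have hG : ContinuousAt G 0 := by
    rw [(⟨rfl⟩ : IsInducing (fun a : EquippedSubmanifold I ℝ x =>
      taylorCoeffs I 2 x a.1.2 a.1.1.pt)).continuousAt_iff]
    have : ((fun a : EquippedSubmanifold I ℝ x => taylorCoeffs I 2 x a.1.2 a.1.1.pt) ∘ G) =
        fun ε => taylorCoeffs I 2 x f x +
          (0, fun i => ε • (taylorCoeffs I 2 x g x).2 i + r ε • (taylorCoeffs I 2 x h x).2 i) := by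
      funext ε
      have hpt : (S ε).pt = x := hSx ε
      change taylorCoeffs I 2 x (fun y => f y + ε * g y + r ε * h y) (S ε).pt = _
      rw [hpt]
      refine Prod.ext ?_ ?_
      · simp [taylorCoeffs]
      · funext i
        have hle : ((i : ℕ) : WithTop ℕ∞) ≤ ∞ := by
          exact_mod_cast WithTop.coe_le_coe.2 (le_top : ((i : ℕ) : ℕ∞) ≤ ⊤)
        have h1 := (key hf).of_le hle
        have h2 := (key hg).of_le hle
        have h3 := (key hh).of_le hle
        have e1 : (fun y => f y + ε * g y + r ε * h y) ∘ (extChartAt I x).symm =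
            (f ∘ (extChartAt I x).symm + ε • (g ∘ (extChartAt I x).symm)) +
              r ε • (h ∘ (extChartAt I x).symm) := by
          funext w; simp
        have h2' : ContDiffAt ℝ (i : ℕ) (ε • (g ∘ (extChartAt I x).symm)) z :=
          contDiffAt_const.smul h2
        have h3' : ContDiffAt ℝ (i : ℕ) (r ε • (h ∘ (extChartAt I x).symm)) z :=
          contDiffAt_const.smul h3
        have h12 : ContDiffAt ℝ (i : ℕ) (f ∘ (extChartAt I x).symm +
            ε • (g ∘ (extChartAt I x).symm)) z := h1.add h2'
        simp only [taylorCoeffs, Prod.snd_add, Pi.add_apply]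
        rw [e1, iteratedFDeriv_add_apply h12 h3', iteratedFDeriv_add_apply h1 h2',
          iteratedFDeriv_const_smul_apply h2, iteratedFDeriv_const_smul_apply h3, add_assoc]
    rw [this]
    refine continuousAt_const.add (continuousAt_const.prodMk (continuousAt_pi.2 fun i => ?_))
    exact (continuousAt_id.smul continuousAt_const).add (hr.smul continuousAt_const)
  exact ((continuous_jet x).continuousAt.comp hG).tendsto

end JetTopology

/-! ### The symbol of a parabolic equation -/

section Symbol

/-- The coordinate space of `T × X × Ω`. -/
abbrev Vec (n : ℕ) := ℝ × EuclideanSpace ℝ (Fin n) × ℝ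

namespace Vec

variable {n : ℕ}

/-- The coordinate vector of the time direction. -/
def et : Vec n := (1, 0, 0)

/-- The coordinate vectors of the directions of `X`. -/
noncomputable def ex (i : Fin n) : Vec n := (0, EuclideanSpace.single i 1, 0)

/-- The coordinate vector of the direction of `Ω`. -/
def eu : Vec n := (0, 0, 1)

theorem eq_sum (v : Vec n) : v = v.1 • et + ∑ i, v.2.1 i • ex i + v.2.2 • eu := by
  have h1 : (∑ i, v.2.1 i • ex i : Vec n).1 = 0 := by
    rw [Prod.fst_sum]; simp [ex]
  have h3 : (∑ i, v.2.1 i • ex i : Vec n).2.2 = 0 := by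
    rw [Prod.snd_sum, Prod.snd_sum]; simp [ex]
  have h2 : (∑ i, v.2.1 i • ex i : Vec n).2.1 = v.2.1 := by
    rw [Prod.snd_sum, Prod.fst_sum]
    ext j
    simp [ex, Finset.sum_apply, Pi.single_apply]
  refine Prod.ext ?_ (Prod.ext ?_ ?_)
  · simp [h1, et, eu]
  · simp [h2, et, eu]
  · simp [h3, et, eu]

theorem clm_apply {F : Type*} [NormedAddCommGroup F] [NormedSpace ℝ F] (α : Vec n →L[ℝ] F)
    (v : Vec n) : α v = v.1 • α et + ∑ i, v.2.1 i • α (ex i) + v.2.2 • α eu := by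
  conv_lhs => rw [eq_sum v]
  simp

theorem clm_ext {F : Type*} [NormedAddCommGroup F] [NormedSpace ℝ F] {α α' : Vec n →L[ℝ] F}
    (ht : α et = α' et) (hx : ∀ i, α (ex i) = α' (ex i)) (hu : α eu = α' eu) : α = α' := by
  refine ContinuousLinearMap.ext fun v => ?_
  rw [clm_apply, clm_apply α', ht, hu]
  simp [hx]

end Vec

open Vec

/-- The coefficients at a point of a parabolic equation. -/
structure ParabolicCoeffs (n : ℕ) where
  b : Matrix (Fin n) (Fin n) ℝ
  c : Matrix (Fin n) (Fin n) ℝ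
  β : Fin n → ℝ
  q : ℝ

/-- The vectors `α_u ∂_i - α_i ∂_u` in the kernel of the covector `α`; they span its intersection
with `dt = 0` if `α_u ≠ 0`. -/
noncomputable def kerVec {n : ℕ} (α : Vec n →L[ℝ] ℝ) (i : Fin n) : Vec n :=
  α eu • ex i - α (ex i) • eu

/-- The polynomial in the first and second derivatives of a local equation `f` of a hypersurface
whose vanishing expresses the parabolic equation. For `f = u - s(t, x)` it is `L s - s_t`; it is
homogeneous with respect to multiplication of `f` by functions. -/
noncomputable def ParabolicCoeffs.symb {n : ℕ} (k : ParabolicCoeffs n) (α : Vec n →L[ℝ] ℝ)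
    (H : Vec n →L[ℝ] Vec n →L[ℝ] ℝ) : ℝ :=
  α et * α eu ^ 2 - ∑ i, ∑ j, k.b i j * H (kerVec α i) (kerVec α j)
    + α eu * ∑ i, ∑ j, k.c i j * α (ex i) * α (ex j) - α eu ^ 2 * ∑ i, k.β i * α (ex i)
    + α eu ^ 3 * k.q

variable {n : ℕ}

theorem apply_kerVec (α : Vec n →L[ℝ] ℝ) (i : Fin n) : α (kerVec α i) = 0 := by
  simp [kerVec, mul_comm]

theorem ParabolicCoeffs.symb_eq_of_isProportionalJet (k : ParabolicCoeffs n)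
    {α α₁ : Vec n →L[ℝ] ℝ} {H H₁ : Vec n →L[ℝ] Vec n →L[ℝ] ℝ} (hH : ∀ a b, H a b = H b a)
    (hH₁ : ∀ a b, H₁ a b = H₁ b a) {c : ℝ} (hα : α₁ = c • α)
    (hc : ∀ a, α a = 0 → H₁ a a = c * H a a) : k.symb α₁ H₁ = c ^ 3 * k.symb α H := by
  have hpol : ∀ a b, α a = 0 → α b = 0 → H₁ a b = c * H a b := by
    intro a b ha hb
    have h1 := hc (a + b) (by simp [ha, hb])
    simp only [map_add, add_apply, hc a ha, hc b hb, hH b a, hH₁ b a] at h1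
    linarith
  have hw : ∀ i, kerVec α₁ i = c • kerVec α i := fun i => by
    simp [kerVec, hα, smul_sub, mul_smul]
  have hs : ∑ i, ∑ j, k.b i j * H₁ (kerVec α₁ i) (kerVec α₁ j) =
      c ^ 3 * ∑ i, ∑ j, k.b i j * H (kerVec α i) (kerVec α j) := by
    simp only [Finset.mul_sum, hw, map_smul, smul_apply, smul_eq_mul,
      hpol _ _ (apply_kerVec α _) (apply_kerVec α _)]
    exact Finset.sum_congr rfl fun i _ => Finset.sum_congr rfl fun j _ => by ring
  have hs2 : ∑ i, ∑ j, k.c i j * α₁ (ex i) * α₁ (ex j) =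
      c ^ 2 * ∑ i, ∑ j, k.c i j * α (ex i) * α (ex j) := by
    simp only [Finset.mul_sum, hα, smul_apply, smul_eq_mul]
    exact Finset.sum_congr rfl fun i _ => Finset.sum_congr rfl fun j _ => by ring
  have hs3 : ∑ i, k.β i * α₁ (ex i) = c * ∑ i, k.β i * α (ex i) := by
    simp only [Finset.mul_sum, hα, smul_apply, smul_eq_mul]
    exact Finset.sum_congr rfl fun i _ => by ring
  rw [symb, symb, hs, hs2, hs3, hα]
  simp only [smul_apply, smul_eq_mul]
  ring

theorem ParabolicCoeffs.continuousOn_symb {Y : Type*} [TopologicalSpace Y] {s : Set Y}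
    {k : Y → ParabolicCoeffs n} {α : Y → Vec n →L[ℝ] ℝ} {H : Y → Vec n →L[ℝ] Vec n →L[ℝ] ℝ}
    (hb : ∀ i j, ContinuousOn (fun y => (k y).b i j) s)
    (hc : ∀ i j, ContinuousOn (fun y => (k y).c i j) s)
    (hβ : ∀ i, ContinuousOn (fun y => (k y).β i) s) (hq : ContinuousOn (fun y => (k y).q) s)
    (hα : ContinuousOn α s) (hH : ContinuousOn H s) :
    ContinuousOn (fun y => (k y).symb (α y) (H y)) s := by
  have hα' : ∀ v, ContinuousOn (fun y => α y v) s := fun v => hα.clm_apply continuousOn_const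
  have hw : ∀ i, ContinuousOn (fun y => kerVec (α y) i) s := fun i =>
    ((hα' eu).smul continuousOn_const).sub ((hα' (ex i)).smul continuousOn_const)
  have hHw : ∀ i j, ContinuousOn (fun y => H y (kerVec (α y) i) (kerVec (α y) j)) s := fun i j =>
    (hH.clm_apply (hw i)).clm_apply (hw j)
  exact ((((hα' et).mul ((hα' eu).pow 2)).sub (continuousOn_finsetSum _ fun i _ =>
    continuousOn_finsetSum _ fun j _ => (hb i j).mul (hHw i j))).add ((hα' eu).mul
    (continuousOn_finsetSum _ fun i _ => continuousOn_finsetSum _ fun j _ =>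
      ((hc i j).mul (hα' (ex i))).mul (hα' (ex j))))).sub (((hα' eu).pow 2).mul
    (continuousOn_finsetSum _ fun i _ => (hβ i).mul (hα' (ex i)))) |>.add
    (((hα' eu).pow 3).mul hq)

theorem sum_mul_pos {b : Matrix (Fin n) (Fin n) ℝ} (hb : b.PosDef) {x : Fin n → ℝ} (hx : x ≠ 0) :
    0 < ∑ i, ∑ j, b i j * (x i * x j) := by
  have h := hb.dotProduct_mulVec_pos hx
  simp only [dotProduct, Matrix.mulVec, Finset.mul_sum, star_trivial] at h
  refine h.trans_eq (Finset.sum_congr rfl fun i _ => Finset.sum_congr rfl fun j _ => by ring)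

theorem sum_mul_nonneg {b : Matrix (Fin n) (Fin n) ℝ} (hb : b.PosDef) (x : Fin n → ℝ) :
    0 ≤ ∑ i, ∑ j, b i j * (x i * x j) := by
  rcases eq_or_ne x 0 with rfl | hx
  · simp
  · exact (sum_mul_pos hb hx).le

end Symbol

/-! ### Coordinates on `T × X × Ω` and local forms of parabolic operators -/

section LocalForm

open Coordinates Vec

/-- A left inverse of the inclusion of a non-empty open subset of the real line. -/
noncomputable def Opens.retract {U : Opens ℝ} (hU : (U : Set ℝ).Nonempty) (r : ℝ) : U :=
  open Classical in if h : r ∈ U then ⟨r, h⟩ else ⟨hU.some, hU.some_mem⟩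

theorem Opens.coe_retract {U : Opens ℝ} (hU : (U : Set ℝ).Nonempty) {r : ℝ} (hr : r ∈ U) :
    (Opens.retract hU r : ℝ) = r := by
  simp [Opens.retract, hr]

theorem Opens.retract_coe {U : Opens ℝ} (hU : (U : Set ℝ).Nonempty) (r : U) :
    Opens.retract hU r = r := Subtype.ext (Opens.coe_retract hU r.2)

theorem Opens.contMDiffAt_retract {U : Opens ℝ} (hU : (U : Set ℝ).Nonempty) {r : ℝ} (hr : r ∈ U) :
    ContMDiffAt 𝓘(ℝ, ℝ) 𝓘(ℝ, ℝ) ∞ (Opens.retract hU) r := by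
  refine (ContMDiffAt.subtypeVal_comp_iff U _ r).1 ?_
  refine contMDiffAt_id.congr_of_eventuallyEq ?_
  filter_upwards [U.isOpen.mem_nhds hr] with s hs
  exact Opens.coe_retract hU hs

variable {M : ParabolicDomain.{u}}

theorem contMDiff_coe_t : ContMDiff M.I 𝓘(ℝ, ℝ) ∞ (fun p : M.N => (p.1 : ℝ)) :=
  contMDiff_subtype_val.comp contMDiff_fst

theorem contMDiff_coe_u : ContMDiff M.I 𝓘(ℝ, ℝ) ∞ (fun p : M.N => (p.2.2 : ℝ)) :=
  contMDiff_subtype_val.comp (contMDiff_snd.comp contMDiff_snd)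

theorem contMDiff_x : ContMDiff M.I (𝓡 M.n) ∞ (fun p : M.N => p.2.1) :=
  contMDiff_fst.comp contMDiff_snd

/-- The coordinates `(t, φ(x), u)` on `T × X × Ω` for local coordinates `φ` on `X`. -/
noncomputable def prodCoordinates {φ : OpenPartialHomeomorph M.X (EuclideanSpace ℝ (Fin M.n))}
    (hφ : φ ∈ IsManifold.maximalAtlas (𝓡 M.n) ∞ M.X) : Coordinates M.I M.N (Vec M.n) where
  toFun p := (p.1, φ p.2.1, p.2.2)
  invFun z := (Opens.retract M.isConnected_T.nonempty z.1, φ.symm z.2.1,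
    Opens.retract M.isConnected_Ω.nonempty z.2.2)
  source := {p | p.2.1 ∈ φ.source}
  target := {z | z.1 ∈ M.T ∧ z.2.1 ∈ φ.target ∧ z.2.2 ∈ M.Ω}
  map_source' p hp := ⟨p.1.2, φ.map_source hp, p.2.2.2⟩
  map_target' z hz := φ.map_target hz.2.1
  left_inv' p hp := by
    simp only [Opens.retract_coe]
    rw [φ.left_inv hp]
  right_inv' z hz := by
    simp only [Opens.coe_retract _ hz.1, Opens.coe_retract _ hz.2.2]
    rw [φ.right_inv hz.2.1]
  open_source := φ.open_source.preimage (continuous_fst.comp continuous_snd)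
  open_target := (M.T.isOpen.preimage continuous_fst).inter
    ((φ.open_target.preimage (continuous_fst.comp continuous_snd)).inter
      (M.Ω.isOpen.preimage (continuous_snd.comp continuous_snd)))
  contMDiffOn_toFun := by
    refine contMDiff_coe_t.contMDiffOn.prodMk_space
      (ContMDiffOn.prodMk_space ?_ contMDiff_coe_u.contMDiffOn)
    exact (contMDiffOn_of_mem_maximalAtlas hφ).comp contMDiff_x.contMDiffOn fun p hp => hp
  contMDiffOn_invFun := by
    intro z hz
    have h1 : ContMDiff 𝓘(ℝ, Vec M.n) 𝓘(ℝ, ℝ) ∞ (fun z : Vec M.n => z.1) :=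
      contDiff_fst.contMDiff
    have h2 : ContMDiff 𝓘(ℝ, Vec M.n) (𝓡 M.n) ∞ (fun z : Vec M.n => z.2.1) :=
      (contDiff_fst.comp contDiff_snd).contMDiff
    have h3 : ContMDiff 𝓘(ℝ, Vec M.n) 𝓘(ℝ, ℝ) ∞ (fun z : Vec M.n => z.2.2) :=
      (contDiff_snd.comp contDiff_snd).contMDiff
    have k2 : ContMDiffAt (𝓡 M.n) (𝓡 M.n) ∞ φ.symm z.2.1 :=
      (contMDiffOn_symm_of_mem_maximalAtlas hφ).contMDiffAt (φ.open_target.mem_nhds hz.2.1)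
    exact ((ContMDiffAt.comp z (Opens.contMDiffAt_retract _ hz.1) h1.contMDiffAt).prodMk
      ((ContMDiffAt.comp z k2 h2.contMDiffAt).prodMk
        (ContMDiffAt.comp z (Opens.contMDiffAt_retract _ hz.2.2) h3.contMDiffAt))).contMDiffWithinAt

/-- The value at `z` of the operator with the given coefficients on a function `w` of the local
coordinates of `X`. -/
noncomputable def ParabolicCoeffs.eval {n : ℕ} (k : ParabolicCoeffs n)
    (w : EuclideanSpace ℝ (Fin n) → ℝ) (z : EuclideanSpace ℝ (Fin n)) : ℝ :=
  ∑ i, ∑ j, k.b i j * partialD i (partialD j w) z +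
    ∑ i, ∑ j, k.c i j * partialD i w z * partialD j w z + ∑ i, k.β i * partialD i w z + k.q

/-- A local expression of an operator `L`, in coordinates `φ` of `X` and over an open set `W`. -/
structure LocalForm (M : ParabolicDomain.{u}) (L : M.T → M.X → (M.X → ℝ) → ℝ) where
  φ : OpenPartialHomeomorph M.X (EuclideanSpace ℝ (Fin M.n))
  mem_maximalAtlas : φ ∈ IsManifold.maximalAtlas (𝓡 M.n) ∞ M.X
  W : Set M.N
  isOpen_W : IsOpen W
  mem_source : ∀ p ∈ W, p.2.1 ∈ φ.source
  coeffs : M.N → ParabolicCoeffs M.n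
  contMDiffOn_b : ∀ i j, ContMDiffOn M.I 𝓘(ℝ, ℝ) ∞ (fun p => (coeffs p).b i j) W
  contMDiffOn_c : ∀ i j, ContMDiffOn M.I 𝓘(ℝ, ℝ) ∞ (fun p => (coeffs p).c i j) W
  contMDiffOn_β : ∀ i, ContMDiffOn M.I 𝓘(ℝ, ℝ) ∞ (fun p => (coeffs p).β i) W
  contMDiffOn_q : ContMDiffOn M.I 𝓘(ℝ, ℝ) ∞ (fun p => (coeffs p).q) W
  posDef : ∀ p ∈ W, (coeffs p).b.PosDef
  eq : ∀ p ∈ W, ∀ (v : M.X → ℝ) (U : Set M.X), IsOpen U → p.2.1 ∈ U →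
    ContMDiffOn (𝓡 M.n) 𝓘(ℝ, ℝ) ∞ v U → v p.2.1 = p.2.2 →
    L p.1 p.2.1 v = (coeffs p).eval (v ∘ φ.symm) (φ p.2.1)

theorem IsParabolicOperator.exists_localForm {L : M.T → M.X → (M.X → ℝ) → ℝ}
    (hL : IsParabolicOperator M L) (p : M.N) : ∃ D : LocalForm M L, p ∈ D.W := by
  obtain ⟨φ, hφ, W, hW, hpW, hs, b, c, β, q, hb, hc, hβ, hq, hpos, heq⟩ := hL p
  exact ⟨⟨φ, hφ, W, hW, hs, fun p => ⟨b p, c p, β p, q p⟩, hb, hc, hβ, hq,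
    fun p hp => (hpos p hp).1, heq⟩, hpW⟩

namespace LocalForm

variable {L : M.T → M.X → (M.X → ℝ) → ℝ} (D : LocalForm M L)

/-- The coordinates of `T × X × Ω` belonging to a local form. -/
noncomputable abbrev coord : Coordinates M.I M.N (Vec M.n) := prodCoordinates D.mem_maximalAtlas

theorem mem_coord_source {p : M.N} (hp : p ∈ D.W) : p ∈ D.coord.source := D.mem_source p hp

/-- The symbol of the operator at the point `p`, applied to a local equation. -/
noncomputable def symbAt (f : M.N → ℝ) (p : M.N) : ℝ :=
  (D.coeffs p).symb (D.coord.d1 f p) (D.coord.d2 f p)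

end LocalForm

theorem Coordinates.d2_symm {E H N : Type*} [NormedAddCommGroup E] [NormedSpace ℝ E]
    [TopologicalSpace H] [TopologicalSpace N] [ChartedSpace H N] {I : ModelWithCorners ℝ E H}
    {B : Type*} [NormedAddCommGroup B] [NormedSpace ℝ B] {e : Coordinates I N B} {f : N → ℝ} {x : N}
    (hx : x ∈ e.source) (hf : ContMDiffAt I 𝓘(ℝ, ℝ) ∞ f x) (a b : B) :
    e.d2 f x a b = e.d2 f x b a :=
  (contDiffAt_comp_symm hx hf).isSymmSndFDerivAt (by
    rw [minSmoothness_of_isRCLikeNormedField]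
    exact WithTop.coe_le_coe.2 (le_top : (2 : ℕ∞) ≤ ⊤)) a b

/-- The local equation `u - s(t, x)` of the graph of `s`. -/
def graphFun (M : ParabolicDomain.{u}) (s : ℝ → M.X → ℝ) (p : M.N) : ℝ := p.2.2 - s p.1 p.2.1

section Graph

theorem contMDiffOn_graphFun {s : ℝ → M.X → ℝ} {U : Set (ℝ × M.X)}
    (hs : ContMDiffOn M.I₀ 𝓘(ℝ, ℝ) ∞ (fun y : ℝ × M.X => s y.1 y.2) U) :
    ContMDiffOn M.I 𝓘(ℝ, ℝ) ∞ (graphFun M s) {p | ((p.1 : ℝ), p.2.1) ∈ U} := by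
  have h : ContMDiff M.I M.I₀ ∞ (fun p : M.N => ((p.1 : ℝ), p.2.1)) :=
    contMDiff_coe_t.prodMk contMDiff_x
  exact contMDiff_coe_u.contMDiffOn.sub (hs.comp h.contMDiffOn fun p hp => hp)

theorem isOpen_graphFun_domain {U : Set (ℝ × M.X)} (hU : IsOpen U) :
    IsOpen {p : M.N | ((p.1 : ℝ), p.2.1) ∈ U} :=
  hU.preimage ((continuous_subtype_val.comp continuous_fst).prodMk
    (continuous_fst.comp continuous_snd))

variable {s : ℝ → M.X → ℝ} {U : Set (ℝ × M.X)} (hU : IsOpen U)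
  (hs : ContMDiffOn M.I₀ 𝓘(ℝ, ℝ) ∞ (fun y : ℝ × M.X => s y.1 y.2) U)
  {φ : OpenPartialHomeomorph M.X (EuclideanSpace ℝ (Fin M.n))}
  (hφ : φ ∈ IsManifold.maximalAtlas (𝓡 M.n) ∞ M.X) {p : M.N} (hp : p.2.1 ∈ φ.source)
  (hpU : ((p.1 : ℝ), p.2.1) ∈ U)

include hU hs hφ hp hpU

theorem contDiffAt_graph_coord :
    ContDiffAt ℝ ∞ (fun y : ℝ × EuclideanSpace ℝ (Fin M.n) => s y.1 (φ.symm y.2))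
      (p.1, φ p.2.1) := by
  rw [← contMDiffAt_iff_contDiffAt]
  have h1 : ContMDiffAt 𝓘(ℝ, ℝ × EuclideanSpace ℝ (Fin M.n)) 𝓘(ℝ, ℝ) ∞
      (fun y : ℝ × EuclideanSpace ℝ (Fin M.n) => y.1) ((p.1 : ℝ), φ p.2.1) :=
    contDiff_fst.contMDiff.contMDiffAt
  have h2 : ContMDiffAt 𝓘(ℝ, ℝ × EuclideanSpace ℝ (Fin M.n)) (𝓡 M.n) ∞
      (fun y : ℝ × EuclideanSpace ℝ (Fin M.n) => y.2) ((p.1 : ℝ), φ p.2.1) :=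
    contDiff_snd.contMDiff.contMDiffAt
  have k2 : ContMDiffAt (𝓡 M.n) (𝓡 M.n) ∞ φ.symm (φ p.2.1) :=
    (contMDiffOn_symm_of_mem_maximalAtlas hφ).contMDiffAt
      (φ.open_target.mem_nhds (φ.map_source hp))
  have h3 : ContMDiffAt 𝓘(ℝ, ℝ × EuclideanSpace ℝ (Fin M.n)) M.I₀ ∞
      (fun y : ℝ × EuclideanSpace ℝ (Fin M.n) => (y.1, φ.symm y.2)) ((p.1 : ℝ), φ p.2.1) :=
    h1.prodMk (ContMDiffAt.comp _ k2 h2)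
  refine ContMDiffAt.comp (g := fun y : ℝ × M.X => s y.1 y.2) _ (hs.contMDiffAt ?_) h3
  rw [φ.left_inv hp]
  exact hU.mem_nhds hpU

theorem d1_d2_graphFun :
    (∀ a, (prodCoordinates hφ).d1 (graphFun M s) p a = a.2.2 -
      fderiv ℝ (fun y : ℝ × EuclideanSpace ℝ (Fin M.n) => s y.1 (φ.symm y.2))
        (p.1, φ p.2.1) (a.1, a.2.1)) ∧
    ∀ a b, (prodCoordinates hφ).d2 (graphFun M s) p a b =
      - fderiv ℝ (fderiv ℝ (fun y : ℝ × EuclideanSpace ℝ (Fin M.n) => s y.1 (φ.symm y.2)))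
        (p.1, φ p.2.1) (a.1, a.2.1) (b.1, b.2.1) := by
  set S := fun y : ℝ × EuclideanSpace ℝ (Fin M.n) => s y.1 (φ.symm y.2) with hS
  have hSc := contDiffAt_graph_coord hU hs hφ hp hpU
  rw [← hS] at hSc
  let e := prodCoordinates hφ
  let l : Vec M.n →L[ℝ] ℝ × EuclideanSpace ℝ (Fin M.n) :=
    (ContinuousLinearMap.fst ℝ _ _).prod
      ((ContinuousLinearMap.fst ℝ _ _).comp (ContinuousLinearMap.snd ℝ _ _))
  let π : Vec M.n →L[ℝ] ℝ := (ContinuousLinearMap.snd ℝ _ _).comp (ContinuousLinearMap.snd ℝ _ _)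
  have hpe : p ∈ e.source := hp
  let z : Vec M.n := e.toPartialEquiv p
  have hev : graphFun M s ∘ e.toPartialEquiv.symm =ᶠ[𝓝 z] fun z => π z - (S ∘ l) z := by
    filter_upwards [e.open_target.mem_nhds (e.map_source hpe)] with w hw
    change (Opens.retract M.isConnected_Ω.nonempty w.2.2 : ℝ) -
      s (Opens.retract M.isConnected_T.nonempty w.1 : ℝ) (φ.symm w.2.1) = w.2.2 - s w.1 (φ.symm w.2.1)
    rw [Opens.coe_retract _ hw.1, Opens.coe_retract _ hw.2.2]
  have hSl : ContDiffAt ℝ ∞ S (l z) := hSc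
  have hlc : ContDiffAt ℝ ∞ l z := l.contDiff.contDiffAt
  have hd : ∀ᶠ w in 𝓝 z, fderiv ℝ (fun z => π z - (S ∘ l) z) w = π - fderiv ℝ (S ∘ l) w := by
    have h1 : ContDiffAt ℝ 1 (S ∘ l) z := (hSl.comp z hlc).of_le
      (WithTop.coe_le_coe.2 (le_top : (1 : ℕ∞) ≤ ⊤))
    filter_upwards [h1.eventually (by simp)] with w hw
    have := fderiv_fun_sub (π.differentiableAt (x := w)) (hw.differentiableAt (by simp))
    rw [this, π.fderiv]
  have hll : fderiv ℝ (fderiv ℝ l) z = 0 := by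
    have : fderiv ℝ l = fun _ => l := by
      ext1 s
      exact l.fderiv
    rw [this]; simp
  constructor
  · intro a
    change fderiv ℝ (graphFun M s ∘ e.toPartialEquiv.symm) z a = _
    rw [hev.fderiv_eq, hd.self_of_nhds, fderiv_comp z (hSl.differentiableAt (by simp))
      (hlc.differentiableAt (by simp)), l.fderiv]
    rfl
  · intro a b
    change fderiv ℝ (fderiv ℝ (graphFun M s ∘ e.toPartialEquiv.symm)) z a b = _
    have hd' : fderiv ℝ (fun z => π z - (S ∘ l) z) =ᶠ[𝓝 z] fun w => π - fderiv ℝ (S ∘ l) w := hd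
    rw [hev.fderiv.fderiv_eq, hd'.fderiv_eq, fderiv_const_sub]
    simp only [neg_apply]
    rw [fderiv_fderiv_comp_apply hSl hlc, hll, l.fderiv]
    simp only [zero_apply, map_zero, add_zero]
    rfl

theorem deriv_partialD_graph :
    deriv (fun τ => s τ p.2.1) p.1 =
      fderiv ℝ (fun y : ℝ × EuclideanSpace ℝ (Fin M.n) => s y.1 (φ.symm y.2)) (p.1, φ p.2.1) (1, 0) ∧
    (∀ i, partialD i (s p.1 ∘ φ.symm) (φ p.2.1) =
      fderiv ℝ (fun y : ℝ × EuclideanSpace ℝ (Fin M.n) => s y.1 (φ.symm y.2)) (p.1, φ p.2.1)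
        (0, EuclideanSpace.single i 1)) ∧
    ∀ i j, partialD i (partialD j (s p.1 ∘ φ.symm)) (φ p.2.1) =
      fderiv ℝ (fderiv ℝ (fun y : ℝ × EuclideanSpace ℝ (Fin M.n) => s y.1 (φ.symm y.2)))
        (p.1, φ p.2.1) (0, EuclideanSpace.single i 1) (0, EuclideanSpace.single j 1) := by
  set S := fun y : ℝ × EuclideanSpace ℝ (Fin M.n) => s y.1 (φ.symm y.2) with hS
  have hSc := contDiffAt_graph_coord hU hs hφ hp hpU
  rw [← hS] at hSc
  have hS2 : ContDiffAt ℝ 2 S ((p.1 : ℝ), φ p.2.1) :=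
    hSc.of_le (WithTop.coe_le_coe.2 (le_top : (2 : ℕ∞) ≤ ⊤))
  set j₀ : EuclideanSpace ℝ (Fin M.n) → ℝ × EuclideanSpace ℝ (Fin M.n) := fun z => ((p.1 : ℝ), z)
    with hj₀
  have hj : ∀ z, HasFDerivAt j₀ (ContinuousLinearMap.inr ℝ ℝ (EuclideanSpace ℝ (Fin M.n))) z :=
    fun z => hasFDerivAt_prodMk_right _ _
  have hfirst : ∀ z, DifferentiableAt ℝ S (j₀ z) → ∀ v,
      fderiv ℝ (s p.1 ∘ φ.symm) z v = fderiv ℝ S (j₀ z) (0, v) := by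
    intro z hz v
    have : HasFDerivAt (s p.1 ∘ φ.symm) _ z := hz.hasFDerivAt.comp z (hj z)
    rw [this.fderiv]
    simp
  refine ⟨?_, fun i => hfirst _ (hS2.differentiableAt (by simp)) _, fun i j => ?_⟩
  · have h1 : HasDerivAt (fun τ : ℝ => (τ, φ p.2.1)) ((1 : ℝ), (0 : EuclideanSpace ℝ (Fin M.n)))
        (p.1 : ℝ) := (hasDerivAt_id _).prodMk (hasDerivAt_const _ _)
    have h2 := (hS2.differentiableAt (by simp)).hasFDerivAt.comp_hasDerivAt (p.1 : ℝ) h1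
    have h3 : (S ∘ fun τ : ℝ => (τ, φ p.2.1)) = fun τ => s τ p.2.1 := by
      funext τ
      simp [hS, φ.left_inv hp]
    rw [h3] at h2
    exact h2.deriv
  · have hc : ContinuousAt j₀ (φ p.2.1) := (hj _).continuousAt
    have hev : partialD j (s p.1 ∘ φ.symm) =ᶠ[𝓝 (φ p.2.1)]
        fun z => fderiv ℝ S (j₀ z) (0, EuclideanSpace.single j 1) := by
      filter_upwards [hc.eventually (hS2.eventually (by simp))] with z hz
      exact hfirst z (hz.differentiableAt (by simp)) _
    have hdS : DifferentiableAt ℝ (fderiv ℝ S) (j₀ (φ p.2.1)) :=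
      (hS2.fderiv_right (m := 1) (by norm_num)).differentiableAt (by simp)
    have h1 := (hdS.hasFDerivAt.comp (φ p.2.1) (hj _)).clm_apply
      (hasFDerivAt_const ((0 : ℝ), (EuclideanSpace.single j 1 : EuclideanSpace ℝ (Fin M.n)))
        (φ p.2.1))
    have h2 := h1.fderiv
    simp only [Function.comp_def] at h2
    rw [partialD, hev.fderiv_eq, h2]
    simp [hj₀]

theorem symb_graphFun (k : ParabolicCoeffs M.n) :
    k.symb ((prodCoordinates hφ).d1 (graphFun M s) p) ((prodCoordinates hφ).d2 (graphFun M s) p) =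
      k.eval (s p.1 ∘ φ.symm) (φ p.2.1) - deriv (fun τ => s τ p.2.1) p.1 := by
  obtain ⟨h1, h2⟩ := d1_d2_graphFun hU hs hφ hp hpU
  obtain ⟨k1, k2, k3⟩ := deriv_partialD_graph hU hs hφ hp hpU
  have hz : fderiv ℝ (fun y : ℝ × EuclideanSpace ℝ (Fin M.n) => s y.1 (φ.symm y.2))
      (p.1, φ p.2.1) (0, 0) = 0 := map_zero _
  rw [k1]
  simp only [k2, k3, ParabolicCoeffs.eval, ParabolicCoeffs.symb, h1, h2, kerVec, et, eu, ex]
  simp [hz]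
  ring

end Graph

namespace LocalForm

variable {L : M.T → M.X → (M.X → ℝ) → ℝ} (D : LocalForm M L)

/-- The symbol of the local equation `u - s(t, x)` is `L s - s_t`. -/
theorem symbAt_graphFun {s : ℝ → M.X → ℝ} {U : Set (ℝ × M.X)} (hU : IsOpen U)
    (hs : ContMDiffOn M.I₀ 𝓘(ℝ, ℝ) ∞ (fun y : ℝ × M.X => s y.1 y.2) U) {p : M.N} (hp : p ∈ D.W)
    (hpU : ((p.1 : ℝ), p.2.1) ∈ U) (hps : (p.2.2 : ℝ) = s p.1 p.2.1) :
    D.symbAt (graphFun M s) p = L p.1 p.2.1 (s p.1) - deriv (fun τ => s τ p.2.1) p.1 := by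
  have hUt : IsOpen {x : M.X | ((p.1 : ℝ), x) ∈ U} :=
    hU.preimage (Continuous.prodMk_right _)
  have hst : ContMDiffOn (𝓡 M.n) 𝓘(ℝ, ℝ) ∞ (s p.1) {x : M.X | ((p.1 : ℝ), x) ∈ U} := by
    have : ContMDiff (𝓡 M.n) M.I₀ ∞ (fun x : M.X => ((p.1 : ℝ), x)) :=
      contMDiff_const.prodMk contMDiff_id
    exact hs.comp this.contMDiffOn fun x hx => hx
  rw [D.eq p hp (s p.1) _ hUt hpU hst hps.symm]
  exact symb_graphFun hU hs D.mem_maximalAtlas (D.mem_source p hp) hpU (D.coeffs p)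

end LocalForm

end LocalForm

/-! ### Membership in the closure of a parabolic equation -/

section Membership

open Coordinates Vec

variable {M : ParabolicDomain.{u}}

namespace LocalForm

variable {L : M.T → M.X → (M.X → ℝ) → ℝ} (D : LocalForm M L)

/-- Whether the symbol of a local equation vanishes, and whether its `u`-derivative does, depends
only on the `2`-jet of the hypersurface. -/
theorem symbAt_of_jet_eq {S₁ S₂ : PointedSubmanifold M.I M.N ℝ} (h : S₁.jet 2 = S₂.jet 2)
    (hW : S₁.pt ∈ D.W) {f₁ f₂ : M.N → ℝ} (h₁ : IsLocalEquation M.I f₁ S₁.carrier S₁.pt)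
    (h₂ : IsLocalEquation M.I f₂ S₂.carrier S₂.pt) :
    (D.symbAt f₁ S₁.pt = 0 ↔ D.symbAt f₂ S₂.pt = 0) ∧
      (D.coord.d1 f₁ S₁.pt eu = 0 ↔ D.coord.d1 f₂ S₂.pt eu = 0) := by
  obtain ⟨hpt, hp⟩ := PointedSubmanifold.isProportionalJet_of_jet_eq (B := Vec M.n) h
  obtain ⟨c, hc, hα, hH⟩ := hp D.coord f₁ f₂ (D.mem_coord_source hW) h₁ h₂
  have key := (D.coeffs S₁.pt).symb_eq_of_isProportionalJet
    (d2_symm (D.mem_coord_source hW) h₁.contMDiffAt)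
    (d2_symm (D.mem_coord_source (hpt ▸ hW)) h₂.contMDiffAt) hα hH
  constructor
  · have : D.symbAt f₂ S₂.pt = c ^ 3 * D.symbAt f₁ S₁.pt := by
      rw [symbAt, symbAt, ← key, hpt]
    rw [this]
    simp [hc]
  · rw [hα]
    simp [hc]

/-- A `2`-jet of hypersurfaces belongs to the equation `u_t = L u` iff the hypersurface is
transversal to `∂_u` and the symbol of its local equation vanishes. -/
theorem jet_mem_graphEquation_iff {S : PointedSubmanifold M.I M.N ℝ} (hW : S.pt ∈ D.W)
    {f : M.N → ℝ} (hf : IsLocalEquation M.I f S.carrier S.pt) :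
    S.jet 2 ∈ graphEquation M L ↔ D.coord.d1 f S.pt eu ≠ 0 ∧ D.symbAt f S.pt = 0 := by
  have key : ∀ (S : PointedSubmanifold M.I M.N ℝ) (s : ℝ → M.X → ℝ) (U : Set (ℝ × M.X)),
      S.pt ∈ D.W → IsOpen U → ((S.pt.1 : ℝ), S.pt.2.1) ∈ U →
      ContMDiffOn M.I₀ 𝓘(ℝ, ℝ) ∞ (fun y : ℝ × M.X => s y.1 y.2) U →
      (∀ᶠ p in 𝓝 S.pt, p ∈ S.carrier ↔ (p.2.2 : ℝ) = s p.1 p.2.1) →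
      IsLocalEquation M.I (graphFun M s) S.carrier S.pt ∧
        D.coord.d1 (graphFun M s) S.pt eu = 1 ∧
        D.symbAt (graphFun M s) S.pt =
          L S.pt.1 S.pt.2.1 (s S.pt.1) - deriv (fun τ => s τ S.pt.2.1) S.pt.1 := by
    intro S s U hW hU hpU hs hev
    obtain ⟨h1, -⟩ := d1_d2_graphFun hU hs D.mem_maximalAtlas (D.mem_source _ hW) hpU
    have hu : D.coord.d1 (graphFun M s) S.pt eu = 1 := by
      rw [h1]
      simp only [eu]
      rw [show ((0 : ℝ), (0 : EuclideanSpace ℝ (Fin M.n))) = 0 from rfl, map_zero, sub_zero]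
    refine ⟨?_, hu, D.symbAt_graphFun hU hs hW hpU (hev.self_of_nhds.1 S.pt_mem)⟩
    refine isLocalEquation_of_d1_ne_zero (D.mem_coord_source hW) (isOpen_graphFun_domain hU) hpU
      (contMDiffOn_graphFun hs) (fun h => ?_) ?_
    · rw [h] at hu
      simp at hu
    · filter_upwards [hev] with p hp
      rw [hp, graphFun, sub_eq_zero]
  constructor
  · rintro ⟨S₀, s, U, hjet, hU, hpU, hs, hev, heq⟩
    have hpt : S₀.pt = S.pt :=
      (PointedSubmanifold.isProportionalJet_of_jet_eq (B := Vec M.n) hjet).1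
    obtain ⟨k1, k2, k3⟩ := key S₀ s U (hpt ▸ hW) hU hpU hs hev
    obtain ⟨j1, j2⟩ := D.symbAt_of_jet_eq hjet (hpt ▸ hW) k1 hf
    rw [← j1, Ne, ← j2, k2, k3, heq]
    simp
  · rintro ⟨hu, h0⟩
    obtain ⟨U, hU, hxU, hfU, -, -⟩ := id hf
    set e := D.coord with he
    have hx : S.pt ∈ e.source := D.mem_coord_source hW
    set O : Set (Vec M.n) := e.target ∩ e.toPartialEquiv.symm ⁻¹' U with hO
    have hOo : IsOpen O := e.contMDiffOn_invFun.continuousOn.isOpen_inter_preimage e.open_target hU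
    have hfO : ContDiffOn ℝ ∞ (f ∘ e.toPartialEquiv.symm) O := by
      rw [← contMDiffOn_iff_contDiffOn]
      exact hfU.comp (e.contMDiffOn_invFun.mono inter_subset_left) fun z hz => hz.2
    have hz0 : e.toPartialEquiv S.pt ∈ O := by
      refine ⟨e.map_source hx, ?_⟩
      change e.toPartialEquiv.symm (e.toPartialEquiv S.pt) ∈ U
      rwa [e.left_inv hx]
    obtain ⟨s, Ws, hWs, hzW, hsW, hev⟩ := exists_graph_of_fderiv_ne_zero hOo hfO hz0
      (by rw [Function.comp_apply, e.left_inv hx]; exact hf.eventually_iff.self_of_nhds.1 S.pt_mem)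
      hu
    have hc := (contMDiffAt_toFun hx).continuousAt
    let V : Set (ℝ × M.X) := {y | y.2 ∈ D.φ.source ∧ (y.1, D.φ y.2) ∈ Ws}
    have hφ : ContMDiffOn M.I₀ 𝓘(ℝ, ℝ × EuclideanSpace ℝ (Fin M.n)) ∞
        (fun y : ℝ × M.X => (y.1, D.φ y.2)) {y | y.2 ∈ D.φ.source} :=
      contMDiff_fst.contMDiffOn.prodMk_space
        ((contMDiffOn_of_mem_maximalAtlas D.mem_maximalAtlas).comp contMDiff_snd.contMDiffOn
          fun y hy => hy)
    have hV : IsOpen V := hφ.continuousOn.isOpen_inter_preimage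
      (D.φ.open_source.preimage continuous_snd) hWs
    have hsV : ContMDiffOn M.I₀ 𝓘(ℝ, ℝ) ∞ (fun y : ℝ × M.X => s (y.1, D.φ y.2)) V :=
      (contMDiffOn_iff_contDiffOn.2 hsW).comp (hφ.mono fun y hy => hy.1) fun y hy => hy.2
    have hpV : ((S.pt.1 : ℝ), S.pt.2.1) ∈ V := ⟨hx, hzW⟩
    have hgr : ∀ᶠ p in 𝓝 S.pt, p ∈ S.carrier ↔ (p.2.2 : ℝ) = s (p.1, D.φ p.2.1) := by
      filter_upwards [hc.eventually hev, e.open_source.mem_nhds hx, hf.eventually_iff]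
        with p hp hps hpf
      rw [Function.comp_apply, e.left_inv hps] at hp
      exact hpf.trans hp
    obtain ⟨k1, k2, k3⟩ := key S (fun τ x => s (τ, D.φ x)) V hW hV hpV hsV hgr
    refine ⟨S, fun τ x => s (τ, D.φ x), V, rfl, hV, hpV, hsV, hgr, ?_⟩
    have := (D.symbAt_of_jet_eq rfl hW hf k1).1.1 h0
    rw [k3] at this
    linarith

/-- The symbol vanishes on the closure of the equation. -/
theorem symbAt_eq_zero_of_mem_closure {S : PointedSubmanifold M.I M.N ℝ} (hW : S.pt ∈ D.W)
    {f : M.N → ℝ} (hf : IsLocalEquation M.I f S.carrier S.pt)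
    (h : S.jet 2 ∈ closure (graphEquation M L)) : D.symbAt f S.pt = 0 := by
  by_contra hne
  let O : Set (JetSpace M.I M.N ℝ 2) := {θ | ∃ (S : PointedSubmanifold M.I M.N ℝ) (f : M.N → ℝ),
    S.jet 2 = θ ∧ IsLocalEquation M.I f S.carrier S.pt ∧ S.pt ∈ D.W ∧ D.symbAt f S.pt ≠ 0}
  have hO : IsOpen O := by
    refine JetSpace.isOpen_iff.2 fun x₀ => ?_
    have hset : {a : EquippedSubmanifold M.I ℝ x₀ | a.1.1.jet 2 ∈ O} =
        {a | a.1.1.pt ∈ D.W} ∩ {a | D.symbAt a.1.2 a.1.1.pt ∈ ({0}ᶜ : Set ℝ)} := by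
      ext a
      constructor
      · rintro ⟨S, f, hj, hf, hS, h0⟩
        have hpt := (PointedSubmanifold.isProportionalJet_of_jet_eq (B := Vec M.n) hj).1
        rw [hpt] at hS
        exact ⟨hS, fun h => h0 ((D.symbAt_of_jet_eq hj (hpt ▸ hS) hf a.2.2).1.2 h)⟩
      · rintro ⟨h1, h2⟩
        exact ⟨a.1.1, a.1.2, rfl, a.2.2, h1, h2⟩
    rw [hset]
    have hpt := EquippedSubmanifold.continuous_pt (I := M.I) x₀
    have hWo : IsOpen {a : EquippedSubmanifold M.I ℝ x₀ | a.1.1.pt ∈ D.W} := D.isOpen_W.preimage hpt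
    refine ContinuousOn.isOpen_inter_preimage ?_ hWo isOpen_compl_singleton
    obtain ⟨c1, c2⟩ := continuousOn_d1_d2_comp (F := fun y : M.N => y) contMDiff_id x₀ D.coord hpt
      fun a => rfl
    have hsub : {a : EquippedSubmanifold M.I ℝ x₀ | a.1.1.pt ∈ D.W} ⊆
        {a | a.1.1.pt ∈ D.coord.source} := fun a ha => D.mem_coord_source ha
    exact ParabolicCoeffs.continuousOn_symb
      (fun i j => (D.contMDiffOn_b i j).continuousOn.comp hpt.continuousOn fun a ha => ha)
      (fun i j => (D.contMDiffOn_c i j).continuousOn.comp hpt.continuousOn fun a ha => ha)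
      (fun i => (D.contMDiffOn_β i).continuousOn.comp hpt.continuousOn fun a ha => ha)
      (D.contMDiffOn_q.continuousOn.comp hpt.continuousOn fun a ha => ha)
      (c1.mono hsub) (c2.mono hsub)
  obtain ⟨θ, ⟨S₁, f₁, hj, hf₁, hS₁, h0⟩, hθ⟩ := mem_closure_iff.1 h O hO ⟨S, f, rfl, hf, hW, hne⟩
  rw [← hj] at hθ
  exact h0 ((D.jet_mem_graphEquation_iff hS₁ hf₁).1 hθ).2

/-- A hypersurface with vanishing symbol whose conormal is not proportional to `dt` has its `2`-jet in
the closure of the equation. If the conormal annihilates `∂_u`, its local equation `f` is perturbed to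
`f + ε (u - u₀) + r(ε) (u - u₀)² / 2`, with `r(ε)` making the symbol vanish. -/
theorem mem_closure_of_symbAt_eq_zero {S : PointedSubmanifold M.I M.N ℝ} (hW : S.pt ∈ D.W)
    {f : M.N → ℝ} (hf : IsLocalEquation M.I f S.carrier S.pt) (h0 : D.symbAt f S.pt = 0)
    (hα : D.coord.d1 f S.pt eu ≠ 0 ∨ ∃ i, D.coord.d1 f S.pt (ex i) ≠ 0) :
    S.jet 2 ∈ closure (graphEquation M L) := by
  by_cases hu : D.coord.d1 f S.pt eu = 0
  swap
  · exact subset_closure ((D.jet_mem_graphEquation_iff hW hf).2 ⟨hu, h0⟩)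
  obtain ⟨i₀, hi₀⟩ : ∃ i, D.coord.d1 f S.pt (ex i) ≠ 0 := hα.resolve_left fun h => h hu
  set p := S.pt with hp
  set e := D.coord with he
  have hx : p ∈ e.source := D.mem_coord_source hW
  set α := e.d1 f p with hαdef
  set H := e.d2 f p with hHdef
  let π : Vec M.n →L[ℝ] ℝ := (ContinuousLinearMap.snd ℝ _ _).comp (ContinuousLinearMap.snd ℝ _ _)
  set k := D.coeffs p with hk
  set b₀ := ∑ i, ∑ j, k.b i j * (α (ex i) * α (ex j)) with hb₀
  have hb₀pos : 0 < b₀ := sum_mul_pos (D.posDef p hW) fun h => hi₀ (congrFun h i₀)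
  let ψ : ℝ → ℝ := fun ε => k.symb (α + ε • π) H
  let r : ℝ → ℝ := fun ε => ψ ε / b₀
  have hψ0 : ψ 0 = 0 := by
    simp only [ψ, zero_smul, add_zero]
    exact h0
  have hψc : Continuous ψ := by
    rw [← continuousOn_univ]
    exact ParabolicCoeffs.continuousOn_symb (fun _ _ => continuousOn_const)
      (fun _ _ => continuousOn_const) (fun _ => continuousOn_const) continuousOn_const
      (continuousOn_const.add (continuousOn_id.smul continuousOn_const)) continuousOn_const
  have hrc : Continuous r := hψc.div_const _
  have hr0 : r 0 = 0 := by simp [r, hψ0]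
  let g : M.N → ℝ := fun y => y.2.2 - p.2.2
  let h : M.N → ℝ := fun y => (1 / 2) * (g y * g y)
  have hg : ContMDiff M.I 𝓘(ℝ, ℝ) ∞ g := contMDiff_coe_u.sub contMDiff_const
  have hh : ContMDiff M.I 𝓘(ℝ, ℝ) ∞ h := contMDiff_const.mul (hg.mul hg)
  let fε : ℝ → M.N → ℝ := fun ε y => f y + ε * g y + r ε * h y
  obtain ⟨U, hU, hxU, hfU, -, -⟩ := id hf
  have hfεU : ∀ ε, ContMDiffOn M.I 𝓘(ℝ, ℝ) ∞ (fε ε) U := fun ε =>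
    (hfU.add (contMDiffOn_const.mul hg.contMDiffOn)).add (contMDiffOn_const.mul hh.contMDiffOn)
  -- the coordinate expression of the perturbed local equation
  have hcoord : ∀ ε, e.d1 (fε ε) p = α + ε • π ∧
      ∀ v w, e.d2 (fε ε) p v w = H v w + r ε * (v.2.2 * w.2.2) := by
    intro ε
    set z := e.toPartialEquiv p with hz
    set fc := f ∘ e.toPartialEquiv.symm
    have hfc : ContDiffAt ℝ 2 fc z := (contDiffAt_comp_symm hx hf.contMDiffAt).of_le
      (WithTop.coe_le_coe.2 (le_top : (2 : ℕ∞) ≤ ⊤))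
    have hev : fε ε ∘ e.toPartialEquiv.symm =ᶠ[𝓝 z] fun w =>
        fc w + ε * (π w - p.2.2) + r ε * ((1 / 2) * ((π w - p.2.2) * (π w - p.2.2))) := by
      filter_upwards [e.open_target.mem_nhds (e.map_source hx)] with w hw
      have hw' : ((e.toPartialEquiv.symm w).2.2 : ℝ) = π w := Opens.coe_retract _ hw.2.2
      simp only [Function.comp_apply, fε, g, h, hw', fc]
    have hd : ∀ᶠ w in 𝓝 z, HasFDerivAt (fun w =>
        fc w + ε * (π w - p.2.2) + r ε * ((1 / 2) * ((π w - p.2.2) * (π w - p.2.2))))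
        (fderiv ℝ fc w + ε • π + (r ε * (π w - p.2.2)) • π) w := by
      filter_upwards [hfc.eventually (by simp)] with w hw
      have h1 := (hw.differentiableAt (by simp)).hasFDerivAt
      have h2 : HasFDerivAt (fun w => π w - (p.2.2 : ℝ)) π w := π.hasFDerivAt.sub_const _
      refine ((h1.add (h2.const_mul ε)).add (((h2.mul h2).const_mul (1 / 2)).const_mul
        (r ε))).congr_fderiv ?_
      refine ContinuousLinearMap.ext fun v => ?_
      simp
      ring
    have hπz : π z = p.2.2 := rfl
    constructor
    · rw [d1, hev.fderiv_eq, hd.self_of_nhds.fderiv, hπz]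
      simp only [sub_self, mul_zero, zero_smul, add_zero]
      rfl
    · intro v w
      have hev2 : fderiv ℝ (fun w => fc w + ε * (π w - p.2.2) +
          r ε * ((1 / 2) * ((π w - p.2.2) * (π w - p.2.2)))) =ᶠ[𝓝 z] fun w =>
          fderiv ℝ fc w + ε • π + (r ε * (π w - p.2.2)) • π := by
        filter_upwards [hd] with w hw using hw.fderiv
      have hd2 : DifferentiableAt ℝ (fderiv ℝ fc) z :=
        (hfc.fderiv_right (m := 1) (by norm_num)).differentiableAt (by simp)
      have h2 : HasFDerivAt (fun w => π w - (p.2.2 : ℝ)) π z := π.hasFDerivAt.sub_const _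
      have hd3 := (hd2.hasFDerivAt.add_const (ε • π)).add ((h2.const_mul (r ε)).smul_const π)
      rw [d2, hev.fderiv.fderiv_eq, hev2.fderiv_eq,
        HasFDerivAt.fderiv (f := fun w => fderiv ℝ fc w + ε • π + (r ε * (π w - p.2.2)) • π) hd3]
      simp only [add_apply, smul_apply, ContinuousLinearMap.smulRight_apply, smul_eq_mul]
      rw [mul_assoc]
      rfl
  have hπ : ∀ i, π (ex i) = 0 := fun i => rfl
  have hne : ∀ ε, e.d1 (fε ε) p ≠ 0 := fun ε hε => by
    have := congrArg (fun l : Vec M.n →L[ℝ] ℝ => l (ex i₀)) (hcoord ε).1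
    rw [hε] at this
    simp [hπ] at this
    exact hi₀ this.symm
  have hfε0 : ∀ ε, fε ε p = 0 := fun ε => by
    have : f p = 0 := hf.eventually_iff.self_of_nhds.1 S.pt_mem
    simp [fε, g, h, this]
  choose Sε hpt hSε using fun ε => PointedSubmanifold.exists_of_d1_ne_zero hx hU hxU (hfεU ε)
    (hfε0 ε) (hne ε)
  have hS0 : (Sε 0).jet 2 = S.jet 2 := by
    refine PointedSubmanifold.jet_eq_of_eventually 2 (hpt 0) ?_
    rw [hpt]
    filter_upwards [(hSε 0).eventually_iff, hf.eventually_iff] with y hy hy'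
    rw [hy, hy']
    simp [fε, hr0]
  have hlim := tendsto_jet_of_perturbation hrc.continuousAt hf.contMDiffAt hg.contMDiffAt
    hh.contMDiffAt Sε hpt hSε
  rw [hS0] at hlim
  refine mem_closure_of_tendsto (hlim.mono_left (nhdsWithin_le_nhds (s := {0}ᶜ))) ?_
  filter_upwards [self_mem_nhdsWithin] with ε (hε : ε ≠ 0)
  have hWε : (Sε ε).pt ∈ D.W := by rw [hpt]; exact hW
  refine (D.jet_mem_graphEquation_iff hWε ((hpt ε).symm ▸ hSε ε)).2 ?_
  rw [hpt, symbAt, (hcoord ε).1]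
  have hαu : (α + ε • π) eu = ε := by
    have : π eu = 1 := rfl
    simp [hu, this]
  refine ⟨by rw [hαu]; exact hε, ?_⟩
  have hw : ∀ i, (kerVec (α + ε • π) i).2.2 = - α (ex i) := fun i => by
    have h1 : (ex i : Vec M.n).2.2 = 0 := rfl
    have h2 : (eu : Vec M.n).2.2 = 1 := rfl
    simp [kerVec, hπ, h1, h2]
  have hsum : ∑ i, ∑ j, k.b i j * e.d2 (fε ε) p (kerVec (α + ε • π) i) (kerVec (α + ε • π) j) =
      ∑ i, ∑ j, k.b i j * H (kerVec (α + ε • π) i) (kerVec (α + ε • π) j) + r ε * b₀ := by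
    simp only [(hcoord ε).2, hw, hb₀, Finset.mul_sum, ← Finset.sum_add_distrib]
    exact Finset.sum_congr rfl fun i _ => Finset.sum_congr rfl fun j _ => by ring
  have hfin : k.symb (α + ε • π) (e.d2 (fε ε) p) = ψ ε - r ε * b₀ := by
    simp only [ψ, ParabolicCoeffs.symb, hsum]
    ring
  rw [hfin]
  simp only [r]
  field_simp
  ring

end LocalForm

end Membership

/-! ### Linear algebra of morphisms at a point -/

section LinearAlgebra

open Vec

namespace Vec

variable {n : ℕ}

/-- The coordinate covector of the time direction. -/
noncomputable def dt : Vec n →L[ℝ] ℝ := ContinuousLinearMap.fst ℝ _ _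

/-- The coordinate covectors of the directions of `X`. -/
noncomputable def dx (i : Fin n) : Vec n →L[ℝ] ℝ :=
  (EuclideanSpace.proj i : EuclideanSpace ℝ (Fin n) →L[ℝ] ℝ).comp
    ((ContinuousLinearMap.fst ℝ _ _).comp (ContinuousLinearMap.snd ℝ _ _))

/-- The coordinate covector of the direction of `Ω`. -/
noncomputable def du : Vec n →L[ℝ] ℝ :=
  (ContinuousLinearMap.snd ℝ _ _).comp (ContinuousLinearMap.snd ℝ _ _)

@[simp] theorem dt_et : (dt : Vec n →L[ℝ] ℝ) et = 1 := rfl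
@[simp] theorem dt_ex (i : Fin n) : (dt : Vec n →L[ℝ] ℝ) (ex i) = 0 := rfl
@[simp] theorem dt_eu : (dt : Vec n →L[ℝ] ℝ) eu = 0 := rfl
@[simp] theorem dx_et (i : Fin n) : dx i et = 0 := rfl
@[simp] theorem dx_ex (i j : Fin n) : dx i (ex j) = if i = j then 1 else 0 := by
  change (EuclideanSpace.single j (1 : ℝ) : EuclideanSpace ℝ (Fin n)) i = _
  simp
@[simp] theorem dx_eu (i : Fin n) : dx i eu = 0 := rfl
@[simp] theorem du_et : (du : Vec n →L[ℝ] ℝ) et = 0 := rfl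
@[simp] theorem du_ex (i : Fin n) : (du : Vec n →L[ℝ] ℝ) (ex i) = 0 := rfl
@[simp] theorem du_eu : (du : Vec n →L[ℝ] ℝ) eu = 1 := rfl

/-- The bilinear form `(a, b) ↦ l a * l b`. -/
noncomputable def sq (l : Vec n →L[ℝ] ℝ) : Vec n →L[ℝ] Vec n →L[ℝ] ℝ := l.smulRight l

@[simp] theorem sq_apply (l : Vec n →L[ℝ] ℝ) (a b : Vec n) : sq l a b = l a * l b := by
  simp [sq]

end Vec

variable {n n' : ℕ}

/-- The second derivative of `f ∘ F` at a point where `f` has the derivatives `α` and `H` and `F` has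
the derivatives `D` and `K`. -/
noncomputable def pullHess (D : Vec n →L[ℝ] Vec n') (K : Vec n →L[ℝ] Vec n →L[ℝ] Vec n')
    (α : Vec n' →L[ℝ] ℝ) (H : Vec n' →L[ℝ] Vec n' →L[ℝ] ℝ) : Vec n →L[ℝ] Vec n →L[ℝ] ℝ :=
  ((ContinuousLinearMap.compL ℝ (Vec n) (Vec n') ℝ).flip D).comp (H.comp D) +
    (ContinuousLinearMap.compL ℝ (Vec n) (Vec n') ℝ α).comp K

@[simp] theorem pullHess_apply (D : Vec n →L[ℝ] Vec n') (K : Vec n →L[ℝ] Vec n →L[ℝ] Vec n')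
    (α : Vec n' →L[ℝ] ℝ) (H : Vec n' →L[ℝ] Vec n' →L[ℝ] ℝ) (a b : Vec n) :
    pullHess D K α H a b = H (D a) (D b) + α (K a b) := rfl

theorem continuous_pullHess {Y : Type*} [TopologicalSpace Y] (D : Vec n →L[ℝ] Vec n')
    (K : Vec n →L[ℝ] Vec n →L[ℝ] Vec n') {α : Y → Vec n' →L[ℝ] ℝ}
    {H : Y → Vec n' →L[ℝ] Vec n' →L[ℝ] ℝ} (hα : Continuous α) (hH : Continuous H) :
    Continuous fun y => pullHess D K (α y) (H y) :=
  (continuous_const.clm_comp (hH.clm_comp continuous_const)).add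
    (((ContinuousLinearMap.compL ℝ (Vec n) (Vec n') ℝ).continuous.comp hα).clm_comp
      continuous_const)

/-- The conditions imposed on the first two derivatives `D` and `K` of a morphism of parabolic
equations at a point: they relate the zeros of the symbols over conormals not proportional to `dt`. -/
structure IsSymbolMorphism (k : ParabolicCoeffs n) (k' : ParabolicCoeffs n')
    (D : Vec n →L[ℝ] Vec n') (K : Vec n →L[ℝ] Vec n →L[ℝ] Vec n') : Prop where
  comp_ne_zero : ∀ α : Vec n' →L[ℝ] ℝ, α ≠ 0 → α.comp D ≠ 0
  pull : ∀ (α : Vec n' →L[ℝ] ℝ) (H : Vec n' →L[ℝ] Vec n' →L[ℝ] ℝ), (∀ a b, H a b = H b a) →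
    (α eu ≠ 0 ∨ ∃ i, α (ex i) ≠ 0) → k'.symb α H = 0 → k.symb (α.comp D) (pullHess D K α H) = 0
  push : ∀ (α : Vec n' →L[ℝ] ℝ) (H : Vec n' →L[ℝ] Vec n' →L[ℝ] ℝ), (∀ a b, H a b = H b a) →
    α ≠ 0 → (α.comp D eu ≠ 0 ∨ ∃ i, α.comp D (ex i) ≠ 0) →
    k.symb (α.comp D) (pullHess D K α H) = 0 → k'.symb α H = 0

namespace ParabolicCoeffs

variable (k : ParabolicCoeffs n)

/-- The symbol of a conormal annihilating `∂_u`. -/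
theorem symb_of_apply_eu_eq_zero {α : Vec n →L[ℝ] ℝ} (hα : α eu = 0)
    (H : Vec n →L[ℝ] Vec n →L[ℝ] ℝ) :
    k.symb α H = - (∑ i, ∑ j, k.b i j * (α (ex i) * α (ex j))) * H eu eu := by
  simp only [symb, kerVec, hα, zero_smul, zero_sub, map_neg, neg_apply, map_smul, smul_apply,
    smul_eq_mul]
  simp
  simp only [Finset.sum_mul]
  exact Finset.sum_congr rfl fun i _ => Finset.sum_congr rfl fun j _ => by ring

/-- The symbol of a conormal in the span of `dt` and `du`. -/
theorem symb_of_apply_ex_eq_zero {α : Vec n →L[ℝ] ℝ} (hα : ∀ i, α (ex i) = 0)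
    (H : Vec n →L[ℝ] Vec n →L[ℝ] ℝ) :
    k.symb α H = α eu ^ 2 * (α et - (∑ i, ∑ j, k.b i j * H (ex i) (ex j)) + α eu * k.q) := by
  have h : ∑ i, ∑ j, k.b i j * H (α eu • ex i) (α eu • ex j) =
      α eu ^ 2 * ∑ i, ∑ j, k.b i j * H (ex i) (ex j) := by
    simp only [map_smul, smul_apply, smul_eq_mul, Finset.mul_sum]
    exact Finset.sum_congr rfl fun i _ => Finset.sum_congr rfl fun j _ => by ring
  simp only [symb, kerVec, hα, zero_smul, sub_zero, h]
  simp
  ring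

end ParabolicCoeffs

theorem eq_zero_of_forall_ne_zero {g : ℝ → ℝ} (hg : Continuous g) (h : ∀ ε, ε ≠ 0 → g ε = 0) :
    g 0 = 0 :=
  congrFun (hg.ext_on (dense_compl_singleton (0 : ℝ)) continuous_const fun ε hε => h ε hε) 0

namespace IsSymbolMorphism

variable {k : ParabolicCoeffs n} {k' : ParabolicCoeffs n'} {D : Vec n →L[ℝ] Vec n'}
  {K : Vec n →L[ℝ] Vec n →L[ℝ] Vec n'}

/-- The pull-back of `dt` is proportional to `dt`. Otherwise, over the pull-back `α₀` of `dt` the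
symbol would be an affine function on the second derivatives. Taking the limits of the zeros of the
symbol over `dt + ε dx` and `dt + ε du` one finds that its linear part vanishes, so that `D` vanishes
on the vectors `kerVec α₀ i`. If `α₀ (∂_u) ≠ 0`, the rank of `D` is too small. If `α₀ (∂_u) = 0`, then
`D ∂_u = 0`, and the symbol over the pull-back of `dt ± du` would not depend on the second
derivatives. -/
theorem dt_comp_eq (h : IsSymbolMorphism k k' D K) (hb : k.b.PosDef) (hb' : k'.b.PosDef)
    (hn' : 1 ≤ n') : dt (D eu) = 0 ∧ ∀ i, dt (D (ex i)) = 0 := by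
  by_contra hcon
  set α₀ : Vec n →L[ℝ] ℝ := (dt : Vec n' →L[ℝ] ℝ).comp D with hα₀
  have hne : α₀ eu ≠ 0 ∨ ∃ i, α₀ (ex i) ≠ 0 := by
    by_contra! hall
    exact hcon hall
  let i₁ : Fin n' := ⟨0, hn'⟩
  have hcont : ∀ (l : Vec n' →L[ℝ] ℝ) (H : ℝ → Vec n' →L[ℝ] Vec n' →L[ℝ] ℝ), Continuous H →
      Continuous fun ε : ℝ => k.symb ((dt + ε • l).comp D) (pullHess D K (dt + ε • l) (H ε)) := by
    intro l H hH
    have hl : Continuous fun ε : ℝ => dt + ε • l := by fun_prop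
    rw [← continuousOn_univ]
    exact ParabolicCoeffs.continuousOn_symb (fun _ _ => continuousOn_const)
      (fun _ _ => continuousOn_const) (fun _ => continuousOn_const) continuousOn_const
      (hl.clm_comp continuous_const).continuousOn
      (continuous_pullHess D K hl hH).continuousOn
  -- limits of zeros of the symbol over `dt + ε dx`: all `H` with `H(∂_u, ∂_u) = 0`
  have ha : ∀ H : Vec n' →L[ℝ] Vec n' →L[ℝ] ℝ, (∀ a b, H a b = H b a) → H eu eu = 0 →
      k.symb α₀ (pullHess D K dt H) = 0 := by
    intro H hH h0
    have := eq_zero_of_forall_ne_zero (hcont (dx i₁) (fun _ => H) continuous_const) fun ε hε => by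
      refine h.pull _ _ hH (Or.inr ⟨i₁, by simpa using hε⟩) ?_
      rw [k'.symb_of_apply_eu_eq_zero (by simp), h0, mul_zero]
    simpa using this
  -- limits of zeros of the symbol over `dt + ε du`: all `H` of trace one with respect to `b'`
  have hbb : ∀ H : Vec n' →L[ℝ] Vec n' →L[ℝ] ℝ, (∀ a b, H a b = H b a) →
      ∑ i, ∑ j, k'.b i j * H (ex i) (ex j) = 1 → k.symb α₀ (pullHess D K dt H) = 0 := by
    intro H hH h1
    have := eq_zero_of_forall_ne_zero (hcont du (fun ε => (1 + ε * k'.q) • H) (by fun_prop))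
      fun ε hε => by
        refine h.pull _ _ (fun a b => by simp [hH a b]) (Or.inl (by simpa using hε)) ?_
        rw [k'.symb_of_apply_ex_eq_zero (by simp)]
        have : ∑ i, ∑ j, k'.b i j * ((1 + ε * k'.q) • H) (ex i) (ex j) = 1 + ε * k'.q := by
          rw [← mul_one (1 + ε * k'.q), ← h1]
          simp only [Finset.mul_sum, smul_apply, smul_eq_mul]
          exact Finset.sum_congr rfl fun i _ => Finset.sum_congr rfl fun j _ => by
            simp only [← Finset.mul_sum, h1]; ring
        rw [this]
        simp
    simpa using this
  -- the linear part of the symbol over `α₀`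
  set w := kerVec α₀ with hw
  let l : (Vec n' →L[ℝ] Vec n' →L[ℝ] ℝ) → ℝ := fun G =>
    ∑ i, ∑ j, k.b i j * G (D (w i)) (D (w j))
  have hsplit : ∀ G, k.symb α₀ (pullHess D K dt G) = k.symb α₀ (pullHess D K dt 0) - l G := by
    intro G
    simp only [ParabolicCoeffs.symb, pullHess_apply, mul_add, Finset.sum_add_distrib, l]
    simp
    ring
  have h00 : k.symb α₀ (pullHess D K dt 0) = 0 := ha 0 (by simp) (by simp)
  have hladd : ∀ G G', l (G + G') = l G + l G' := by
    intro G G'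
    simp only [l, add_apply, mul_add, Finset.sum_add_distrib]
  have hlsmul : ∀ (c : ℝ) G, l (c • G) = c * l G := by
    intro c G
    simp only [l, smul_apply, smul_eq_mul, Finset.mul_sum]
    exact Finset.sum_congr rfl fun i _ => Finset.sum_congr rfl fun j _ => by ring
  have hla : ∀ G, (∀ a b, G a b = G b a) → G eu eu = 0 → l G = 0 := fun G hG h0 => by
    have := ha G hG h0
    rw [hsplit, h00] at this
    linarith
  have hlb : ∀ G : Vec n' →L[ℝ] Vec n' →L[ℝ] ℝ, (∀ a b, G a b = G b a) →
      ∑ i, ∑ j, k'.b i j * G (ex i) (ex j) = 1 → l G = 0 := fun G hG h0 => by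
    have := hbb G hG h0
    rw [hsplit, h00] at this
    linarith
  have hb11 : 0 < k'.b i₁ i₁ := by
    have := sum_mul_pos hb' (x := Pi.single i₁ 1) (by simp)
    simpa [Pi.single_apply] using this
  let G₀ : Vec n' →L[ℝ] Vec n' →L[ℝ] ℝ := (k'.b i₁ i₁)⁻¹ • sq (dx i₁)
  have hG₀s : ∀ a b, G₀ a b = G₀ b a := fun a b => by
    simp only [G₀, smul_apply, sq_apply, mul_comm]
  have hG₀u : G₀ eu eu = 0 := by simp [G₀]
  have hG₀t : ∑ i, ∑ j, k'.b i j * G₀ (ex i) (ex j) = 1 := by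
    simp [G₀, hb11.ne']
  have hldu : l (sq du) = 0 := by
    have h1 := hlb (G₀ + sq du) (fun a b => by
      simp only [add_apply, hG₀s a b, sq_apply, mul_comm]) (by simpa using hG₀t)
    rw [hladd, hla G₀ hG₀s hG₀u] at h1
    linarith
  have hlsq : ∀ m : Vec n' →L[ℝ] ℝ, l (sq m) = 0 := by
    intro m
    have h1 := hla (sq m + (-(m eu) ^ 2) • sq du) (fun a b => by
      simp only [add_apply, smul_apply, smul_eq_mul, sq_apply]; ring) (by simp; ring)
    rw [hladd, hlsmul, hldu] at h1
    linarith
  have hDw : ∀ (m : Vec n' →L[ℝ] ℝ) i, m (D (w i)) = 0 := by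
    intro m i
    by_contra hmi
    have h1 := sum_mul_pos hb (x := fun i => m (D (w i))) fun h0 => hmi (congrFun h0 i)
    have h2 := hlsq m
    simp only [l, sq_apply] at h2
    exact h1.ne' h2
  have hDw' : ∀ (m : Vec n' →L[ℝ] ℝ) i, α₀ eu * m (D (ex i)) = α₀ (ex i) * m (D eu) := by
    intro m i
    have := hDw m i
    simp only [hw, kerVec, map_sub, map_smul, smul_eq_mul] at this
    linarith
  by_cases hu : α₀ eu = 0
  -- now `D ∂_u = 0`, and the symbol over the pull-back of `dt + s du` is independent of `H`
  · obtain ⟨j, hj⟩ := hne.resolve_left fun h0 => h0 hu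
    have hDu : ∀ m : Vec n' →L[ℝ] ℝ, m (D eu) = 0 := by
      intro m
      have := hDw' m j
      rw [hu, zero_mul] at this
      exact (mul_eq_zero.1 this.symm).resolve_left hj
    obtain ⟨s, hs, hsj⟩ : ∃ s : ℝ, s ^ 2 = 1 ∧ (dt + s • du : Vec n' →L[ℝ] ℝ).comp D (ex j) ≠ 0 := by
      by_contra! hall
      have h1 := hall 1 (by norm_num)
      have h2 := hall (-1) (by norm_num)
      simp at h1 h2
      apply hj
      change dt (D (ex j)) = 0
      linarith
    set α : Vec n' →L[ℝ] ℝ := dt + s • du with hα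
    have hαu : α eu = s := by simp [hα]
    have hαt : α et = 1 := by simp [hα]
    have hαx : ∀ i, α (ex i) = 0 := by simp [hα]
    have hs0 : s ≠ 0 := by
      rintro rfl
      norm_num at hs
    have hcu : α.comp D eu = 0 := hDu α
    have hDu0 : D eu = 0 := by
      have e1 := eq_sum (D eu)
      have e2 : (D eu).1 = 0 := hDu dt
      have e3 : ∀ i, (D eu).2.1 i = 0 := fun i => hDu (dx i)
      have e4 : (D eu).2.2 = 0 := hDu du
      rw [e1, e2, e4]
      simp [e3]
    have hval : ∀ H, k.symb (α.comp D) (pullHess D K α H) =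
        -(∑ i, ∑ j, k.b i j * (α.comp D (ex i) * α.comp D (ex j))) * α (K eu eu) := fun H => by
      rw [k.symb_of_apply_eu_eq_zero hcu, pullHess_apply, hDu0]
      simp
    have h1 := h.pull α ((1 + s * k'.q) • G₀) (fun a b => by
      simp only [smul_apply, hG₀s a b]) (Or.inl (hαu ▸ hs0)) (by
      rw [k'.symb_of_apply_ex_eq_zero hαx]
      simp only [smul_apply, smul_eq_mul, mul_left_comm _ (1 + s * k'.q), ← Finset.mul_sum, hG₀t,
        hαt, hαu]
      ring)
    rw [hval] at h1
    have h2 := h.push α ((2 + s * k'.q) • G₀) (fun a b => by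
      simp only [smul_apply, hG₀s a b]) (fun h0 => by rw [h0] at hαt; simp at hαt)
      (Or.inr ⟨j, hsj⟩) (by rw [hval, h1])
    rw [k'.symb_of_apply_ex_eq_zero hαx] at h2
    simp only [smul_apply, smul_eq_mul, mul_left_comm _ (2 + s * k'.q), ← Finset.mul_sum, hG₀t,
        hαt, hαu, hs] at h2
    linarith
  -- now all `D ∂_i` are multiples of `D ∂_u`, so that some covector in the span of `dt`, `dx`, `du`
  -- vanishes on the image of `D`
  · let Φ : (ℝ × ℝ × ℝ) →ₗ[ℝ] (ℝ × ℝ) :=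
      { toFun := fun x => (x.1 * dt (D eu) + x.2.1 * dx i₁ (D eu) + x.2.2 * du (D eu),
          x.1 * dt (D et) + x.2.1 * dx i₁ (D et) + x.2.2 * du (D et))
        map_add' := fun x y => by
          ext <;> simp <;> ring
        map_smul' := fun c x => by
          ext <;> simp <;> ring }
    have hker : LinearMap.ker Φ ≠ ⊥ := LinearMap.ker_ne_bot_of_finrank_lt (by simp)
    obtain ⟨x, hx, hx0⟩ := Submodule.exists_mem_ne_zero_of_ne_bot hker
    let m : Vec n' →L[ℝ] ℝ := x.1 • dt + x.2.1 • dx i₁ + x.2.2 • du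
    have hΦ : Φ x = 0 := hx
    have hmu : m (D eu) = 0 := congrArg Prod.fst hΦ
    have hmt : m (D et) = 0 := congrArg Prod.snd hΦ
    refine h.comp_ne_zero m (fun hm => hx0 ?_) (clm_ext hmt (fun i => ?_) hmu)
    · have h1 := congrArg (fun l : Vec n' →L[ℝ] ℝ => l et) hm
      have h2 := congrArg (fun l : Vec n' →L[ℝ] ℝ => l (ex i₁)) hm
      have h3 := congrArg (fun l : Vec n' →L[ℝ] ℝ => l eu) hm
      simp [m] at h1 h2 h3
      exact Prod.ext h1 (Prod.ext h2 h3)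
    · have := hDw' m i
      rw [hmu, mul_zero] at this
      exact (mul_eq_zero.1 this).resolve_left hu

theorem dt_comp_et_ne_zero (h : IsSymbolMorphism k k' D K)
    (hdt : dt (D eu) = 0 ∧ ∀ i, dt (D (ex i)) = 0) : dt (D et) ≠ 0 := fun h0 =>
  h.comp_ne_zero dt (fun h1 => by
    have := congrArg (fun l : Vec n' →L[ℝ] ℝ => l et) h1
    simp at this) (clm_ext h0 hdt.2 hdt.1)

/-- If the time component of a morphism depends on `t` only, then its `X`-component does not depend on
`u`, to first order: the jets `(dx + s dt, 0)` have vanishing symbol for all `s`. -/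
theorem dx_comp_eu_eq_zero (h : IsSymbolMorphism k k' D K)
    (hdt : dt (D eu) = 0 ∧ ∀ i, dt (D (ex i)) = 0)
    (hK : ∀ a b : Vec n, a.1 = 0 → b.1 = 0 → dt (K a b) = 0) (l : Fin n') : dx l (D eu) = 0 := by
  have key : ∀ s : ℝ, k.symb ((dx l + s • dt).comp D) (pullHess D K (dx l + s • dt) 0) = 0 :=
    fun s => h.pull _ 0 (by simp) (Or.inr ⟨l, by simp⟩) (by
      rw [k'.symb_of_apply_eu_eq_zero (by simp)]; simp)
  have h0 := key 0
  have h1 := key 1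
  have hw : ∀ s : ℝ, ∀ i, kerVec ((dx l + s • dt).comp D) i = kerVec ((dx l).comp D) i := by
    intro s i
    simp [kerVec, hdt.1, hdt.2]
  have hw0 : ∀ i, (kerVec ((dx l).comp D) i).1 = 0 := fun i => by simp [kerVec, ex, eu]
  have e0 : (dx l + (0 : ℝ) • dt : Vec n' →L[ℝ] ℝ) = dx l := by simp
  simp only [ParabolicCoeffs.symb, hw] at h0 h1
  simp [hdt.1, hdt.2, hK _ _ (hw0 _) (hw0 _)] at h0 h1
  have hμ := h.dt_comp_et_ne_zero hdt
  have : dt (D et) * dx l (D eu) ^ 2 = 0 := by linarith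
  exact pow_eq_zero_iff (two_ne_zero) |>.1 ((mul_eq_zero.1 this).resolve_left hμ)

/-- Morphisms which are immersions in the `u`-direction preserve the direction of time: compare the
zeros `(du + τ dt, r dx²)` of the symbol, with `τ` depending on `r`, for `r = 0` and `r = 1`. -/
theorem dt_comp_et_pos (h : IsSymbolMorphism k k' D K) (hb : k.b.PosDef) (hb' : k'.b.PosDef)
    (hn' : 1 ≤ n') (hdt : dt (D eu) = 0 ∧ ∀ i, dt (D (ex i)) = 0)
    (hK : ∀ a b : Vec n, a.1 = 0 → b.1 = 0 → dt (K a b) = 0) (hu : du (D eu) ≠ 0) :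
    0 < dt (D et) := by
  let i₁ : Fin n' := ⟨0, hn'⟩
  have hb11 : 0 < k'.b i₁ i₁ := by
    have := sum_mul_pos hb' (x := Pi.single i₁ 1) (by simp)
    simpa [Pi.single_apply] using this
  have key : ∀ r : ℝ, k.symb ((du + (r * k'.b i₁ i₁ - k'.q) • dt).comp D)
      (pullHess D K (du + (r * k'.b i₁ i₁ - k'.q) • dt) (r • sq (dx i₁))) = 0 := fun r =>
    h.pull _ _ (fun a b => by simp [mul_comm]) (Or.inl (by simp)) (by
      rw [k'.symb_of_apply_ex_eq_zero (by simp)]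
      simp
      ring)
  have h0 := key 0
  have h1 := key 1
  have hw : ∀ s : ℝ, ∀ i, kerVec ((du + s • dt).comp D) i = kerVec (du.comp D) i := by
    intro s i
    simp [kerVec, hdt.1, hdt.2]
  have hw0 : ∀ i, (kerVec ((du : Vec n' →L[ℝ] ℝ).comp D) i).1 = 0 := fun i => by
    simp [kerVec, ex, eu]
  simp only [ParabolicCoeffs.symb, hw] at h0 h1
  simp [hdt.1, hdt.2, hK _ _ (hw0 _) (hw0 _), mul_add, Finset.sum_add_distrib] at h0 h1
  have hnn := sum_mul_nonneg hb fun i => dx i₁ (D (kerVec (du.comp D) i))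
  have hμ := h.dt_comp_et_ne_zero hdt
  have hm : 0 < du (D eu) ^ 2 := by positivity
  have e : dt (D et) * (k'.b i₁ i₁ * du (D eu) ^ 2) =
      ∑ i, ∑ j, k.b i j * (dx i₁ (D (kerVec (du.comp D) i)) * dx i₁ (D (kerVec (du.comp D) j))) := by
    linarith
  have : 0 ≤ dt (D et) := by
    rw [← e] at hnn
    exact nonneg_of_mul_nonneg_left hnn (by positivity)
  exact lt_of_le_of_ne this hμ.symm

end IsSymbolMorphism

end LinearAlgebra

/-! ### Morphisms have triangular form -/

section Submersions

variable {E H N : Type*} [NormedAddCommGroup E] [NormedSpace ℝ E] [TopologicalSpace H]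
  [TopologicalSpace N] [ChartedSpace H N] {I : ModelWithCorners ℝ E H}
  {E' H' N' : Type*} [NormedAddCommGroup E'] [NormedSpace ℝ E'] [TopologicalSpace H']
  [TopologicalSpace N'] [ChartedSpace H' N'] {I' : ModelWithCorners ℝ E' H'}
  {E'' H'' N'' : Type*} [NormedAddCommGroup E''] [NormedSpace ℝ E''] [TopologicalSpace H'']
  [TopologicalSpace N''] [ChartedSpace H'' N''] {I'' : ModelWithCorners ℝ E'' H''}

theorem IsSmoothSubmersion.comp {G : N' → N''} {F : N → N'} (hG : IsSmoothSubmersion I' I'' G)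
    (hF : IsSmoothSubmersion I I' F) : IsSmoothSubmersion I I'' (G ∘ F) := by
  refine ⟨hG.1.comp hF.1, fun x => ?_⟩
  rw [mfderiv_comp x ((hG.1 (F x)).mdifferentiableAt (by simp))
    ((hF.1 x).mdifferentiableAt (by simp))]
  exact (hG.2 (F x)).comp (hF.2 x)

theorem IsSmoothSubmersion.of_comp {G : N' → N''} {F : N → N'} (hG : ContMDiff I' I'' ∞ G)
    (hF : ContMDiff I I' ∞ F) (hs : Function.Surjective F) (h : IsSmoothSubmersion I I'' (G ∘ F)) :
    IsSmoothSubmersion I' I'' G := by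
  refine ⟨hG, fun y => ?_⟩
  obtain ⟨x, rfl⟩ := hs y
  have h1 := h.2 x
  rw [mfderiv_comp x ((hG (F x)).mdifferentiableAt (by simp))
    ((hF x).mdifferentiableAt (by simp))] at h1
  exact Function.Surjective.of_comp h1

theorem isSmoothSubmersion_fst : IsSmoothSubmersion (I.prod I') I (Prod.fst : N × N' → N) := by
  refine ⟨contMDiff_fst, fun x => ?_⟩
  rw [mfderiv_fst]
  exact fun v => ⟨(v, 0), rfl⟩

theorem isSmoothSubmersion_snd : IsSmoothSubmersion (I.prod I') I' (Prod.snd : N × N' → N') := by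
  refine ⟨contMDiff_snd, fun x => ?_⟩
  rw [mfderiv_snd]
  exact fun v => ⟨(0, v), rfl⟩

end Submersions

section Triangular

open Coordinates Vec

theorem eventually_eq_of_fderiv_eq_zero {B V G : Type*} [NormedAddCommGroup B] [NormedSpace ℝ B]
    [NormedAddCommGroup V] [NormedSpace ℝ V] [NormedAddCommGroup G] [NormedSpace ℝ G] (j : B →L[ℝ] V)
    {R : V → G} {z₀ : V}
    (h : ∀ᶠ z in 𝓝 z₀, DifferentiableAt ℝ R z ∧ ∀ b, fderiv ℝ R z (j b) = 0) :
    ∀ᶠ b in 𝓝 (0 : B), R (z₀ + j b) = R z₀ := by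
  have hc : Tendsto (fun b => z₀ + j b) (𝓝 0) (𝓝 z₀) := by
    have : Continuous fun b => z₀ + j b := by fun_prop
    simpa using this.tendsto 0
  obtain ⟨δ, hδ, hball⟩ := Metric.eventually_nhds_iff_ball.1 (hc.eventually h)
  filter_upwards [Metric.ball_mem_nhds (0 : B) hδ] with b hb
  have hd : ∀ c ∈ Metric.ball (0 : B) δ, HasFDerivAt (fun b => R (z₀ + j b)) (0 : B →L[ℝ] G) c := by
    intro c hc'
    have h1 : HasFDerivAt (fun b => z₀ + j b) j c := j.hasFDerivAt.const_add z₀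
    refine ((hball c hc').1.hasFDerivAt.comp c h1).congr_fderiv ?_
    exact ContinuousLinearMap.ext fun v => (hball c hc').2 v
  have := Metric.isOpen_ball.is_const_of_fderiv_eq_zero (𝕜 := ℝ) (convex_ball (0 : B) δ).isPreconnected
    (fun c hc => (hd c hc).differentiableAt.differentiableWithinAt) (fun c hc => (hd c hc).fderiv)
    hb (Metric.mem_ball_self hδ)
  simpa using this

/-- Any `2`-jet of functions vanishing at a point is realized in coordinates by a quadratic polynomial. -/
theorem Coordinates.exists_d1_d2_eq {E H N : Type*} [NormedAddCommGroup E] [NormedSpace ℝ E]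
    [TopologicalSpace H] [TopologicalSpace N] [ChartedSpace H N] {I : ModelWithCorners ℝ E H}
    {B : Type*} [NormedAddCommGroup B] [NormedSpace ℝ B] (e : Coordinates I N B) {x : N}
    (hx : x ∈ e.source) (α : B →L[ℝ] ℝ) (A : B →L[ℝ] B →L[ℝ] ℝ) (hA : ∀ a b, A a b = A b a) :
    ∃ f : N → ℝ, ContMDiffOn I 𝓘(ℝ, ℝ) ∞ f e.source ∧ f x = 0 ∧ e.d1 f x = α ∧ e.d2 f x = A := by
  set z := e.toPartialEquiv x with hz
  let P : B → ℝ := fun w => α (w - z) + (1 / 2) * A (w - z) (w - z)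
  have hP : ContDiff ℝ ∞ P := by
    have h1 : ContDiff ℝ ∞ fun w : B => w - z := contDiff_id.sub contDiff_const
    exact (α.contDiff.comp h1).add (contDiff_const.mul ((A.contDiff.comp h1).clm_apply h1))
  have hd : ∀ w, HasFDerivAt P (α + A (w - z)) w := by
    intro w
    have h1 : HasFDerivAt (fun w : B => w - z) (ContinuousLinearMap.id ℝ B) w :=
      (hasFDerivAt_id w).sub_const z
    have h2 := (α.hasFDerivAt.comp w h1).add
      (((A.hasFDerivAt.comp w h1).clm_apply h1).const_mul (1 / 2))
    refine h2.congr_fderiv (ContinuousLinearMap.ext fun v => ?_)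
    simp [hA v w, hA v z]
    ring
  have hev : (P ∘ e.toPartialEquiv) ∘ e.toPartialEquiv.symm =ᶠ[𝓝 z] P := by
    filter_upwards [e.open_target.mem_nhds (e.map_source hx)] with w hw
    simp [e.right_inv hw]
  refine ⟨P ∘ e.toPartialEquiv, hP.contMDiff.comp_contMDiffOn e.contMDiffOn_toFun, by simp [P, hz],
    ?_, ?_⟩
  · rw [d1, hev.fderiv_eq, (hd z).fderiv]
    simp
  · have h1 : fderiv ℝ P = fun w => α + A (w - z) := funext fun w => (hd w).fderiv
    have h2 : HasFDerivAt (fun w : B => w - z) (ContinuousLinearMap.id ℝ B) z :=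
      (hasFDerivAt_id z).sub_const z
    rw [d2, hev.fderiv.fderiv_eq, h1]
    exact ((A.hasFDerivAt.comp z h2).const_add α).fderiv

variable {M M' : ParabolicDomain.{u}} {L : M.T → M.X → (M.X → ℝ) → ℝ}
  {L' : M'.T → M'.X → (M'.X → ℝ) → ℝ}

/-- The preimage of a hypersurface under a submersion. -/
def PointedSubmanifold.preimage {F : M.N → M'.N} (hF : IsSmoothSubmersion M.I M'.I F)
    (S : PointedSubmanifold M'.I M'.N ℝ) (p : M.N) (hp : F p = S.pt) :
    PointedSubmanifold M.I M.N ℝ where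
  pt := p
  carrier := F ⁻¹' S.carrier
  pt_mem := by rw [mem_preimage, hp]; exact S.pt_mem
  isSubmanifold x hx := by
    obtain ⟨f, hf⟩ := S.isSubmanifold (F x) hx
    exact ⟨f ∘ F, hf.comp hF⟩

theorem IsPDEMorphism.preimage_mem_iff {F : M.N → M'.N} {𝓔 : Set (JetSpace M.I M.N ℝ 2)}
    {𝓔' : Set (JetSpace M'.I M'.N ℝ 2)} (h : IsPDEMorphism M.I M'.I F 𝓔 𝓔')
    (S : PointedSubmanifold M'.I M'.N ℝ) (p : M.N) (hp : F p = S.pt) :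
    (S.preimage h.submersion p hp).jet 2 ∈ 𝓔 ↔ S.jet 2 ∈ 𝓔' := by
  have him : F '' (F ⁻¹' S.carrier) = S.carrier := image_preimage_eq _ h.surjective
  exact h.mem_iff _ _ ⟨S.preimage h.submersion p hp, S, by
    change F ⁻¹' S.carrier = F ⁻¹' (F '' (F ⁻¹' S.carrier))
    rw [him], him.symm, hp.symm, rfl, rfl⟩

theorem IsPDEMorphism.isSymbolMorphism {F : M.N → M'.N}
    (h : IsPDEMorphism M.I M'.I F (closure (graphEquation M L)) (closure (graphEquation M' L')))
    (D : LocalForm M L) (D' : LocalForm M' L') {p : M.N} (hp : p ∈ D.W) (hp' : F p ∈ D'.W) :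
    IsSymbolMorphism (D.coeffs p) (D'.coeffs (F p))
      (fderiv ℝ (D.coord.rep D'.coord F) (D.coord.toPartialEquiv p))
      (fderiv ℝ (fderiv ℝ (D.coord.rep D'.coord F)) (D.coord.toPartialEquiv p)) := by
  set R := D.coord.rep D'.coord F
  set z := D.coord.toPartialEquiv p
  have hx := D.mem_coord_source hp
  have hx' := D'.mem_coord_source hp'
  have hF : ContMDiffAt M.I M'.I ∞ F p := h.submersion.1 p
  have key : ∀ (α : Vec M'.n →L[ℝ] ℝ) (A : Vec M'.n →L[ℝ] Vec M'.n →L[ℝ] ℝ),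
      (∀ a b, A a b = A b a) → α ≠ 0 → ∃ (S : PointedSubmanifold M'.I M'.N ℝ) (hS : F p = S.pt)
        (f : M'.N → ℝ),
        IsLocalEquation M'.I f S.carrier S.pt ∧ D'.symbAt f (F p) = (D'.coeffs (F p)).symb α A ∧
        D'.coord.d1 f (F p) = α ∧
        IsLocalEquation M.I (f ∘ F) (S.preimage h.submersion p hS).carrier p ∧
        D.coord.d1 (f ∘ F) p = α.comp (fderiv ℝ R z) ∧
        D.symbAt (f ∘ F) p =
          (D.coeffs p).symb (α.comp (fderiv ℝ R z)) (pullHess (fderiv ℝ R z)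
            (fderiv ℝ (fderiv ℝ R) z) α A) := by
    intro α A hA hα
    obtain ⟨f, hf, hf0, hf1, hf2⟩ := D'.coord.exists_d1_d2_eq hx' α A hA
    obtain ⟨S, hS, hSf⟩ := PointedSubmanifold.exists_of_d1_ne_zero hx' D'.coord.open_source hx' hf hf0
      (by rw [hf1]; exact hα)
    have hfa : ContMDiffAt M'.I 𝓘(ℝ, ℝ) ∞ f (F p) := hSf.contMDiffAt
    have c1 : D.coord.d1 (f ∘ F) p = α.comp (fderiv ℝ R z) := by
      rw [d1_comp hx hx' hF hfa, hf1]
    have c2 : D.coord.d2 (f ∘ F) p = pullHess (fderiv ℝ R z) (fderiv ℝ (fderiv ℝ R) z) α A := by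
      refine ContinuousLinearMap.ext fun a => ContinuousLinearMap.ext fun b => ?_
      rw [d2_comp hx hx' hF hfa, hf1, hf2]
      rfl
    exact ⟨S, hS.symm, f, hS.symm ▸ hSf, by rw [LocalForm.symbAt, hf1, hf2], hf1,
      hSf.comp h.submersion, c1, by rw [LocalForm.symbAt, c1, c2]⟩
  have hne : ∀ α : Vec M'.n →L[ℝ] ℝ, (α eu ≠ 0 ∨ ∃ i, α (ex i) ≠ 0) → α ≠ 0 := by
    rintro α hα rfl
    simp at hα
  refine ⟨fun α hα => ?_, fun α A hA hα h0 => ?_, fun α A hA hα hD h0 => ?_⟩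
  · obtain ⟨S, hS, f, h1, h2, h3, h4, h5, h6⟩ := key α 0 (by simp) hα
    rw [← h5]
    exact h4.d1_ne_zero hx
  · obtain ⟨S, hS, f, h1, h2, h3, h4, h5, h6⟩ := key α A hA (hne α hα)
    rw [← h6]
    refine D.symbAt_eq_zero_of_mem_closure (S := S.preimage h.submersion p hS) hp h4
      ((h.preimage_mem_iff S p hS).2 ?_)
    refine D'.mem_closure_of_symbAt_eq_zero (hS ▸ hp') h1 ?_ ?_
    · rw [← hS, h2, h0]
    · rw [← hS, h3]
      exact hα
  · obtain ⟨S, hS, f, h1, h2, h3, h4, h5, h6⟩ := key α A hA hα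
    rw [← h2, hS]
    refine D'.symbAt_eq_zero_of_mem_closure (hS ▸ hp') h1 ((h.preimage_mem_iff S p hS).1 ?_)
    refine D.mem_closure_of_symbAt_eq_zero (S := S.preimage h.submersion p hS) hp h4 ?_ ?_
    · exact h6.trans h0
    · change D.coord.d1 (f ∘ F) p eu ≠ 0 ∨ ∃ i, D.coord.d1 (f ∘ F) p (ex i) ≠ 0
      rw [h5]
      exact hD

end Triangular

section TriangularForm

open Coordinates Vec

variable {M M' : ParabolicDomain.{u}} {L : M.T → M.X → (M.X → ℝ) → ℝ}
  {L' : M'.T → M'.X → (M'.X → ℝ) → ℝ}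

theorem fderiv_fderiv_apply_eq_zero {V V' : Type*} [NormedAddCommGroup V] [NormedSpace ℝ V]
    [NormedAddCommGroup V'] [NormedSpace ℝ V'] {R : V → V'} {z : V} (hR : ContDiffAt ℝ ∞ R z)
    {l : V' →L[ℝ] ℝ} {b : V} (h : ∀ᶠ w in 𝓝 z, l (fderiv ℝ R w b) = 0) (a : V) :
    l (fderiv ℝ (fderiv ℝ R) z a b) = 0 := by
  have hd : DifferentiableAt ℝ (fderiv ℝ R) z :=
    ((hR.of_le (WithTop.coe_le_coe.2 (le_top : (2 : ℕ∞) ≤ ⊤))).fderiv_right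
      (m := 1) (by norm_num)).differentiableAt (by simp)
  have h1 : HasFDerivAt (fun w => l (fderiv ℝ R w b)) _ z :=
    l.hasFDerivAt.comp z (hd.hasFDerivAt.clm_apply (hasFDerivAt_const b z))
  have h2 : (fun w => l (fderiv ℝ R w b)) =ᶠ[𝓝 z] fun _ => 0 := h
  have h3 := h1.fderiv
  rw [h2.fderiv_eq] at h3
  have := congrArg (fun l : V →L[ℝ] ℝ => l a) h3
  simp at this
  exact this.symm

theorem Vec.dt_apply_eq_zero {n n' : ℕ} {D : Vec n →L[ℝ] Vec n'}
    (h : dt (D eu) = 0 ∧ ∀ i, dt (D (ex i)) = 0) (b : Vec n) (hb : b.1 = 0) : dt (D b) = 0 := by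
  have := clm_apply (dt.comp D) b
  simpa [hb, h.1, h.2] using this

section Morphism

variable {F : M.N → M'.N}
  (h : IsPDEMorphism M.I M'.I F (closure (graphEquation M L)) (closure (graphEquation M' L')))
  (D : LocalForm M L) (D' : LocalForm M' L')

include h

theorem IsPDEMorphism.eventually_dt_eq_zero {p : M.N} (hp : p ∈ D.W) (hp' : F p ∈ D'.W) :
    ∀ᶠ w in 𝓝 (D.coord.toPartialEquiv p), ContDiffAt ℝ ∞ (D.coord.rep D'.coord F) w ∧
      (D.coord.toPartialEquiv.symm w ∈ D.W ∧ F (D.coord.toPartialEquiv.symm w) ∈ D'.W ∧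
        w ∈ D.coord.target) ∧
      ∀ b : Vec M.n, b.1 = 0 → dt (fderiv ℝ (D.coord.rep D'.coord F) w b) = 0 := by
  have hx := D.mem_coord_source hp
  have hc : ∀ᶠ y in 𝓝 p, y ∈ D.W ∧ F y ∈ D'.W :=
    (D.isOpen_W.eventually_mem hp).and
      ((h.submersion.1.continuous.continuousAt).eventually (D'.isOpen_W.eventually_mem hp'))
  filter_upwards [(tendsto_symm hx).eventually hc,
    D.coord.open_target.mem_nhds (D.coord.map_source hx)] with w hw hwt
  have hsym := h.isSymbolMorphism D D' hw.1 hw.2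
  have hs := D.coord.right_inv hwt
  have hR := contDiffAt_rep (D.mem_coord_source hw.1) (D'.mem_coord_source hw.2) (h.submersion.1 _)
  rw [hs] at hsym hR
  exact ⟨hR, ⟨hw.1, hw.2, hwt⟩, dt_apply_eq_zero (hsym.dt_comp_eq (D.posDef _ hw.1)
    (D'.posDef _ hw.2) M'.one_le_n)⟩

theorem IsPDEMorphism.dt_second_eq_zero {p : M.N} (hp : p ∈ D.W) (hp' : F p ∈ D'.W) (a b : Vec M.n)
    (hb : b.1 = 0) : dt (fderiv ℝ (fderiv ℝ (D.coord.rep D'.coord F))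
      (D.coord.toPartialEquiv p) a b) = 0 := by
  have hev := h.eventually_dt_eq_zero D D' hp hp'
  exact fderiv_fderiv_apply_eq_zero hev.self_of_nhds.1 (hev.mono fun w hw => hw.2.2 b hb) a

theorem IsPDEMorphism.dx_eq_zero {p : M.N} (hp : p ∈ D.W) (hp' : F p ∈ D'.W) (l : Fin M'.n) :
    dx l (fderiv ℝ (D.coord.rep D'.coord F) (D.coord.toPartialEquiv p) eu) = 0 :=
  (h.isSymbolMorphism D D' hp hp').dx_comp_eu_eq_zero
    ((h.isSymbolMorphism D D' hp hp').dt_comp_eq (D.posDef _ hp) (D'.posDef _ hp') M'.one_le_n)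
    (fun a b _ hb => h.dt_second_eq_zero D D' hp hp' a b hb) l

/-- The time component of a morphism depends on `t` only, locally. -/
theorem IsPDEMorphism.eventually_fst_eq {p : M.N} (hp : p ∈ D.W) (hp' : F p ∈ D'.W) :
    ∀ᶠ y in 𝓝 p.2, (F (p.1, y)).1 = (F p).1 := by
  set R := D.coord.rep D'.coord F with hRdef
  set z := D.coord.toPartialEquiv p with hz
  have hx := D.mem_coord_source hp
  have hev := h.eventually_dt_eq_zero D D' hp hp'
  let j : (EuclideanSpace ℝ (Fin M.n) × ℝ) →L[ℝ] Vec M.n := ContinuousLinearMap.inr ℝ _ _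
  have h1 := eventually_eq_of_fderiv_eq_zero j (R := fun w => dt (R w)) (z₀ := z) (by
    filter_upwards [hev] with w hw
    have hd := hw.1.differentiableAt (by simp)
    have hd' : HasFDerivAt (fun w => dt (R w)) _ w :=
      (dt : Vec M'.n →L[ℝ] ℝ).hasFDerivAt.comp w hd.hasFDerivAt
    refine ⟨hd'.differentiableAt, fun b => ?_⟩
    rw [hd'.fderiv]
    exact hw.2.2 (j b) rfl)
  have hcont : ContinuousAt (fun y : M.X × M.Ω => ((D.φ y.1 - D.φ p.2.1, (y.2 : ℝ) - p.2.2) :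
      EuclideanSpace ℝ (Fin M.n) × ℝ)) p.2 := by
    have : ContinuousAt (fun y : M.X × M.Ω => D.φ y.1) p.2 :=
      ContinuousAt.comp (f := fun y : M.X × M.Ω => y.1)
        (D.φ.continuousAt (D.mem_source p hp)) continuousAt_fst
    exact (this.sub continuousAt_const).prodMk
      ((continuous_subtype_val.comp continuous_snd).continuousAt.sub continuousAt_const)
  have h2 := hcont.tendsto
  simp only [sub_self] at h2
  have hsrc : ∀ᶠ y in 𝓝 p.2, ((p.1, y) : M.N) ∈ D.coord.source :=
    (Continuous.prodMk_right p.1).continuousAt.eventually (D.coord.open_source.eventually_mem hx)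
  filter_upwards [h2.eventually h1, hsrc] with y hy hys
  have e1 : z + j (D.φ y.1 - D.φ p.2.1, (y.2 : ℝ) - p.2.2) = D.coord.toPartialEquiv (p.1, y) := by
    refine Prod.ext ?_ (Prod.ext ?_ ?_)
    · exact add_zero _
    · exact add_sub_cancel _ _
    · exact add_sub_cancel _ _
  rw [e1, hRdef, rep_apply hys, rep_apply hx] at hy
  exact Subtype.ext hy

/-- The `X'`-component of a morphism does not depend on `u`, locally. -/
theorem IsPDEMorphism.eventually_snd_fst_eq {p : M.N} (hp : p ∈ D.W) (hp' : F p ∈ D'.W) :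
    ∀ᶠ y in 𝓝 p.2.2, (F (p.1, p.2.1, y)).2.1 = (F p).2.1 := by
  set R := D.coord.rep D'.coord F with hRdef
  set z := D.coord.toPartialEquiv p with hz
  have hx := D.mem_coord_source hp
  have hev := h.eventually_dt_eq_zero D D' hp hp'
  let j : ℝ →L[ℝ] Vec M.n := (ContinuousLinearMap.inr ℝ _ _).comp (ContinuousLinearMap.inr ℝ _ _)
  let π : Vec M'.n →L[ℝ] EuclideanSpace ℝ (Fin M'.n) :=
    (ContinuousLinearMap.fst ℝ _ _).comp (ContinuousLinearMap.snd ℝ _ _)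
  have h1 := eventually_eq_of_fderiv_eq_zero j (R := fun w => π (R w)) (z₀ := z) (by
    filter_upwards [hev] with w hw
    have hd := hw.1.differentiableAt (by simp)
    have hd' : HasFDerivAt (fun w => π (R w)) _ w := π.hasFDerivAt.comp w hd.hasFDerivAt
    refine ⟨hd'.differentiableAt, fun b => ?_⟩
    rw [hd'.fderiv]
    have hj : j b = b • eu := by
      refine Prod.ext ?_ (Prod.ext ?_ ?_) <;> simp [j, eu]
    have h0 := h.dx_eq_zero D D' hw.2.1.1 hw.2.1.2.1
    rw [D.coord.right_inv hw.2.1.2.2] at h0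
    rw [hj, map_smul]
    have : (π.comp (fderiv ℝ R w)) eu = 0 := by
      ext l
      exact h0 l
    rw [this, smul_zero])
  have hcont : ContinuousAt (fun y : M.Ω => (y : ℝ) - p.2.2) p.2.2 :=
    continuous_subtype_val.continuousAt.sub continuousAt_const
  have h2 := hcont.tendsto
  simp only [sub_self] at h2
  have hcF : ContinuousAt (fun y : M.Ω => F (p.1, p.2.1, y)) p.2.2 :=
    (h.submersion.1.continuous.comp ((Continuous.prodMk_right p.1).comp
      (Continuous.prodMk_right p.2.1))).continuousAt
  have hsrc' : ∀ᶠ y in 𝓝 p.2.2, F (p.1, p.2.1, y) ∈ D'.coord.source :=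
    hcF.eventually (D'.coord.open_source.eventually_mem (D'.mem_coord_source hp'))
  filter_upwards [h2.eventually h1, hsrc'] with y hy hys'
  have e1 : z + j ((y : ℝ) - p.2.2) = D.coord.toPartialEquiv (p.1, p.2.1, y) := by
    refine Prod.ext ?_ (Prod.ext ?_ ?_)
    · exact add_zero _
    · exact add_zero _
    · exact add_sub_cancel _ _
  have hys : ((p.1, p.2.1, y) : M.N) ∈ D.coord.source := hx
  rw [e1, hRdef, rep_apply hys, rep_apply hx] at hy
  exact D'.φ.injOn hys' (D'.mem_source _ hp') hy

end Morphism

theorem IsPDEMorphism.hasTriangularForm {F : M.N → M'.N}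
    (h : IsPDEMorphism M.I M'.I F (closure (graphEquation M L)) (closure (graphEquation M' L')))
    (hL : IsParabolicOperator M L) (hL' : IsParabolicOperator M' L') :
    ∃ t' x' u', HasTriangularForm F t' x' u' := by
  have : ConnectedSpace M.Ω := isConnected_iff_connectedSpace.1 M.isConnected_Ω
  have hT : ∀ t y y', (F (t, y)).1 = (F (t, y')).1 := by
    intro t y y'
    have hloc : IsLocallyConstant fun y => (F (t, y)).1 := by
      refine (IsLocallyConstant.iff_eventually_eq _).2 fun y => ?_
      obtain ⟨D, hD⟩ := hL.exists_localForm (t, y)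
      obtain ⟨D', hD'⟩ := hL'.exists_localForm (F (t, y))
      exact h.eventually_fst_eq D D' hD hD'
    exact hloc.apply_eq_of_preconnectedSpace y y'
  have hX : ∀ t x u u', (F (t, x, u)).2.1 = (F (t, x, u')).2.1 := by
    intro t x u u'
    have hloc : IsLocallyConstant fun u => (F (t, x, u)).2.1 := by
      refine (IsLocallyConstant.iff_eventually_eq _).2 fun u => ?_
      obtain ⟨D, hD⟩ := hL.exists_localForm (t, x, u)
      obtain ⟨D', hD'⟩ := hL'.exists_localForm (F (t, x, u))
      exact h.eventually_snd_fst_eq D D' hD hD'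
    exact hloc.apply_eq_of_preconnectedSpace u u'
  let t₀ : M.T := ⟨_, M.isConnected_T.nonempty.some_mem⟩
  let u₀ : M.Ω := ⟨_, M.isConnected_Ω.nonempty.some_mem⟩
  let x₀ : M.X := Classical.arbitrary M.X
  have hF := h.submersion
  refine ⟨fun t => (F (t, x₀, u₀)).1, fun y => (F (y.1, y.2, u₀)).2.1, fun p => (F p).2.2,
    ?_, ?_, ?_, fun t x u => ?_⟩
  · refine IsSmoothSubmersion.of_comp (I := M.I) (F := (Prod.fst : M.N → M.T)) ?_ contMDiff_fst
      (fun t => ⟨(t, x₀, u₀), rfl⟩) ?_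
    · exact contMDiff_fst.comp (hF.1.comp (contMDiff_id.prodMk contMDiff_const))
    · have e : (fun t => (F (t, x₀, u₀)).1) ∘ (Prod.fst : M.N → M.T) = Prod.fst ∘ F :=
        funext fun p => hT p.1 _ _
      rw [e]
      exact isSmoothSubmersion_fst.comp hF
  · refine IsSmoothSubmersion.of_comp (I := M.I) (F := fun p : M.N => (p.1, p.2.1)) ?_
      (contMDiff_fst.prodMk contMDiff_x) (fun y => ⟨(y.1, y.2, u₀), rfl⟩) ?_
    · exact contMDiff_fst.comp (contMDiff_snd.comp (hF.1.comp
        (contMDiff_fst.prodMk (contMDiff_snd.prodMk contMDiff_const))))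
    · have e : (fun y : M.T × M.X => (F (y.1, y.2, u₀)).2.1) ∘ (fun p : M.N => (p.1, p.2.1)) =
          (Prod.fst ∘ Prod.snd) ∘ F := funext fun p => hX p.1 p.2.1 _ _
      rw [e]
      exact (isSmoothSubmersion_fst.comp isSmoothSubmersion_snd).comp hF
  · exact (isSmoothSubmersion_snd.comp isSmoothSubmersion_snd).comp hF
  · exact Prod.ext (hT t _ _) (Prod.ext (hX t x _ _) rfl)

end TriangularForm

/-! ### Transport of the coefficients by maps of triangular form -/

section Quadratic

variable {n : ℕ}

/-- Polynomial functions of degree at most one. -/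
def IsAffineFun (f : (Fin n → ℝ) → ℝ) : Prop :=
  ∃ (l : (Fin n → ℝ) →ₗ[ℝ] ℝ) (q : ℝ), ∀ ξ, f ξ = l ξ + q

/-- Polynomial functions of degree at most two. -/
def IsQuadraticFun (f : (Fin n → ℝ) → ℝ) : Prop :=
  ∃ (B : (Fin n → ℝ) →ₗ[ℝ] (Fin n → ℝ) →ₗ[ℝ] ℝ) (l : (Fin n → ℝ) →ₗ[ℝ] ℝ) (q : ℝ),
    ∀ ξ, f ξ = B ξ ξ + l ξ + q

theorem isAffineFun_const (r : ℝ) : IsAffineFun fun _ : Fin n → ℝ => r := ⟨0, r, by simp⟩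

theorem IsAffineFun.add {f g : (Fin n → ℝ) → ℝ} (hf : IsAffineFun f) (hg : IsAffineFun g) :
    IsAffineFun fun ξ => f ξ + g ξ := by
  obtain ⟨l, q, h⟩ := hf
  obtain ⟨l', q', h'⟩ := hg
  exact ⟨l + l', q + q', fun ξ => by simp [h, h']; ring⟩

theorem IsAffineFun.const_mul {f : (Fin n → ℝ) → ℝ} (r : ℝ) (hf : IsAffineFun f) :
    IsAffineFun fun ξ => r * f ξ := by
  obtain ⟨l, q, h⟩ := hf
  exact ⟨r • l, r * q, fun ξ => by simp [h]; ring⟩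

theorem IsAffineFun.isQuadraticFun {f : (Fin n → ℝ) → ℝ} (hf : IsAffineFun f) :
    IsQuadraticFun f := by
  obtain ⟨l, q, h⟩ := hf
  exact ⟨0, l, q, fun ξ => by simp [h]⟩

theorem IsAffineFun.mul {f g : (Fin n → ℝ) → ℝ} (hf : IsAffineFun f) (hg : IsAffineFun g) :
    IsQuadraticFun fun ξ => f ξ * g ξ := by
  obtain ⟨l, q, h⟩ := hf
  obtain ⟨l', q', h'⟩ := hg
  exact ⟨l.smulRight l', q' • l + q • l', q * q', fun ξ => by simp [h, h']; ring⟩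

theorem IsQuadraticFun.add {f g : (Fin n → ℝ) → ℝ} (hf : IsQuadraticFun f)
    (hg : IsQuadraticFun g) : IsQuadraticFun fun ξ => f ξ + g ξ := by
  obtain ⟨B, l, q, h⟩ := hf
  obtain ⟨B', l', q', h'⟩ := hg
  exact ⟨B + B', l + l', q + q', fun ξ => by simp [h, h']; ring⟩

theorem IsQuadraticFun.const_mul {f : (Fin n → ℝ) → ℝ} (r : ℝ) (hf : IsQuadraticFun f) :
    IsQuadraticFun fun ξ => r * f ξ := by
  obtain ⟨B, l, q, h⟩ := hf
  exact ⟨r • B, r • l, r * q, fun ξ => by simp [h]; ring⟩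

theorem IsQuadraticFun.sub {f g : (Fin n → ℝ) → ℝ} (hf : IsQuadraticFun f)
    (hg : IsQuadraticFun g) : IsQuadraticFun fun ξ => f ξ - g ξ := by
  simpa [sub_eq_add_neg] using hf.add (hg.const_mul (-1))

theorem IsQuadraticFun.sum {ι : Type*} (s : Finset ι) {f : ι → (Fin n → ℝ) → ℝ}
    (hf : ∀ i, IsQuadraticFun (f i)) : IsQuadraticFun fun ξ => ∑ i ∈ s, f i ξ := by
  classical
  induction s using Finset.induction_on with
  | empty => simpa using (isAffineFun_const (n := n) 0).isQuadraticFun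
  | insert a s ha ih => simpa [Finset.sum_insert ha] using (hf a).add ih

/-- The coefficients of a quadratic polynomial are obtained from its values by polarization. -/
theorem IsQuadraticFun.eq_polarization {f : (Fin n → ℝ) → ℝ} (hf : IsQuadraticFun f)
    (ξ : Fin n → ℝ) :
    f ξ = ∑ k, ∑ l, (f (Pi.single k 1 + Pi.single l 1) - f (Pi.single k 1) - f (Pi.single l 1) + f 0)
        / 2 * ξ k * ξ l +
      ∑ k, (f (Pi.single k 1) - f (-Pi.single k 1)) / 2 * ξ k + f 0 := by
  obtain ⟨B, l, q, h⟩ := hf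
  have hξ : ξ = ∑ k, ξ k • (Pi.single k 1 : Fin n → ℝ) := by
    conv_lhs => rw [← Finset.univ_sum_single ξ]
    refine Finset.sum_congr rfl fun k _ => ?_
    ext j
    simp [Pi.single_apply]
  have hB : B ξ ξ = ∑ k, ∑ l, ξ k * ξ l * B (Pi.single k 1) (Pi.single l 1) := by
    conv_lhs => rw [hξ]
    simp only [map_sum, LinearMap.sum_apply, map_smul, LinearMap.smul_apply, smul_eq_mul,
      Finset.mul_sum]
    rw [Finset.sum_comm]
    exact Finset.sum_congr rfl fun k _ => Finset.sum_congr rfl fun j _ => by ring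
  have hl : l ξ = ∑ k, ξ k * l (Pi.single k 1) := by
    conv_lhs => rw [hξ]
    simp only [map_sum, map_smul, smul_eq_mul]
  have hB' : B ξ ξ = ∑ k, ∑ l, ξ k * ξ l * B (Pi.single l 1) (Pi.single k 1) := by
    rw [hB, Finset.sum_comm]
    exact Finset.sum_congr rfl fun k _ => Finset.sum_congr rfl fun j _ => by ring
  have e1 : ∑ k, ∑ l, (f (Pi.single k 1 + Pi.single l 1) - f (Pi.single k 1) - f (Pi.single l 1)
      + f 0) / 2 * ξ k * ξ l = (B ξ ξ + B ξ ξ) / 2 := by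
    conv_rhs => rw [hB]
    nth_rw 2 [← hB]
    rw [hB', ← Finset.sum_add_distrib, Finset.sum_div]
    refine Finset.sum_congr rfl fun k _ => ?_
    rw [← Finset.sum_add_distrib, Finset.sum_div]
    refine Finset.sum_congr rfl fun j _ => ?_
    simp only [h, map_add, LinearMap.add_apply, map_zero]
    ring
  have e2 : ∑ k, (f (Pi.single k 1) - f (-Pi.single k 1)) / 2 * ξ k = l ξ := by
    rw [hl]
    refine Finset.sum_congr rfl fun k _ => ?_
    simp only [h, map_neg, LinearMap.neg_apply]
    ring
  rw [e1, e2, h, h 0]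
  simp

end Quadratic

section Transport

open Vec

variable {n n' : ℕ}

/-- The covector `du - ∑ ξ_k dx_k`. -/
noncomputable def graphCovector (ξ : Fin n → ℝ) : Vec n →L[ℝ] ℝ := du - ∑ k, ξ k • dx k

theorem graphCovector_apply (ξ : Fin n → ℝ) (v : Vec n) :
    graphCovector ξ v = du v - ∑ k, ξ k * dx k v := by
  simp [graphCovector]

/-- The first two derivatives `D` and `K`, at a point, of a diffeomorphism of triangular form which
preserves the direction of time. -/
structure IsTriangularAt (D : Vec n →L[ℝ] Vec n') (K : Vec n →L[ℝ] Vec n →L[ℝ] Vec n') : Prop where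
  dt_eu : dt (D eu) = 0
  dt_ex : ∀ i, dt (D (ex i)) = 0
  dx_eu : ∀ l, dx l (D eu) = 0
  dt_second : ∀ a b : Vec n, b.1 = 0 → dt (K a b) = 0
  dx_second_left : ∀ l a, dx l (K eu a) = 0
  dx_second_right : ∀ l a, dx l (K a eu) = 0
  comp_ne_zero : ∀ α : Vec n' →L[ℝ] ℝ, α ≠ 0 → α.comp D ≠ 0
  du_ne_zero : du (D eu) ≠ 0
  dt_pos : 0 < dt (D et)

/-- The terms of order at most one of the transported equation, as a function of the gradient `ξ`.
They are found by evaluating the symbol on the pull-back of the jet `(du - ∑ ξ_k dx_k, 0)`; the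
denominator makes the coefficient of the time derivative equal to one. -/
noncomputable def ParabolicCoeffs.lowerOrder (k : ParabolicCoeffs n) (D : Vec n →L[ℝ] Vec n')
    (K : Vec n →L[ℝ] Vec n →L[ℝ] Vec n') (ξ : Fin n' → ℝ) : ℝ :=
  k.symb ((graphCovector ξ).comp D) (pullHess D K (graphCovector ξ) 0) /
    (du (D eu) ^ 2 * dt (D et))

/-- The coefficients at the image point of the parabolic equation transported by a map with
derivatives `D` and `K`. The coefficients of order at most one are found by polarization. -/
noncomputable def ParabolicCoeffs.transport (k : ParabolicCoeffs n) (D : Vec n →L[ℝ] Vec n')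
    (K : Vec n →L[ℝ] Vec n →L[ℝ] Vec n') : ParabolicCoeffs n' where
  b l m := (∑ i, ∑ j, k.b i j * dx l (D (ex i)) * dx m (D (ex j))) / dt (D et)
  c l m := (k.lowerOrder D K (Pi.single l 1 + Pi.single m 1) - k.lowerOrder D K (Pi.single l 1)
    - k.lowerOrder D K (Pi.single m 1) + k.lowerOrder D K 0) / 2
  β l := (k.lowerOrder D K (Pi.single l 1) - k.lowerOrder D K (-Pi.single l 1)) / 2
  q := k.lowerOrder D K 0

theorem ParabolicCoeffs.isSymm_transport_c (k : ParabolicCoeffs n) (D : Vec n →L[ℝ] Vec n')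
    (K : Vec n →L[ℝ] Vec n →L[ℝ] Vec n') : (k.transport D K).c.IsSymm := by
  ext l m
  change (k.transport D K).c m l = (k.transport D K).c l m
  simp only [transport]
  rw [show (Pi.single m 1 + Pi.single l 1 : Fin n' → ℝ) = Pi.single l 1 + Pi.single m 1 from
    add_comm _ _]
  ring

variable {D : Vec n →L[ℝ] Vec n'} {K : Vec n →L[ℝ] Vec n →L[ℝ] Vec n'}

namespace IsTriangularAt

theorem dx_second_kerVec (h : IsTriangularAt D K) (α : Vec n →L[ℝ] ℝ) (l : Fin n')
    (i j : Fin n) :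
    dx l (K (kerVec α i) (kerVec α j)) = α eu ^ 2 * dx l (K (ex i) (ex j)) := by
  simp only [kerVec, map_sub, map_smul, sub_apply, smul_apply, smul_eq_mul, h.dx_second_left,
    h.dx_second_right]
  ring

/-- A priori the term with `K` is cubic in the gradient `ξ`. The cubic part vanishes because the
vectors `K ∂_u` have no components in the directions of `X`. -/
theorem isQuadraticFun_lowerOrder (h : IsTriangularAt D K) (k : ParabolicCoeffs n) :
    IsQuadraticFun (k.lowerOrder (n' := n') D K) := by
  set m := du (D eu) with hm
  have haff : ∀ v : Vec n', IsAffineFun fun ξ : Fin n' → ℝ => graphCovector ξ v := by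
    intro v
    refine ⟨-∑ k, (dx k v) • LinearMap.proj k, du v, fun ξ => ?_⟩
    simp only [graphCovector_apply]
    simp [mul_comm]
    ring
  have hu : ∀ ξ : Fin n' → ℝ, graphCovector ξ (D eu) = m := fun ξ => by
    simp [graphCovector_apply, h.dx_eu, hm]
  have hH : ∀ i j, IsQuadraticFun fun ξ : Fin n' → ℝ =>
      graphCovector ξ (K (kerVec ((graphCovector ξ).comp D) i)
        (kerVec ((graphCovector ξ).comp D) j)) := by
    intro i j
    have e : (fun ξ : Fin n' → ℝ => graphCovector ξ (K (kerVec ((graphCovector ξ).comp D) i)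
        (kerVec ((graphCovector ξ).comp D) j))) = fun ξ =>
        ((m ^ 2 * du (K (ex i) (ex j)) + (-(m * du (K (ex i) eu))) * graphCovector ξ (D (ex j))) +
          (-(m * du (K eu (ex j)))) * graphCovector ξ (D (ex i))) +
          du (K eu eu) * (graphCovector ξ (D (ex i)) * graphCovector ξ (D (ex j))) +
          (m ^ 2 * graphCovector ξ (K (ex i) (ex j)) + -(m ^ 2 * du (K (ex i) (ex j)))) := by
      funext ξ
      rw [graphCovector_apply ξ (K (kerVec _ i) _)]
      simp only [h.dx_second_kerVec, ContinuousLinearMap.comp_apply, hu]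
      have e2 : ∑ x, ξ x * (m ^ 2 * dx x (K (ex i) (ex j))) =
          m ^ 2 * (du (K (ex i) (ex j)) - graphCovector ξ (K (ex i) (ex j))) := by
        rw [graphCovector_apply, sub_sub_cancel, Finset.mul_sum]
        exact Finset.sum_congr rfl fun _ _ => by ring
      rw [e2]
      simp only [kerVec, ContinuousLinearMap.comp_apply, hu, map_sub, map_smul, sub_apply,
        smul_apply, smul_eq_mul]
      ring
    rw [e]
    exact (((((isAffineFun_const _).add ((haff _).const_mul _)).add
      ((haff _).const_mul _)).isQuadraticFun).add (((haff _).mul (haff _)).const_mul _)).add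
      ((((haff _).const_mul _).add (isAffineFun_const _)).isQuadraticFun)
  have e : (k.lowerOrder (n' := n') D K) = fun ξ => (m ^ 2 * dt (D et))⁻¹ *
      ((((m ^ 2 * graphCovector ξ (D et) -
        ∑ i, ∑ j, k.b i j * graphCovector ξ (K (kerVec ((graphCovector ξ).comp D) i)
          (kerVec ((graphCovector ξ).comp D) j))) +
        m * ∑ i, ∑ j, k.c i j * (graphCovector ξ (D (ex i)) * graphCovector ξ (D (ex j)))) -
        m ^ 2 * ∑ i, k.β i * graphCovector ξ (D (ex i))) + m ^ 3 * k.q) := by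
    funext ξ
    simp only [ParabolicCoeffs.lowerOrder, ParabolicCoeffs.symb, pullHess_apply,
      ContinuousLinearMap.comp_apply, hu, zero_apply, zero_add, mul_assoc]
    rw [div_eq_inv_mul]
    ring
  rw [e]
  refine IsQuadraticFun.const_mul _ ((((((haff _).const_mul _).isQuadraticFun.sub
    (IsQuadraticFun.sum _ fun i => IsQuadraticFun.sum _ fun j => (hH i j).const_mul _)).add
    ((IsQuadraticFun.sum _ fun i => IsQuadraticFun.sum _ fun j =>
      ((haff _).mul (haff _)).const_mul _).const_mul _)).sub
    ((IsQuadraticFun.sum _ fun i => ((haff _).const_mul _).isQuadraticFun).const_mul _)).add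
    (isAffineFun_const _).isQuadraticFun)

/-- The symbol of the pull-back of a local equation `u - s(t, x)`, with `s` having the `t`-derivative
`a`, the gradient `ξ` and the second `x`-derivatives `A`, is a multiple of the difference of the two
sides of the transported equation. -/
theorem symb_pull_eq (h : IsTriangularAt D K) (k : ParabolicCoeffs n) (a : ℝ) (ξ : Fin n' → ℝ)
    (A : Fin n' → Fin n' → ℝ) (H : Vec n' →L[ℝ] Vec n' →L[ℝ] ℝ)
    (hH : ∀ v w : Vec n', v.1 = 0 → w.1 = 0 → H v w = -∑ l, ∑ m, A l m * dx l v * dx m w) :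
    k.symb ((graphCovector ξ - a • dt).comp D) (pullHess D K (graphCovector ξ - a • dt) H) =
      (du (D eu) ^ 2 * dt (D et)) * (∑ l, ∑ m, (k.transport D K).b l m * A l m +
        ∑ l, ∑ m, (k.transport D K).c l m * ξ l * ξ m + ∑ l, (k.transport D K).β l * ξ l +
        (k.transport D K).q - a) := by
  have hμ := h.dt_pos.ne'
  have hm := h.du_ne_zero
  set μ := dt (D et) with hμdef
  set m := du (D eu) with hmdef
  have hlow : k.lowerOrder D K ξ = ∑ l, ∑ m, (k.transport D K).c l m * ξ l * ξ m +
      ∑ l, (k.transport D K).β l * ξ l + (k.transport D K).q :=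
    (h.isQuadraticFun_lowerOrder k).eq_polarization ξ
  have hlow' : k.symb ((graphCovector ξ).comp D) (pullHess D K (graphCovector ξ) 0) =
      m ^ 2 * μ * k.lowerOrder D K ξ := by
    rw [ParabolicCoeffs.lowerOrder, ← hmdef, ← hμdef]
    field_simp
  set α := graphCovector ξ with hα
  have hu : α (D eu) = m := by simp [hα, graphCovector_apply, h.dx_eu, hmdef]
  have hk : ∀ i, kerVec ((α - a • dt).comp D) i = kerVec (α.comp D) i := fun i => by
    simp [kerVec, h.dt_eu, h.dt_ex]
  have hk1 : ∀ i, (kerVec (α.comp D) i).1 = 0 := fun i => by simp [kerVec, ex, eu]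
  have hDk : ∀ i, dt (D (kerVec (α.comp D) i)) = 0 := fun i => by
    simp [kerVec, h.dt_eu, h.dt_ex]
  have hDx : ∀ l i, dx l (D (kerVec (α.comp D) i)) = m * dx l (D (ex i)) := fun l i => by
    simp [kerVec, h.dx_eu, hu]
  have hHw : ∀ i j, H (D (kerVec (α.comp D) i)) (D (kerVec (α.comp D) j)) =
      -(m ^ 2 * ∑ l, ∑ r, A l r * (dx l (D (ex i)) * dx r (D (ex j)))) := by
    intro i j
    rw [hH _ _ (hDk i) (hDk j)]
    simp only [hDx, Finset.mul_sum]
    exact congrArg _ (Finset.sum_congr rfl fun l _ => Finset.sum_congr rfl fun r _ => by ring)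
  have hb : ∑ i, ∑ j, k.b i j * ∑ l, ∑ r, A l r * (dx l (D (ex i)) * dx r (D (ex j))) =
      μ * ∑ l, ∑ r, (k.transport D K).b l r * A l r := by
    have e1 : ∀ l r, μ * ((k.transport D K).b l r * A l r) =
        ∑ i, ∑ j, k.b i j * (A l r * (dx l (D (ex i)) * dx r (D (ex j)))) := by
      intro l r
      simp only [ParabolicCoeffs.transport]
      rw [← hμdef, ← mul_assoc, mul_div_cancel₀ _ hμ, Finset.sum_mul]
      refine Finset.sum_congr rfl fun i _ => ?_
      rw [Finset.sum_mul]
      exact Finset.sum_congr rfl fun j _ => by ring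
    simp only [Finset.mul_sum, e1]
    calc ∑ i, ∑ j, ∑ l, ∑ r, k.b i j * (A l r * (dx l (D (ex i)) * dx r (D (ex j))))
        = ∑ i, ∑ l, ∑ j, ∑ r, k.b i j * (A l r * (dx l (D (ex i)) * dx r (D (ex j)))) :=
          Finset.sum_congr rfl fun i _ => Finset.sum_comm
      _ = ∑ l, ∑ i, ∑ j, ∑ r, k.b i j * (A l r * (dx l (D (ex i)) * dx r (D (ex j)))) :=
          Finset.sum_comm
      _ = ∑ l, ∑ i, ∑ r, ∑ j, k.b i j * (A l r * (dx l (D (ex i)) * dx r (D (ex j)))) :=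
          Finset.sum_congr rfl fun l _ => Finset.sum_congr rfl fun i _ => Finset.sum_comm
      _ = ∑ l, ∑ r, ∑ i, ∑ j, k.b i j * (A l r * (dx l (D (ex i)) * dx r (D (ex j)))) :=
          Finset.sum_congr rfl fun l _ => Finset.sum_comm
  have hsum : ∑ i, ∑ j, k.b i j * pullHess D K (α - a • dt) H (kerVec (α.comp D) i)
      (kerVec (α.comp D) j) = ∑ i, ∑ j, k.b i j * pullHess D K α 0 (kerVec (α.comp D) i)
      (kerVec (α.comp D) j) - m ^ 2 * μ * ∑ l, ∑ r, (k.transport D K).b l r * A l r := by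
    rw [mul_assoc, ← hb, Finset.mul_sum, ← Finset.sum_sub_distrib]
    refine Finset.sum_congr rfl fun i _ => ?_
    rw [Finset.mul_sum, ← Finset.sum_sub_distrib]
    refine Finset.sum_congr rfl fun j _ => ?_
    simp only [pullHess_apply, hHw, sub_apply, smul_apply, h.dt_second _ _ (hk1 j), zero_apply]
    simp
    ring
  have hex : ∀ i, (α - a • dt).comp D (ex i) = α.comp D (ex i) := fun i => by simp [h.dt_ex]
  have heu : (α - a • dt).comp D eu = α.comp D eu := by simp [h.dt_eu]
  have het : (α - a • dt).comp D et = α.comp D et - a * μ := by simp [hμdef]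
  have hfin : k.symb ((α - a • dt).comp D) (pullHess D K (α - a • dt) H) =
      k.symb (α.comp D) (pullHess D K α 0) +
        m ^ 2 * μ * (∑ l, ∑ r, (k.transport D K).b l r * A l r) - a * μ * m ^ 2 := by
    simp only [ParabolicCoeffs.symb, hk, hsum, hex, heu, het]
    rw [show α.comp D eu = m from hu]
    ring
  rw [hfin, hlow', hlow]
  ring

theorem _root_.ParabolicCoeffs.symb_smul (k : ParabolicCoeffs n) (c : ℝ) (α : Vec n →L[ℝ] ℝ)
    (H : Vec n →L[ℝ] Vec n →L[ℝ] ℝ) : k.symb (c • α) (c • H) = c ^ 3 * k.symb α H := by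
  have hw : ∀ i, kerVec (c • α) i = c • kerVec α i := fun i => by
    simp [kerVec, smul_sub, mul_smul]
  have hs : ∑ i, ∑ j, k.b i j * (c • H) (kerVec (c • α) i) (kerVec (c • α) j) =
      c ^ 3 * ∑ i, ∑ j, k.b i j * H (kerVec α i) (kerVec α j) := by
    simp only [Finset.mul_sum, hw, map_smul, smul_apply, smul_eq_mul]
    exact Finset.sum_congr rfl fun i _ => Finset.sum_congr rfl fun j _ => by ring
  have hs2 : ∑ i, ∑ j, k.c i j * (c • α) (ex i) * (c • α) (ex j) =
      c ^ 2 * ∑ i, ∑ j, k.c i j * α (ex i) * α (ex j) := by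
    simp only [Finset.mul_sum, smul_apply, smul_eq_mul]
    exact Finset.sum_congr rfl fun i _ => Finset.sum_congr rfl fun j _ => by ring
  have hs3 : ∑ i, k.β i * (c • α) (ex i) = c * ∑ i, k.β i * α (ex i) := by
    simp only [Finset.mul_sum, smul_apply, smul_eq_mul]
    exact Finset.sum_congr rfl fun i _ => by ring
  simp only [ParabolicCoeffs.symb, hs, hs2, hs3]
  simp only [smul_apply, smul_eq_mul]
  ring

/-- The symbol of the pull-back of a local equation is a multiple of the symbol, with respect to the
transported coefficients, of the local equation. By homogeneity it suffices to consider the local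
equation of a graph. -/
theorem symb_pull (h : IsTriangularAt D K) (k : ParabolicCoeffs n) {α : Vec n' →L[ℝ] ℝ}
    (hα : α eu ≠ 0) (H : Vec n' →L[ℝ] Vec n' →L[ℝ] ℝ) :
    k.symb (α.comp D) (pullHess D K α H) =
      (du (D eu) ^ 2 * dt (D et)) * (k.transport D K).symb α H := by
  obtain ⟨c, hc, α₀, hα₀, rfl⟩ : ∃ c : ℝ, c ≠ 0 ∧ ∃ α₀ : Vec n' →L[ℝ] ℝ, α₀ eu = 1 ∧ α = c • α₀ :=
    ⟨α eu, hα, (α eu)⁻¹ • α, by simp [hα], by rw [smul_smul, mul_inv_cancel₀ hα, one_smul]⟩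
  obtain ⟨H₀, rfl⟩ : ∃ H₀ : Vec n' →L[ℝ] Vec n' →L[ℝ] ℝ, H = c • H₀ :=
    ⟨c⁻¹ • H, by rw [smul_smul, mul_inv_cancel₀ hc, one_smul]⟩
  have e1 : pullHess D K (c • α₀) (c • H₀) = c • pullHess D K α₀ H₀ := by
    refine ContinuousLinearMap.ext fun a => ContinuousLinearMap.ext fun b => ?_
    simp only [pullHess_apply, smul_apply, smul_eq_mul]
    ring
  rw [e1, ContinuousLinearMap.smul_comp, ParabolicCoeffs.symb_smul, ParabolicCoeffs.symb_smul]
  let P : Vec n' →L[ℝ] Vec n' := ContinuousLinearMap.id ℝ _ - α₀.smulRight eu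
  have hP : ∀ v, P v = v - α₀ v • eu := fun v => rfl
  have hPk : ∀ v, α₀ v = 0 → P v = v := fun v hv => by rw [hP, hv, zero_smul, sub_zero]
  have hgr : α₀ = graphCovector (fun l => -α₀ (ex l)) - (-α₀ et) • dt := by
    refine clm_ext ?_ (fun i => ?_) ?_ <;> simp [graphCovector_apply, hα₀]
  -- the second derivative modulo multiples of `α₀`
  have e2 : k.symb (α₀.comp D) (pullHess D K α₀ H₀) =
      k.symb (α₀.comp D) (pullHess D K α₀ (pullHess P 0 0 H₀)) := by
    simp only [ParabolicCoeffs.symb, pullHess_apply]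
    have hz : ∀ i, α₀ (D (kerVec (α₀.comp D) i)) = 0 := fun i => apply_kerVec (α₀.comp D) i
    simp only [hPk _ (hz _)]
    simp
  have hPv : ∀ v : Vec n', v.1 = 0 → P v = ∑ l, dx l v • kerVec α₀ l := by
    intro v hv
    rw [clm_apply P v, hv, zero_smul, zero_add, hP eu, hα₀, one_smul, sub_self, smul_zero, add_zero]
    refine Finset.sum_congr rfl fun l _ => ?_
    rw [hP, kerVec, hα₀, one_smul]
    rfl
  have e3 := h.symb_pull_eq k (-α₀ et) (fun l => -α₀ (ex l))
    (fun l m => -H₀ (kerVec α₀ l) (kerVec α₀ m)) (pullHess P 0 0 H₀) (fun v w hv hw => by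
      rw [pullHess_apply, hPv v hv, hPv w hw]
      simp only [map_sum, map_smul, sum_apply, smul_apply, smul_eq_mul,
        zero_apply, add_zero, Finset.mul_sum, ← Finset.sum_neg_distrib]
      rw [Finset.sum_comm]
      exact Finset.sum_congr rfl fun l _ => Finset.sum_congr rfl fun m _ => by ring)
  rw [← hgr] at e3
  rw [e2, e3]
  simp only [ParabolicCoeffs.symb, hα₀]
  simp
  ring

theorem posDef_transport (h : IsTriangularAt D K) {k : ParabolicCoeffs n} (hb : k.b.PosDef) :
    (k.transport D K).b.PosDef := by
  have hμ := h.dt_pos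
  refine Matrix.PosDef.of_dotProduct_mulVec_pos ?_ fun ξ hξ => ?_
  · ext l m
    have hs : ∀ i j, k.b i j = k.b j i := fun i j => by
      simpa using (hb.isHermitian.apply j i)
    change (k.transport D K).b m l = (k.transport D K).b l m
    simp only [ParabolicCoeffs.transport]
    rw [Finset.sum_comm]
    refine congrArg (fun r : ℝ => r / dt (D et))
      (Finset.sum_congr rfl fun i _ => Finset.sum_congr rfl fun j _ => ?_)
    rw [hs i j]
    ring
  · let y : Fin n → ℝ := fun i => ∑ l, ξ l * dx l (D (ex i))
    have hy : y ≠ 0 := by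
      intro hy0
      let α : Vec n' →L[ℝ] ℝ := ∑ l, ξ l • dx l
      let c := α (D et) / dt (D et)
      refine h.comp_ne_zero (α - c • dt) (fun h0 => hξ ?_) (clm_ext ?_ (fun i => ?_) ?_)
      · funext l
        have := congrArg (fun f : Vec n' →L[ℝ] ℝ => f (ex l)) h0
        simpa [α] using this
      · simp [c, hμ.ne']
      · have := congrFun hy0 i
        simpa [α, h.dt_ex, y] using this
      · simp [α, h.dt_eu, h.dx_eu]
    have hpos := sum_mul_pos hb hy
    have e : star ξ ⬝ᵥ ((k.transport D K).b.mulVec ξ) =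
        (∑ i, ∑ j, k.b i j * (y i * y j)) / dt (D et) := by
      simp only [dotProduct, Matrix.mulVec, star_trivial, ParabolicCoeffs.transport]
      have e1 : ∀ i j, k.b i j * (y i * y j) = ∑ l, ∑ m,
          ξ l * (k.b i j * dx l (D (ex i)) * dx m (D (ex j)) * ξ m) := by
        intro i j
        simp only [y]
        rw [Finset.sum_mul_sum, Finset.mul_sum]
        refine Finset.sum_congr rfl fun l _ => ?_
        rw [Finset.mul_sum]
        exact Finset.sum_congr rfl fun m _ => by ring
      simp only [e1]
      have e2 : ∑ i, ∑ j, ∑ l, ∑ m, ξ l * (k.b i j * dx l (D (ex i)) * dx m (D (ex j)) * ξ m) =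
          ∑ l, ∑ m, ∑ i, ∑ j, ξ l * (k.b i j * dx l (D (ex i)) * dx m (D (ex j)) * ξ m) := by
        calc _ = ∑ i, ∑ l, ∑ j, ∑ m, ξ l * (k.b i j * dx l (D (ex i)) * dx m (D (ex j)) * ξ m) :=
              Finset.sum_congr rfl fun i _ => Finset.sum_comm
          _ = ∑ l, ∑ i, ∑ j, ∑ m, ξ l * (k.b i j * dx l (D (ex i)) * dx m (D (ex j)) * ξ m) :=
              Finset.sum_comm
          _ = ∑ l, ∑ i, ∑ m, ∑ j, ξ l * (k.b i j * dx l (D (ex i)) * dx m (D (ex j)) * ξ m) :=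
              Finset.sum_congr rfl fun l _ => Finset.sum_congr rfl fun i _ => Finset.sum_comm
          _ = _ := Finset.sum_congr rfl fun l _ => Finset.sum_comm
      rw [e2, Finset.sum_div]
      refine Finset.sum_congr rfl fun l _ => ?_
      rw [Finset.mul_sum, Finset.sum_div]
      refine Finset.sum_congr rfl fun m _ => ?_
      rw [div_mul_eq_mul_div, ← mul_div_assoc, Finset.sum_mul, Finset.mul_sum]
      refine congrArg (fun r : ℝ => r / dt (D et)) (Finset.sum_congr rfl fun i _ => ?_)
      rw [Finset.sum_mul, Finset.mul_sum]
    rw [e]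
    exact div_pos hpos hμ

end IsTriangularAt

end Transport

/-! ### Diffeomorphisms of triangular form -/

section Diffeomorphisms

open Coordinates

variable {E H N : Type*} [NormedAddCommGroup E] [NormedSpace ℝ E] [TopologicalSpace H]
  [TopologicalSpace N] [ChartedSpace H N] {I : ModelWithCorners ℝ E H}
  {E' H' N' : Type*} [NormedAddCommGroup E'] [NormedSpace ℝ E'] [TopologicalSpace H']
  [TopologicalSpace N'] [ChartedSpace H' N'] {I' : ModelWithCorners ℝ E' H'}
  {B B' : Type*} [NormedAddCommGroup B] [NormedSpace ℝ B] [NormedAddCommGroup B'] [NormedSpace ℝ B']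
  (Φ : Diffeomorph I I' N N' ∞) {e : Coordinates I N B} {e' : Coordinates I' N' B'} {x : N}

theorem Diffeomorph.isSmoothSubmersion : IsSmoothSubmersion I I' Φ :=
  ⟨Φ.contMDiff, fun x => (Φ.mfderivToContinuousLinearEquiv (by simp) x).surjective⟩

theorem Diffeomorph.exists_comp_fderiv_rep_eq (hx : x ∈ e.source) (hx' : Φ x ∈ e'.source)
    (α : B →L[ℝ] ℝ) :
    ∃ β : B' →L[ℝ] ℝ, β.comp (fderiv ℝ (e.rep e' Φ) (e.toPartialEquiv x)) = α := by
  obtain ⟨f, hf, -, hf1, -⟩ := e.exists_d1_d2_eq hx α 0 (by simp)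
  have hfx : ContMDiffAt I 𝓘(ℝ, ℝ) ∞ f (Φ.symm (Φ x)) := by
    rw [Φ.symm_apply_apply]
    exact hf.contMDiffAt (e.open_source.mem_nhds hx)
  have h := d1_comp hx hx' Φ.contMDiff.contMDiffAt (f := f ∘ Φ.symm)
    (hfx.comp (Φ x) Φ.symm.contMDiff.contMDiffAt)
  have hc : (f ∘ Φ.symm) ∘ Φ = f := funext fun y => congrArg f (Φ.symm_apply_apply y)
  rw [hc, hf1] at h
  exact ⟨_, h.symm⟩

theorem Diffeomorph.comp_fderiv_rep_ne_zero (hx : x ∈ e.source) (hx' : Φ x ∈ e'.source)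
    {α : B' →L[ℝ] ℝ} (hα : α ≠ 0) :
    α.comp (fderiv ℝ (e.rep e' Φ) (e.toPartialEquiv x)) ≠ 0 := by
  obtain ⟨f, hf, -, hf1, -⟩ := e'.exists_d1_d2_eq hx' α 0 (by simp)
  have hfx : ContMDiffAt I' 𝓘(ℝ, ℝ) ∞ f (Φ x) := hf.contMDiffAt (e'.open_source.mem_nhds hx')
  have h := d1_comp hx hx' Φ.contMDiff.contMDiffAt hfx
  rw [hf1] at h
  intro h0
  rw [h0] at h
  have h2 := d1_comp (F := Φ.symm) (x := Φ x) (e := e') (e' := e) hx'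
    (by rwa [Φ.symm_apply_apply]) Φ.symm.contMDiff.contMDiffAt (f := f ∘ Φ)
    (by rw [Φ.symm_apply_apply]; exact hfx.comp x Φ.contMDiff.contMDiffAt)
  have hc : (f ∘ Φ) ∘ Φ.symm = f := funext fun y => congrArg f (Φ.apply_symm_apply y)
  rw [hc, hf1, Φ.symm_apply_apply, h] at h2
  exact hα h2

end Diffeomorphisms

theorem apply_fderiv_eq_zero_of_invariant {V V' : Type*} [NormedAddCommGroup V] [NormedSpace ℝ V]
    [NormedAddCommGroup V'] [NormedSpace ℝ V'] {R : V → V'} {l : V' →L[ℝ] ℝ} {w b : V}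
    (hR : DifferentiableAt ℝ R w) (h : ∀ s : ℝ, l (R (w + s • b)) = l (R w)) :
    l (fderiv ℝ R w b) = 0 := by
  have h1 : HasDerivAt (fun s : ℝ => w + s • b) b 0 := by
    simpa using ((hasDerivAt_id (0 : ℝ)).smul_const b).const_add w
  have h2 : HasFDerivAt R (fderiv ℝ R w) (w + (0 : ℝ) • b) := by
    simpa using hR.hasFDerivAt
  have h3 := l.hasFDerivAt.comp_hasDerivAt (0 : ℝ) (h2.comp_hasDerivAt (0 : ℝ) h1)
  have h4 : (l ∘ R ∘ fun s : ℝ => w + s • b) = fun _ => l (R w) := funext h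
  rw [h4] at h3
  exact h3.unique (hasDerivAt_const (0 : ℝ) (l (R w)))

section Triangular

open Coordinates Vec

variable {M M' : ParabolicDomain.{u}}
  {φ : OpenPartialHomeomorph M.X (EuclideanSpace ℝ (Fin M.n))}
  (hφ : φ ∈ IsManifold.maximalAtlas (𝓡 M.n) ∞ M.X)
  {φ' : OpenPartialHomeomorph M'.X (EuclideanSpace ℝ (Fin M'.n))}
  (hφ' : φ' ∈ IsManifold.maximalAtlas (𝓡 M'.n) ∞ M'.X)

namespace HasTriangularForm

variable {F : M.N → M'.N} {t' : M.T → M'.T} {x' : M.T × M.X → M'.X} {u' : M.N → M'.Ω}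
  (hF : HasTriangularForm F t' x' u')

include hF

theorem dt_rep (w : Vec M.n) : dt ((prodCoordinates hφ).rep (prodCoordinates hφ') F w) =
    t' (Opens.retract M.isConnected_T.nonempty w.1) := by
  change ((F (Opens.retract M.isConnected_T.nonempty w.1, φ.symm w.2.1,
    Opens.retract M.isConnected_Ω.nonempty w.2.2)).1 : ℝ) = _
  rw [hF.eq]

theorem dx_rep (l : Fin M'.n) (w : Vec M.n) :
    dx l ((prodCoordinates hφ).rep (prodCoordinates hφ') F w) =
      φ' (x' (Opens.retract M.isConnected_T.nonempty w.1, φ.symm w.2.1)) l := by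
  change φ' (F (Opens.retract M.isConnected_T.nonempty w.1, φ.symm w.2.1,
    Opens.retract M.isConnected_Ω.nonempty w.2.2)).2.1 l = _
  rw [hF.eq]

variable {p : M.N}

theorem hasDerivAt_t (hFc : ContMDiff M.I M'.I ∞ F) (hp : p.2.1 ∈ φ.source)
    (hp' : (F p).2.1 ∈ φ'.source) :
    HasDerivAt (fun r : ℝ => (t' (Opens.retract M.isConnected_T.nonempty r) : ℝ))
      (dt (fderiv ℝ ((prodCoordinates hφ).rep (prodCoordinates hφ') F)
        ((prodCoordinates hφ).toPartialEquiv p) et)) p.1 := by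
  have hx : p ∈ (prodCoordinates hφ).source := hp
  have hx' : F p ∈ (prodCoordinates hφ').source := hp'
  have hR := (contDiffAt_rep hx hx' hFc.contMDiffAt).differentiableAt (by simp)
  let j : ℝ → Vec M.n := fun r => (r, φ p.2.1, p.2.2)
  have h1 : HasDerivAt j et (p.1 : ℝ) :=
    (hasDerivAt_id _).prodMk ((hasDerivAt_const _ _).prodMk (hasDerivAt_const _ _))
  have h3 := (dt : Vec M'.n →L[ℝ] ℝ).hasFDerivAt.comp_hasDerivAt (p.1 : ℝ)
    (HasFDerivAt.comp_hasDerivAt (p.1 : ℝ) (f := j) hR.hasFDerivAt h1)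
  exact h3.congr_of_eventuallyEq (Eventually.of_forall fun r => (hF.dt_rep hφ hφ' (j r)).symm)

end HasTriangularForm

/-- A diffeomorphism of triangular form with increasing time component satisfies the pointwise
conditions under which parabolic equations are transported. -/
theorem HasTriangularForm.isTriangularAt (Φ : Diffeomorph M.I M'.I M.N M'.N ∞) {t' : M.T → M'.T}
    {x' : M.T × M.X → M'.X} {u' : M.N → M'.Ω} (hF : HasTriangularForm Φ t' x' u')
    (ht : StrictMono t') {p : M.N} (hp : p.2.1 ∈ φ.source) (hp' : (Φ p).2.1 ∈ φ'.source) :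
    IsTriangularAt (fderiv ℝ ((prodCoordinates hφ).rep (prodCoordinates hφ') Φ)
        ((prodCoordinates hφ).toPartialEquiv p))
      (fderiv ℝ (fderiv ℝ ((prodCoordinates hφ).rep (prodCoordinates hφ') Φ))
        ((prodCoordinates hφ).toPartialEquiv p)) := by
  have hx : p ∈ (prodCoordinates hφ).source := hp
  have hx' : Φ p ∈ (prodCoordinates hφ').source := hp'
  have hderiv := hF.hasDerivAt_t hφ hφ' Φ.contMDiff hp hp'
  set e := prodCoordinates hφ
  set e' := prodCoordinates hφ'
  set R := e.rep e' Φ with hRdef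
  set z := e.toPartialEquiv p
  have hR : ContDiffAt ℝ ∞ R z := contDiffAt_rep hx hx' Φ.contMDiff.contMDiffAt
  have hd : ∀ᶠ w in 𝓝 z, DifferentiableAt ℝ R w := by
    filter_upwards [(hR.of_le (WithTop.coe_le_coe.2 (le_top : (1 : ℕ∞) ≤ ⊤))).eventually (by simp)]
      with w hw using hw.differentiableAt (by simp)
  have h1 : ∀ b : Vec M.n, b.1 = 0 → ∀ᶠ w in 𝓝 z, dt (fderiv ℝ R w b) = 0 := by
    intro b hb
    filter_upwards [hd] with w hw
    refine apply_fderiv_eq_zero_of_invariant hw fun s => ?_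
    rw [hRdef, hF.dt_rep, hF.dt_rep]
    simp [hb]
  have h2 : ∀ l, ∀ᶠ w in 𝓝 z, dx l (fderiv ℝ R w eu) = 0 := by
    intro l
    filter_upwards [hd] with w hw
    refine apply_fderiv_eq_zero_of_invariant hw fun s => ?_
    rw [hRdef, hF.dx_rep, hF.dx_rep]
    simp [eu]
  have hright : ∀ l a, dx l (fderiv ℝ (fderiv ℝ R) z a eu) = 0 := fun l a =>
    fderiv_fderiv_apply_eq_zero hR (h2 l) a
  have hsymm : ∀ a b, fderiv ℝ (fderiv ℝ R) z a b = fderiv ℝ (fderiv ℝ R) z b a :=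
    hR.isSymmSndFDerivAt (by
      rw [minSmoothness_of_isRCLikeNormedField]
      exact WithTop.coe_le_coe.2 (le_top : (2 : ℕ∞) ≤ ⊤))
  have hne : ∀ α : Vec M'.n →L[ℝ] ℝ, α ≠ 0 → α.comp (fderiv ℝ R z) ≠ 0 := fun α hα =>
    Φ.comp_fderiv_rep_ne_zero hx hx' hα
  have hte : dt (fderiv ℝ R z eu) = 0 := (h1 eu rfl).self_of_nhds
  have htx : ∀ i, dt (fderiv ℝ R z (ex i)) = 0 := fun i => (h1 (ex i) rfl).self_of_nhds
  have hxe : ∀ l, dx l (fderiv ℝ R z eu) = 0 := fun l => (h2 l).self_of_nhds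
  refine ⟨hte, htx, hxe, fun a b hb => fderiv_fderiv_apply_eq_zero hR (h1 b hb) a,
    fun l a => by rw [hsymm]; exact hright l a, hright, hne, fun h0 => ?_, ?_⟩
  · obtain ⟨β, hβ⟩ := Φ.exists_comp_fderiv_rep_eq hx hx' du
    have hz : fderiv ℝ R z eu = 0 := by
      refine Prod.ext hte (Prod.ext ?_ h0)
      ext l
      exact hxe l
    have := congrArg (fun l : Vec M.n →L[ℝ] ℝ => l eu) hβ
    change β (fderiv ℝ R z eu) = 1 at this
    rw [hz, map_zero] at this
    exact zero_ne_one this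
  · refine lt_of_le_of_ne ?_ fun h0 => hne dt (fun h => ?_) (clm_ext h0.symm htx hte)
    · refine ge_of_tendsto ((hasDerivAt_iff_tendsto_slope.1 hderiv).mono_left
        (nhdsWithin_mono (s := Ioi (p.1 : ℝ)) _ fun r (hr : (p.1 : ℝ) < r) => hr.ne')) ?_
      filter_upwards [nhdsWithin_le_nhds (M.T.isOpen.mem_nhds p.1.2), self_mem_nhdsWithin]
        with r hr (hpr : (p.1 : ℝ) < r)
      rw [slope_def_field]
      refine div_nonneg (sub_nonneg.2 ?_) (sub_nonneg.2 hpr.le)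
      refine Subtype.coe_le_coe.2 (ht.monotone ?_)
      rw [← Subtype.coe_le_coe, Opens.coe_retract _ hr, Opens.coe_retract _ p.1.2]
      exact hpr.le
    · have := congrArg (fun l : Vec M'.n →L[ℝ] ℝ => l et) h
      simp at this

variable {L : M.T → M.X → (M.X → ℝ) → ℝ} {L' : M'.T → M'.X → (M'.X → ℝ) → ℝ}

/-- The time component of a diffeomorphism which is a morphism is increasing. -/
theorem IsPDEMorphism.strictMono (Φ : Diffeomorph M.I M'.I M.N M'.N ∞)
    (h : IsPDEMorphism M.I M'.I Φ (closure (graphEquation M L)) (closure (graphEquation M' L')))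
    (hL : IsParabolicOperator M L) (hL' : IsParabolicOperator M' L') {t' : M.T → M'.T}
    {x' : M.T × M.X → M'.X} {u' : M.N → M'.Ω} (hF : HasTriangularForm Φ t' x' u') :
    StrictMono t' := by
  let u₀ : M.Ω := ⟨_, M.isConnected_Ω.nonempty.some_mem⟩
  let x₀ : M.X := Classical.arbitrary M.X
  set g : ℝ → ℝ := fun r => t' (Opens.retract M.isConnected_T.nonempty r) with hg
  have hder : ∀ t : M.T, ∃ c, 0 < c ∧ HasDerivAt g c t := by
    intro t
    set p : M.N := (t, x₀, u₀)
    obtain ⟨D, hD⟩ := hL.exists_localForm p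
    obtain ⟨D', hD'⟩ := hL'.exists_localForm (Φ p)
    have hsm := h.isSymbolMorphism D D' hD hD'
    have hdt := hsm.dt_comp_eq (D.posDef _ hD) (D'.posDef _ hD') M'.one_le_n
    refine ⟨_, ?_, hF.hasDerivAt_t (p := p) D.mem_maximalAtlas D'.mem_maximalAtlas Φ.contMDiff
      (D.mem_source _ hD) (D'.mem_source _ hD')⟩
    refine hsm.dt_comp_et_pos (D.posDef _ hD) (D'.posDef _ hD') M'.one_le_n hdt
      (fun a b _ hb => h.dt_second_eq_zero D D' hD hD' a b hb) fun h0 => ?_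
    obtain ⟨β, hβ⟩ := Φ.exists_comp_fderiv_rep_eq (D.mem_coord_source hD)
      (D'.mem_coord_source hD') du
    have hz : fderiv ℝ (D.coord.rep D'.coord Φ) (D.coord.toPartialEquiv p) eu = 0 := by
      refine Prod.ext hdt.1 (Prod.ext ?_ h0)
      ext l
      exact h.dx_eq_zero D D' hD hD' l
    have := congrArg (fun l : Vec M.n →L[ℝ] ℝ => l eu) hβ
    change β (fderiv ℝ (D.coord.rep D'.coord Φ) (D.coord.toPartialEquiv p) eu) = 1 at this
    rw [hz, map_zero] at this
    exact zero_ne_one this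
  have hmono : StrictMonoOn g M.T := by
    refine strictMonoOn_of_deriv_pos M.isConnected_T.isPreconnected.ordConnected.convex
      (fun t ht => ?_) fun t ht => ?_
    · obtain ⟨c, -, hc⟩ := hder ⟨t, ht⟩
      exact hc.continuousAt.continuousWithinAt
    · rw [M.T.isOpen.interior_eq] at ht
      obtain ⟨c, hc0, hc⟩ := hder ⟨t, ht⟩
      rw [hc.deriv]
      exact hc0
  intro s t hst
  have := hmono s.2 t.2 hst
  simp only [hg, Opens.retract_coe] at this
  exact this

end Triangular

/-! ### Transport of parabolic operators -/

section Smoothness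

open Vec

variable {E H N : Type*} [NormedAddCommGroup E] [NormedSpace ℝ E] [TopologicalSpace H]
  [TopologicalSpace N] [ChartedSpace H N] {I : ModelWithCorners ℝ E H} {n n' : ℕ}

/-- Smoothness at a point of the coefficients of a parabolic equation. -/
structure ParabolicCoeffs.ContMDiffAt (I : ModelWithCorners ℝ E H) (k : N → ParabolicCoeffs n)
    (x : N) : Prop where
  b : ∀ i j, _root_.ContMDiffAt I 𝓘(ℝ, ℝ) ∞ (fun y => (k y).b i j) x
  c : ∀ i j, _root_.ContMDiffAt I 𝓘(ℝ, ℝ) ∞ (fun y => (k y).c i j) x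
  β : ∀ i, _root_.ContMDiffAt I 𝓘(ℝ, ℝ) ∞ (fun y => (k y).β i) x
  q : _root_.ContMDiffAt I 𝓘(ℝ, ℝ) ∞ (fun y => (k y).q) x

variable {k : N → ParabolicCoeffs n} {x : N}

theorem ParabolicCoeffs.ContMDiffAt.symb (hk : ParabolicCoeffs.ContMDiffAt I k x)
    {α : N → Vec n →L[ℝ] ℝ} {A : N → Vec n →L[ℝ] Vec n →L[ℝ] ℝ}
    (hα : ∀ v, _root_.ContMDiffAt I 𝓘(ℝ, ℝ) ∞ (fun y => α y v) x)
    (hA : ∀ v w, _root_.ContMDiffAt I 𝓘(ℝ, ℝ) ∞ (fun y => A y v w) x) :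
    _root_.ContMDiffAt I 𝓘(ℝ, ℝ) ∞ (fun y => (k y).symb (α y) (A y)) x := by
  have hAw : ∀ i j, _root_.ContMDiffAt I 𝓘(ℝ, ℝ) ∞
      (fun y => A y (kerVec (α y) i) (kerVec (α y) j)) x := by
    intro i j
    have e : (fun y => A y (kerVec (α y) i) (kerVec (α y) j)) = fun y =>
        (α y eu * (α y eu * A y (ex i) (ex j) - α y (ex j) * A y (ex i) eu)) -
          α y (ex i) * (α y eu * A y eu (ex j) - α y (ex j) * A y eu eu) := by
      funext y
      simp only [kerVec, map_sub, map_smul, sub_apply, smul_apply, smul_eq_mul]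
      ring
    rw [e]
    exact ((hα eu).mul (((hα eu).mul (hA _ _)).sub ((hα _).mul (hA _ _)))).sub
      ((hα _).mul (((hα eu).mul (hA _ _)).sub ((hα _).mul (hA _ _))))
  exact ((((hα et).mul ((hα eu).pow 2)).sub (contMDiffAt_finsetSum fun i _ =>
    contMDiffAt_finsetSum fun j _ => (hk.b i j).mul (hAw i j))).add ((hα eu).mul
    (contMDiffAt_finsetSum fun i _ => contMDiffAt_finsetSum fun j _ =>
      ((hk.c i j).mul (hα (ex i))).mul (hα (ex j))))).sub (((hα eu).pow 2).mul
    (contMDiffAt_finsetSum fun i _ => (hk.β i).mul (hα (ex i)))) |>.add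
    (((hα eu).pow 3).mul hk.q)

theorem ParabolicCoeffs.ContMDiffAt.transport (hk : ParabolicCoeffs.ContMDiffAt I k x)
    {D : N → Vec n →L[ℝ] Vec n'} {K : N → Vec n →L[ℝ] Vec n →L[ℝ] Vec n'}
    (hD : ∀ (l : Vec n' →L[ℝ] ℝ) v, _root_.ContMDiffAt I 𝓘(ℝ, ℝ) ∞ (fun y => l (D y v)) x)
    (hK : ∀ (l : Vec n' →L[ℝ] ℝ) v w, _root_.ContMDiffAt I 𝓘(ℝ, ℝ) ∞ (fun y => l (K y v w)) x)
    (hT : IsTriangularAt (D x) (K x)) :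
    ParabolicCoeffs.ContMDiffAt I (fun y => (k y).transport (D y) (K y)) x := by
  have hlow : ∀ ξ : Fin n' → ℝ, _root_.ContMDiffAt I 𝓘(ℝ, ℝ) ∞
      (fun y => (k y).lowerOrder (D y) (K y) ξ) x := by
    intro ξ
    refine ContMDiffAt.div₀ (hk.symb (fun v => hD (graphCovector ξ) v) fun v w => ?_)
      (((hD du eu).pow 2).mul (hD dt et))
      (mul_ne_zero (pow_ne_zero 2 hT.du_ne_zero) hT.dt_pos.ne')
    simp only [pullHess_apply, zero_apply, zero_add]
    exact hK _ v w
  have h2 : ∀ {f : N → ℝ}, _root_.ContMDiffAt I 𝓘(ℝ, ℝ) ∞ f x →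
      _root_.ContMDiffAt I 𝓘(ℝ, ℝ) ∞ (fun y => f y / 2) x := fun hf =>
    ContMDiffAt.div₀ hf contMDiffAt_const (by simp)
  refine ⟨fun l m => ?_, fun l m => h2 ((((hlow _).sub (hlow _)).sub (hlow _)).add (hlow _)),
    fun l => h2 ((hlow _).sub (hlow _)), hlow 0⟩
  exact ContMDiffAt.div₀ (contMDiffAt_finsetSum fun i _ => contMDiffAt_finsetSum fun j _ =>
    ((hk.b i j).mul (hD _ _)).mul (hD _ _)) (hD dt et) hT.dt_pos.ne'

end Smoothness

section TransportOperator

open Coordinates Vec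

variable {M M' : ParabolicDomain.{u}} {L : M.T → M.X → (M.X → ℝ) → ℝ}

theorem LocalForm.contMDiffAt_coeffs (D : LocalForm M L) {p : M.N} (hp : p ∈ D.W) :
    ParabolicCoeffs.ContMDiffAt M.I D.coeffs p :=
  ⟨fun i j => (D.contMDiffOn_b i j).contMDiffAt (D.isOpen_W.mem_nhds hp),
    fun i j => (D.contMDiffOn_c i j).contMDiffAt (D.isOpen_W.mem_nhds hp),
    fun i => (D.contMDiffOn_β i).contMDiffAt (D.isOpen_W.mem_nhds hp),
    D.contMDiffOn_q.contMDiffAt (D.isOpen_W.mem_nhds hp)⟩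

variable (Φ : Diffeomorph M.I M'.I M.N M'.N ∞) {t' : M.T → M'.T}
  {x' : M.T × M.X → M'.X} {u' : M.N → M'.Ω}

/-- The coefficients, in the local coordinates `φ'`, of the image under the diffeomorphism `Φ` of a
parabolic equation given in local form. -/
noncomputable def LocalForm.transportCoeffs (D : LocalForm M L)
    {φ' : OpenPartialHomeomorph M'.X (EuclideanSpace ℝ (Fin M'.n))}
    (hφ' : φ' ∈ IsManifold.maximalAtlas (𝓡 M'.n) ∞ M'.X) (p : M'.N) : ParabolicCoeffs M'.n :=
  (D.coeffs (Φ.symm p)).transport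
    (fderiv ℝ (D.coord.rep (prodCoordinates hφ') Φ) (D.coord.toPartialEquiv (Φ.symm p)))
    (fderiv ℝ (fderiv ℝ (D.coord.rep (prodCoordinates hφ') Φ)) (D.coord.toPartialEquiv (Φ.symm p)))

/-- The operator whose solutions are the images under the diffeomorphism `Φ` of the solutions of
`u_t = L u`. It is defined by an arbitrary choice of local forms; its values on functions `v` with
`v x ∉ Ω` have no meaning. -/
noncomputable def IsParabolicOperator.transportOperator (hL : IsParabolicOperator M L)
    (t : M'.T) (x : M'.X) (v : M'.X → ℝ) : ℝ :=
  ((hL.exists_localForm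
    (Φ.symm (t, x, Opens.retract M'.isConnected_Ω.nonempty (v x)))).choose.transportCoeffs
    Φ (IsManifold.chart_mem_maximalAtlas (I := 𝓡 M'.n) (n := ∞) x)
      (t, x, Opens.retract M'.isConnected_Ω.nonempty (v x))).eval
    (v ∘ (chartAt (EuclideanSpace ℝ (Fin M'.n)) x).symm)
    (chartAt (EuclideanSpace ℝ (Fin M'.n)) x x)

variable (D : LocalForm M L) {φ' : OpenPartialHomeomorph M'.X (EuclideanSpace ℝ (Fin M'.n))}
    (hφ' : φ' ∈ IsManifold.maximalAtlas (𝓡 M'.n) ∞ M'.X) (hF : HasTriangularForm Φ t' x' u')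
    (ht : StrictMono t')

include hF ht

theorem LocalForm.isTriangularAt {p : M'.N} (hp : Φ.symm p ∈ D.W)
    (hp' : p.2.1 ∈ φ'.source) : IsTriangularAt
    (fderiv ℝ (D.coord.rep (prodCoordinates hφ') Φ) (D.coord.toPartialEquiv (Φ.symm p)))
    (fderiv ℝ (fderiv ℝ (D.coord.rep (prodCoordinates hφ') Φ))
      (D.coord.toPartialEquiv (Φ.symm p))) :=
  hF.isTriangularAt D.mem_maximalAtlas hφ' Φ ht (D.mem_source _ hp)
    (by rwa [Φ.apply_symm_apply])

theorem LocalForm.contMDiffAt_transportCoeffs {p : M'.N} (hp : Φ.symm p ∈ D.W)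
    (hp' : p.2.1 ∈ φ'.source) :
    ParabolicCoeffs.ContMDiffAt M'.I (D.transportCoeffs Φ hφ') p := by
  have hG : ContMDiffAt M'.I M.I ∞ Φ.symm p := Φ.symm.contMDiff.contMDiffAt
  have hx := D.mem_coord_source hp
  set R := D.coord.rep (prodCoordinates hφ') Φ
  have hR : ContDiffAt ℝ ∞ R (D.coord.toPartialEquiv (Φ.symm p)) :=
    contDiffAt_rep hx (e' := prodCoordinates hφ')
      (by rw [Φ.apply_symm_apply]; exact hp') Φ.contMDiff.contMDiffAt
  have hD : ContDiffAt ℝ ∞ (fderiv ℝ R) (D.coord.toPartialEquiv (Φ.symm p)) :=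
    hR.fderiv_right (m := ∞) (by simp)
  have hK : ContDiffAt ℝ ∞ (fderiv ℝ (fderiv ℝ R)) (D.coord.toPartialEquiv (Φ.symm p)) :=
    hD.fderiv_right (m := ∞) (by simp)
  have he : ContMDiffAt M'.I 𝓘(ℝ, Vec M.n) ∞ (fun y => D.coord.toPartialEquiv (Φ.symm y)) p :=
    (contMDiffAt_toFun hx).comp p hG
  have hk := D.contMDiffAt_coeffs hp
  refine ParabolicCoeffs.ContMDiffAt.transport (k := fun y => D.coeffs (Φ.symm y))
    ⟨fun i j => (hk.b i j).comp p hG, fun i j => (hk.c i j).comp p hG, fun i => (hk.β i).comp p hG,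
      hk.q.comp p hG⟩ (fun l v => ?_) (fun l v w => ?_)
    (D.isTriangularAt Φ hφ' hF ht hp hp')
  · exact ContMDiffAt.comp p (g := fun z => l (fderiv ℝ R z v)) (contMDiffAt_iff_contDiffAt.2
      ((contDiffAt_const (c := l)).clm_apply (hD.clm_apply contDiffAt_const))) he
  · exact ContMDiffAt.comp p (g := fun z => l (fderiv ℝ (fderiv ℝ R) z v w))
      (contMDiffAt_iff_contDiffAt.2 ((contDiffAt_const (c := l)).clm_apply
        ((hK.clm_apply contDiffAt_const).clm_apply contDiffAt_const))) he

/-- The transported coefficients describe the hypersurfaces whose preimages are solutions, at the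
given point, of the original equation. -/
theorem LocalForm.preimage_jet_mem_graphEquation_iff {S : PointedSubmanifold M'.I M'.N ℝ}
    (hp : Φ.symm S.pt ∈ D.W) (hp' : S.pt.2.1 ∈ φ'.source) {f : M'.N → ℝ}
    (hf : IsLocalEquation M'.I f S.carrier S.pt) :
    (S.preimage Φ.isSmoothSubmersion (Φ.symm S.pt) (Φ.apply_symm_apply _)).jet 2 ∈
        graphEquation M L ↔
      (prodCoordinates hφ').d1 f S.pt eu ≠ 0 ∧
        (D.transportCoeffs Φ hφ' S.pt).symb ((prodCoordinates hφ').d1 f S.pt)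
          ((prodCoordinates hφ').d2 f S.pt) = 0 := by
  have hT := D.isTriangularAt Φ hφ' hF ht hp hp'
  have hx := D.mem_coord_source hp
  have hpt := Φ.apply_symm_apply S.pt
  have hf' : IsLocalEquation M'.I f S.carrier (Φ (Φ.symm S.pt)) := by rwa [hpt]
  have hx' : Φ (Φ.symm S.pt) ∈ (prodCoordinates hφ').source := by rw [hpt]; exact hp'
  rw [D.jet_mem_graphEquation_iff
    (S := S.preimage Φ.isSmoothSubmersion (Φ.symm S.pt) (Φ.apply_symm_apply _)) hp
    (hf'.comp Φ.isSmoothSubmersion)]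
  have c1 := d1_comp hx hx' Φ.contMDiff.contMDiffAt hf'.contMDiffAt
  have c2 : D.coord.d2 (f ∘ Φ) (Φ.symm S.pt) = pullHess _ _ _ _ :=
    ContinuousLinearMap.ext fun a => ContinuousLinearMap.ext fun b =>
      d2_comp hx hx' Φ.contMDiff.contMDiffAt hf'.contMDiffAt a b
  rw [hpt] at c1 c2
  change D.coord.d1 (f ∘ Φ) (Φ.symm S.pt) eu ≠ 0 ∧ (D.coeffs (Φ.symm S.pt)).symb
    (D.coord.d1 (f ∘ Φ) (Φ.symm S.pt)) (D.coord.d2 (f ∘ Φ) (Φ.symm S.pt)) = 0 ↔ _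
  rw [c1, c2]
  set α := (prodCoordinates hφ').d1 f S.pt
  set D₁ := fderiv ℝ (D.coord.rep (prodCoordinates hφ') Φ) (D.coord.toPartialEquiv (Φ.symm S.pt))
    with hD₁
  have hu : D₁ eu = du (D₁ eu) • eu := by
    refine Prod.ext ?_ (Prod.ext ?_ ?_)
    · refine hT.dt_eu.trans ?_
      simp [eu]
    · ext l
      refine (hT.dx_eu l).trans ?_
      simp [eu]
    · change du (D₁ eu) = du (D₁ eu) * 1
      rw [mul_one]
  have hαu : α.comp D₁ eu = du (D₁ eu) * α eu := by
    rw [ContinuousLinearMap.comp_apply, hu, map_smul, ← hu, smul_eq_mul]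
  rw [hαu]
  refine ⟨fun h => ?_, fun h => ⟨mul_ne_zero hT.du_ne_zero h.1, ?_⟩⟩
  · have hα := right_ne_zero_of_mul h.1
    refine ⟨hα, ?_⟩
    have := hT.symb_pull (D.coeffs (Φ.symm S.pt)) hα ((prodCoordinates hφ').d2 f S.pt)
    rw [h.2] at this
    exact (mul_eq_zero.1 this.symm).resolve_left
      (mul_ne_zero (pow_ne_zero 2 hT.du_ne_zero) hT.dt_pos.ne')
  · rw [hT.symb_pull _ h.1]
    exact mul_eq_zero_of_right _ h.2

/-- The transported operator does not depend on the local form and the coordinates. -/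
theorem LocalForm.eval_transportCoeffs_eq (D₂ : LocalForm M L)
    {φ₂ : OpenPartialHomeomorph M'.X (EuclideanSpace ℝ (Fin M'.n))}
    (hφ₂ : φ₂ ∈ IsManifold.maximalAtlas (𝓡 M'.n) ∞ M'.X) {p : M'.N} (hp : Φ.symm p ∈ D.W)
    (hp' : p.2.1 ∈ φ'.source) (hp₂ : Φ.symm p ∈ D₂.W) (hp₂' : p.2.1 ∈ φ₂.source)
    {v : M'.X → ℝ} {U : Set M'.X} (hU : IsOpen U) (hpU : p.2.1 ∈ U)
    (hv : ContMDiffOn (𝓡 M'.n) 𝓘(ℝ, ℝ) ∞ v U) (hvp : v p.2.1 = p.2.2) :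
    (D.transportCoeffs Φ hφ' p).eval (v ∘ φ'.symm) (φ' p.2.1) =
      (D₂.transportCoeffs Φ hφ₂ p).eval (v ∘ φ₂.symm) (φ₂ p.2.1) := by
  set a := (D.transportCoeffs Φ hφ' p).eval (v ∘ φ'.symm) (φ' p.2.1) with ha
  -- the function which is a solution for the first choice at the given point
  let s : ℝ → M'.X → ℝ := fun τ y => v y + a * (τ - p.1)
  have hUo : IsOpen (univ ×ˢ U : Set (ℝ × M'.X)) := isOpen_univ.prod hU
  have hpU' : ((p.1 : ℝ), p.2.1) ∈ (univ ×ˢ U : Set (ℝ × M'.X)) := ⟨mem_univ _, hpU⟩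
  have hs : ContMDiffOn M'.I₀ 𝓘(ℝ, ℝ) ∞ (fun y : ℝ × M'.X => s y.1 y.2) (univ ×ˢ U) :=
    (hv.comp contMDiff_snd.contMDiffOn fun y hy => hy.2).add
      (contMDiffOn_const.mul (contMDiff_fst.contMDiffOn.sub contMDiffOn_const))
  have hsp : s p.1 = v := by
    funext y
    simp [s]
  have hder : deriv (fun τ => s τ p.2.1) p.1 = a := by
    have : HasDerivAt (fun τ => s τ p.2.1) (a * 1) p.1 :=
      (((hasDerivAt_id _).sub_const _).const_mul a).const_add _
    rw [this.deriv, mul_one]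
  have hd1 : (prodCoordinates hφ').d1 (graphFun M' s) p ≠ 0 := fun h0 => by
    have := (d1_d2_graphFun hUo hs hφ' hp' hpU').1 eu
    rw [h0] at this
    simp only [eu] at this
    rw [show ((0 : ℝ), (0 : EuclideanSpace ℝ (Fin M'.n))) = 0 from rfl, map_zero] at this
    simp at this
  obtain ⟨S, rfl, hS⟩ := PointedSubmanifold.exists_of_d1_ne_zero (e := prodCoordinates hφ') hp'
    (isOpen_graphFun_domain hUo) hpU' (contMDiffOn_graphFun hs)
    (by simp [graphFun, hsp, hvp]) hd1
  have h1 := D.preimage_jet_mem_graphEquation_iff Φ hφ' hF ht hp hp' hS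
  have h2 := D₂.preimage_jet_mem_graphEquation_iff Φ hφ₂ hF ht hp₂ hp₂' hS
  rw [symb_graphFun hUo hs hφ' hp' hpU', hder, hsp] at h1
  rw [symb_graphFun hUo hs hφ₂ hp₂' hpU', hder, hsp] at h2
  have hu : (prodCoordinates hφ').d1 (graphFun M' s) S.pt eu ≠ 0 := by
    rw [(d1_d2_graphFun hUo hs hφ' hp' hpU').1 eu]
    simp only [eu]
    rw [show ((0 : ℝ), (0 : EuclideanSpace ℝ (Fin M'.n))) = 0 from rfl, map_zero]
    simp
  exact (sub_eq_zero.1 ((h2.1 (h1.2 ⟨hu, sub_self _⟩)).2)).symm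

/-- The local form of the transported operator. -/
noncomputable def LocalForm.transport (hL : IsParabolicOperator M L) :
    LocalForm M' (hL.transportOperator Φ) where
  φ := φ'
  mem_maximalAtlas := hφ'
  W := Φ.symm ⁻¹' D.W ∩ {p | p.2.1 ∈ φ'.source}
  isOpen_W := (D.isOpen_W.preimage Φ.symm.continuous).inter
    (φ'.open_source.preimage (continuous_fst.comp continuous_snd))
  mem_source p hp := hp.2
  coeffs := D.transportCoeffs Φ hφ'
  contMDiffOn_b i j p hp :=
    ((D.contMDiffAt_transportCoeffs Φ hφ' hF ht hp.1 hp.2).b i j).contMDiffWithinAt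
  contMDiffOn_c i j p hp :=
    ((D.contMDiffAt_transportCoeffs Φ hφ' hF ht hp.1 hp.2).c i j).contMDiffWithinAt
  contMDiffOn_β i p hp :=
    ((D.contMDiffAt_transportCoeffs Φ hφ' hF ht hp.1 hp.2).β i).contMDiffWithinAt
  contMDiffOn_q p hp :=
    (D.contMDiffAt_transportCoeffs Φ hφ' hF ht hp.1 hp.2).q.contMDiffWithinAt
  posDef p hp := (D.isTriangularAt Φ hφ' hF ht hp.1 hp.2).posDef_transport (D.posDef _ hp.1)
  eq := by
    rintro ⟨t, x, y⟩ ⟨hp1, hp2⟩ v U hU hpU hv hvp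
    have hy : Opens.retract M'.isConnected_Ω.nonempty (v x) = y := by
      change v x = y at hvp
      rw [hvp, Opens.retract_coe]
    have hc := (hL.exists_localForm (Φ.symm (t, x,
      Opens.retract M'.isConnected_Ω.nonempty (v x)))).choose_spec
    rw [IsParabolicOperator.transportOperator]
    set D₂ := (hL.exists_localForm (Φ.symm (t, x,
      Opens.retract M'.isConnected_Ω.nonempty (v x)))).choose
    rw [hy] at hc ⊢
    exact D₂.eval_transportCoeffs_eq Φ _ hF ht D hφ' hc (mem_chart_source _ x) hp1 hp2 hU hpU hv hvp

theorem IsParabolicOperator.isParabolicOperator_transportOperator (hL : IsParabolicOperator M L) :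
    IsParabolicOperator M' (hL.transportOperator Φ) := by
  intro p
  obtain ⟨D, hD⟩ := hL.exists_localForm (Φ.symm p)
  let D' := D.transport Φ (IsManifold.chart_mem_maximalAtlas (I := 𝓡 M'.n) (n := ∞) p.2.1) hF ht hL
  refine ⟨D'.φ, D'.mem_maximalAtlas, D'.W, D'.isOpen_W, ⟨hD, mem_chart_source _ p.2.1⟩,
    D'.mem_source, fun p => (D'.coeffs p).b, fun p => (D'.coeffs p).c, fun p => (D'.coeffs p).β,
    fun p => (D'.coeffs p).q, D'.contMDiffOn_b, D'.contMDiffOn_c, D'.contMDiffOn_β,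
    D'.contMDiffOn_q, fun p hp => ⟨D'.posDef p hp, ?_⟩, D'.eq⟩
  exact ParabolicCoeffs.isSymm_transport_c _ _ _

/-- The preimage of a hypersurface solves the original equation iff the hypersurface solves the
transported one. -/
theorem IsParabolicOperator.preimage_jet_mem_graphEquation_iff (hL : IsParabolicOperator M L)
    (S : PointedSubmanifold M'.I M'.N ℝ) :
    (S.preimage Φ.isSmoothSubmersion (Φ.symm S.pt) (Φ.apply_symm_apply _)).jet 2 ∈
        graphEquation M L ↔ S.jet 2 ∈ graphEquation M' (hL.transportOperator Φ) := by
  obtain ⟨D, hD⟩ := hL.exists_localForm (Φ.symm S.pt)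
  have hφ' := IsManifold.chart_mem_maximalAtlas (I := 𝓡 M'.n) (n := ∞) S.pt.2.1
  have hp' := mem_chart_source (EuclideanSpace ℝ (Fin M'.n)) S.pt.2.1
  obtain ⟨f, hf⟩ := S.isSubmanifold S.pt S.pt_mem
  rw [D.preimage_jet_mem_graphEquation_iff Φ hφ' hF ht hD hp' hf,
    (D.transport Φ hφ' hF ht hL).jet_mem_graphEquation_iff ⟨hD, hp'⟩ hf]
  rfl

end TransportOperator

/-! ### The action of diffeomorphisms on jets and isomorphisms of equations -/

section JetPullback

open Coordinates

theorem taylorCoeffs_eq_of_d1_d2_eq {E H N : Type*} [NormedAddCommGroup E] [NormedSpace ℝ E]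
    [TopologicalSpace H] [TopologicalSpace N] [ChartedSpace H N] {I : ModelWithCorners ℝ E H}
    [I.Boundaryless] [IsManifold I ∞ N] {f f₁ : N → ℝ} {x : N} (h0 : f x = f₁ x)
    (h1 : (ofChart I x).d1 f x = (ofChart I x).d1 f₁ x)
    (h2 : (ofChart I x).d2 f x = (ofChart I x).d2 f₁ x) :
    taylorCoeffs I 2 x f x = taylorCoeffs I 2 x f₁ x := by
  refine Prod.ext rfl (funext fun i => ?_)
  fin_cases i
  · ext m
    change iteratedFDeriv ℝ 0 (f ∘ (extChartAt I x).symm) (extChartAt I x x) m =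
      iteratedFDeriv ℝ 0 (f₁ ∘ (extChartAt I x).symm) (extChartAt I x x) m
    simpa using h0
  · ext m
    change iteratedFDeriv ℝ 1 (f ∘ (extChartAt I x).symm) (extChartAt I x x) m =
      iteratedFDeriv ℝ 1 (f₁ ∘ (extChartAt I x).symm) (extChartAt I x x) m
    rw [iteratedFDeriv_one_apply, iteratedFDeriv_one_apply]
    exact congrArg (fun l : E →L[ℝ] ℝ => l (m 0)) h1
  · ext m
    change iteratedFDeriv ℝ 2 (f ∘ (extChartAt I x).symm) (extChartAt I x x) m =
      iteratedFDeriv ℝ 2 (f₁ ∘ (extChartAt I x).symm) (extChartAt I x x) m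
    rw [iteratedFDeriv_two_apply, iteratedFDeriv_two_apply]
    exact congrArg (fun l : E →L[ℝ] E →L[ℝ] ℝ => l (m 0) (m 1)) h2

theorem IsLocalEquation.apply_pt {E H N : Type*} [NormedAddCommGroup E] [NormedSpace ℝ E]
    [TopologicalSpace H] [TopologicalSpace N] [ChartedSpace H N] {I : ModelWithCorners ℝ E H}
    {S : PointedSubmanifold I N ℝ} {f : N → ℝ} (hf : IsLocalEquation I f S.carrier S.pt) :
    f S.pt = 0 := hf.eventually_iff.self_of_nhds.1 S.pt_mem

variable {M M' : ParabolicDomain.{u}} (Φ : Diffeomorph M.I M'.I M.N M'.N ∞)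

/-- The preimage of a pointed hypersurface under a diffeomorphism. -/
noncomputable abbrev PointedSubmanifold.pullback (S : PointedSubmanifold M'.I M'.N ℝ) :
    PointedSubmanifold M.I M.N ℝ :=
  S.preimage Φ.isSmoothSubmersion (Φ.symm S.pt) (Φ.apply_symm_apply _)

theorem IsLocalEquation.pullback {S : PointedSubmanifold M'.I M'.N ℝ} {f : M'.N → ℝ}
    (hf : IsLocalEquation M'.I f S.carrier S.pt) :
    IsLocalEquation M.I (f ∘ Φ) (S.pullback Φ).carrier (S.pullback Φ).pt := by
  refine IsLocalEquation.comp Φ.isSmoothSubmersion ?_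
  change IsLocalEquation M'.I f S.carrier (Φ (Φ.symm S.pt))
  rwa [Φ.apply_symm_apply]

theorem HaveContact.pullback {S₁ S₂ : PointedSubmanifold M'.I M'.N ℝ}
    (h : HaveContact M'.I 2 S₁ S₂) : HaveContact M.I 2 (S₁.pullback Φ) (S₂.pullback Φ) := by
  obtain ⟨hpt, f₁, f₂, h₁, h₂, ht⟩ := h
  have hpt' : (S₁.pullback Φ).pt = (S₂.pullback Φ).pt := congrArg Φ.symm hpt
  have h₂' : IsLocalEquation M'.I f₂ S₂.carrier S₂.pt := hpt ▸ h₂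
  refine ⟨hpt', f₁ ∘ Φ, f₂ ∘ Φ, h₁.pullback Φ, hpt' ▸ h₂'.pullback Φ, ?_⟩
  set κ := ofChart M.I (Φ.symm S₁.pt)
  set κ' := ofChart M'.I S₁.pt
  have hx : Φ.symm S₁.pt ∈ κ.source := mem_extChartAt_source _
  have hpx : Φ (Φ.symm S₁.pt) = S₁.pt := Φ.apply_symm_apply _
  have hx' : Φ (Φ.symm S₁.pt) ∈ κ'.source := by
    rw [hpx]
    exact mem_extChartAt_source _
  have hΦ : ContMDiffAt M.I M'.I ∞ Φ (Φ.symm S₁.pt) := Φ.contMDiff.contMDiffAt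
  have hf₁ : ContMDiffAt M'.I 𝓘(ℝ, ℝ) ∞ f₁ (Φ (Φ.symm S₁.pt)) := by rw [hpx]; exact h₁.contMDiffAt
  have hf₂ : ContMDiffAt M'.I 𝓘(ℝ, ℝ) ∞ f₂ (Φ (Φ.symm S₁.pt)) := by rw [hpx]; exact h₂.contMDiffAt
  obtain ⟨e1, e2⟩ := d1_d2_eq_of_taylorCoeffs_eq (e := κ') (mem_extChartAt_source _)
    h₁.contMDiffAt h₂.contMDiffAt ht
  refine taylorCoeffs_eq_of_d1_d2_eq ?_ ?_ ?_
  · change f₁ (Φ (Φ.symm S₁.pt)) = f₂ (Φ (Φ.symm S₁.pt))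
    rw [hpx, h₁.apply_pt, hpt, h₂'.apply_pt]
  · change κ.d1 (f₁ ∘ Φ) (Φ.symm S₁.pt) = κ.d1 (f₂ ∘ Φ) (Φ.symm S₁.pt)
    rw [d1_comp hx hx' hΦ hf₁, d1_comp hx hx' hΦ hf₂, hpx, e1]
  · change κ.d2 (f₁ ∘ Φ) (Φ.symm S₁.pt) = κ.d2 (f₂ ∘ Φ) (Φ.symm S₁.pt)
    refine ContinuousLinearMap.ext fun a => ContinuousLinearMap.ext fun b => ?_
    rw [d2_comp hx hx' hΦ hf₁, d2_comp hx hx' hΦ hf₂, hpx, e1, e2]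

/-- The action of a diffeomorphism on `2`-jets of hypersurfaces by preimages. -/
noncomputable def JetSpace.pullback : JetSpace M'.I M'.N ℝ 2 → JetSpace M.I M.N ℝ 2 :=
  Quot.lift (fun S => (S.pullback Φ).jet 2) fun _ _ h => Quot.sound (h.pullback Φ)

theorem JetSpace.continuous_pullback : Continuous (JetSpace.pullback Φ) := by
  refine JetSpace.continuous_iff.2 fun y₀ => continuous_iff_continuousAt.2 fun a₀ => ?_
  let ψ : EquippedSubmanifold M'.I ℝ y₀ → M.N := fun a => Φ.symm a.1.1.pt
  have hψ : Continuous ψ := Φ.symm.continuous.comp (EquippedSubmanifold.continuous_pt y₀)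
  let O : Set (EquippedSubmanifold M'.I ℝ y₀) := {a | ψ a ∈ (ofChart M.I (ψ a₀)).source}
  have hO : IsOpen O := (ofChart M.I (ψ a₀)).open_source.preimage hψ
  have ha₀ : a₀ ∈ O := mem_extChartAt_source (I := M.I) (ψ a₀)
  refine ContinuousOn.continuousAt (s := O) ?_ (hO.mem_nhds ha₀)
  rw [continuousOn_iff_continuous_domRestrict]
  let G : O → EquippedSubmanifold M.I ℝ (ψ a₀) := fun a =>
    ⟨(a.1.1.1.pullback Φ, a.1.1.2 ∘ Φ), by
      have := a.2
      change ψ a.1 ∈ (extChartAt M.I (ψ a₀)).source at this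
      rwa [extChartAt_source] at this, a.1.2.2.pullback Φ⟩
  have hG : Continuous G := by
    obtain ⟨c1, c2⟩ := continuousOn_d1_d2_comp Φ.contMDiff y₀ (ofChart M.I (ψ a₀)) hψ
      fun a => Φ.apply_symm_apply _
    refine continuous_induced_rng.2 (continuous_taylorCoeffs_of (f := fun a : O => a.1.1.2 ∘ Φ)
      (x := fun a : O => ψ a.1) ?_ (fun a => ?_) (continuousOn_iff_continuous_domRestrict.1 c1)
      (continuousOn_iff_continuous_domRestrict.1 c2))
    · exact (ofChart M.I (ψ a₀)).contMDiffOn_toFun.continuousOn.comp_continuous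
        (hψ.comp continuous_subtype_val) fun a => a.2
    · have hl : (extChartAt M.I (ψ a₀)).symm (extChartAt M.I (ψ a₀) (ψ a.1)) = ψ a.1 :=
        (extChartAt M.I (ψ a₀)).left_inv a.2
      rw [Function.comp_apply, hl]
      exact (a.1.2.2.pullback Φ).apply_pt
  exact (continuous_jet (ψ a₀)).comp hG

theorem JetSpace.pullback_symm_pullback (θ : JetSpace M'.I M'.N ℝ 2) :
    JetSpace.pullback Φ.symm (JetSpace.pullback Φ θ) = θ := by
  induction θ using Quot.ind with
  | mk S =>
    refine congrArg (fun S : PointedSubmanifold M'.I M'.N ℝ => S.jet 2)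
      (PointedSubmanifold.ext (Φ.apply_symm_apply S.pt) ?_)
    change Φ.symm ⁻¹' (Φ ⁻¹' S.carrier) = S.carrier
    ext y
    simp

/-- The homeomorphism of jet spaces induced by a diffeomorphism. -/
noncomputable def JetSpace.pullbackHomeomorph : JetSpace M'.I M'.N ℝ 2 ≃ₜ JetSpace M.I M.N ℝ 2 where
  toFun := JetSpace.pullback Φ
  invFun := JetSpace.pullback Φ.symm
  left_inv := JetSpace.pullback_symm_pullback Φ
  right_inv := JetSpace.pullback_symm_pullback Φ.symm
  continuous_toFun := JetSpace.continuous_pullback Φ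
  continuous_invFun := JetSpace.continuous_pullback Φ.symm

/-- A diffeomorphism which relates two sets of jets is a morphism of the equations defined by their
closures. -/
theorem Diffeomorph.isPDEMorphism_closure {A : Set (JetSpace M.I M.N ℝ 2)}
    {A' : Set (JetSpace M'.I M'.N ℝ 2)}
    (h : ∀ S : PointedSubmanifold M'.I M'.N ℝ, (S.pullback Φ).jet 2 ∈ A ↔ S.jet 2 ∈ A') :
    IsPDEMorphism M.I M'.I Φ (closure A) (closure A') where
  submersion := Φ.isSmoothSubmersion
  surjective := Φ.surjective
  mem_iff := by
    rintro θ θ' ⟨S, S', h1, h2, h3, rfl, rfl⟩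
    have hS : S = S'.pullback Φ :=
      PointedSubmanifold.ext (by
        change S.pt = Φ.symm S'.pt
        rw [h3, Φ.symm_apply_apply]) (by rw [h1, ← h2]; rfl)
    have hA : JetSpace.pullbackHomeomorph Φ ⁻¹' A = A' := by
      ext θ
      induction θ using Quot.ind with
      | mk S => exact h S
    rw [← hA, ← (JetSpace.pullbackHomeomorph Φ).preimage_closure, hS]
    rfl

theorem IsPDEMorphism.symm {𝓔 : Set (JetSpace M.I M.N ℝ 2)} {𝓔' : Set (JetSpace M'.I M'.N ℝ 2)}
    (h : IsPDEMorphism M.I M'.I Φ 𝓔 𝓔') : IsPDEMorphism M'.I M.I Φ.symm 𝓔' 𝓔 where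
  submersion := Φ.symm.isSmoothSubmersion
  surjective := Φ.symm.surjective
  mem_iff := by
    rintro θ θ' ⟨S, S', -, h2, h3, rfl, rfl⟩
    have hS : S.carrier = Φ '' S'.carrier := by
      rw [h2, image_image]
      simp
    have hS' : S'.carrier = Φ ⁻¹' (Φ '' S'.carrier) := (preimage_image_eq _ Φ.injective).symm
    exact (h.mem_iff _ _ ⟨S', S, hS', hS, by rw [h3, Φ.apply_symm_apply], rfl, rfl⟩).symm

end JetPullback

section Isomorphisms

variable {A B : ParabolicEquation.{u}}

theorem ParabolicEquation.isDiffeomorphism_of_isIso (F : A ⟶ B) [IsIso F] :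
    IsDiffeomorphism F.toFun := by
  have h1 : ∀ p, (inv F).toFun (F.toFun p) = p := fun p =>
    congrFun (congrArg ParabolicEquation.Hom.toFun (IsIso.hom_inv_id F)) p
  have h2 : ∀ p, F.toFun ((inv F).toFun p) = p := fun p =>
    congrFun (congrArg ParabolicEquation.Hom.toFun (IsIso.inv_hom_id F)) p
  exact ⟨⟨⟨F.toFun, (inv F).toFun, h1, h2⟩, F.isMorphism.submersion.1,
    (inv F).isMorphism.submersion.1⟩, fun _ => rfl⟩

/-- A morphism which is a diffeomorphism is an isomorphism. -/
noncomputable def ParabolicEquation.isoOfDiffeomorph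
    (Φ : Diffeomorph A.dom.I B.dom.I A.dom.N B.dom.N ∞)
    (h : IsPDEMorphism A.dom.I B.dom.I Φ A.eqn B.eqn) : A ≅ B where
  hom := ⟨Φ, h⟩
  inv := ⟨Φ.symm, h.symm⟩
  hom_inv_id := ParabolicEquation.Hom.ext (funext fun p => Φ.symm_apply_apply p)
  inv_hom_id := ParabolicEquation.Hom.ext (funext fun p => Φ.apply_symm_apply p)

theorem ParabolicEquation.hasTriangularForm (F : A ⟶ B) :
    ∃ t' x' u', HasTriangularForm F.toFun t' x' u' := by
  obtain ⟨M, _, L, hL, rfl⟩ := A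
  obtain ⟨M', _, L', hL', rfl⟩ := B
  exact F.isMorphism.hasTriangularForm hL hL'

theorem ParabolicEquation.isIso_iff (F : A ⟶ B) : IsIso F ↔ IsDiffeomorphism F.toFun := by
  refine ⟨fun _ => isDiffeomorphism_of_isIso F, fun ⟨Φ, hΦ⟩ => ?_⟩
  have hF : F = (isoOfDiffeomorph Φ (by
      rw [show (Φ : A.dom.N → B.dom.N) = F.toFun from funext hΦ]; exact F.isMorphism)).hom :=
    ParabolicEquation.Hom.ext (funext fun p => (hΦ p).symm)
  rw [hF]
  infer_instance

theorem ParabolicEquation.exists_iso_iff (A : ParabolicEquation.{u}) (M : ParabolicDomain.{u})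
    (F : A.dom.N → M.N) :
    (∃ (eqn : Set (JetSpace M.I M.N ℝ 2))
        (h : ∃ L, IsParabolicOperator M L ∧ eqn = closure (graphEquation M L))
        (e : A ≅ (⟨M, eqn, h⟩ : ParabolicEquation.{u})), e.hom.toFun = F) ↔
      IsDiffeomorphism F ∧ ∃ t' x' u', HasTriangularForm F t' x' u' ∧ StrictMono t' := by
  constructor
  · rintro ⟨eqn, h, e, rfl⟩
    have hd := isDiffeomorphism_of_isIso e.hom
    obtain ⟨t', x', u', ht⟩ := hasTriangularForm e.hom
    refine ⟨hd, t', x', u', ht, ?_⟩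
    obtain ⟨Φ, hΦ⟩ := hd
    have hm := e.hom.isMorphism
    have hΦ' : e.hom.toFun = Φ := (funext hΦ).symm
    obtain ⟨L', hL', rfl⟩ := h
    obtain ⟨L, hL, hA⟩ := A.isParabolic
    rw [hΦ'] at hm ht
    rw [hA] at hm
    exact hm.strictMono Φ hL hL' ht
  · rintro ⟨⟨Φ, hΦ⟩, t', x', u', hF, ht⟩
    obtain rfl : (Φ : A.dom.N → M.N) = F := funext hΦ
    obtain ⟨L, hL, hA⟩ := A.isParabolic
    refine ⟨closure (graphEquation M (hL.transportOperator Φ)),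
      ⟨_, hL.isParabolicOperator_transportOperator Φ hF ht, rfl⟩, isoOfDiffeomorph Φ ?_, rfl⟩
    rw [hA]
    exact Φ.isPDEMorphism_closure (hL.preimage_jet_mem_graphEquation_iff Φ hF ht)

end Isomorphisms

theorem mainTheorem1 :
    (∀ (A B : ParabolicEquation.{u}) (F : A ⟶ B),
      (∃ t' x' u', HasTriangularForm F.toFun t' x' u') ∧
      (IsIso F ↔
        IsDiffeomorphism F.toFun ∧ ∃ t' x' u', HasTriangularForm F.toFun t' x' u')) ∧
    (∀ (A : ParabolicEquation.{u}) (M : ParabolicDomain.{u}) (F : A.dom.N → M.N),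
      (∃ (eqn : Set (JetSpace M.I M.N ℝ 2))
          (h : ∃ L, IsParabolicOperator M L ∧ eqn = closure (graphEquation M L))
          (e : A ≅ (⟨M, eqn, h⟩ : ParabolicEquation.{u})), e.hom.toFun = F) ↔
        IsDiffeomorphism F ∧
          ∃ t' x' u', HasTriangularForm F t' x' u' ∧ StrictMono t') :=
  ⟨fun _ _ F => ⟨ParabolicEquation.hasTriangularForm F,
    (ParabolicEquation.isIso_iff F).trans
      ⟨fun h => ⟨h, ParabolicEquation.hasTriangularForm F⟩, And.left⟩⟩,
    ParabolicEquation.exists_iso_iff⟩
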